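/- **Setting.** For $h>0$ let $\Omega_h=\{x\in\mathbb R^3: -h<x_3<h\}$. For $0<R_0<R_1$ let $A_{R_0,R_1}=\{z\in\mathbb C: R_0<|z|<R_1\}$. Let $\mathcal A_V(\Omega_h,0)$ be the set of proper conformal harmonic immersions $F:A_{R_0,R_1}\to\Omega_h$ whose (stereographically projected) Gauss map $g$ takes values in $\mathbb C\setminus\{0\}$ and has winding number $0$ along the circles $|z|=r$, and whose flux is vertical, $\mathrm{Flux}(F)=\int_{F(|z|=r)}\nu\,ds=(0,0,F_3)$, where $\nu$ is the unit conormal pointing in the direction of increasing $|z|$. For such $F$ each level set $\{x_3\circ F=s\}$, $s\in(-h,h)$, is a circle $\{|z|=r_s\}$. Write $\ell(s)$ for the length of $F(\{|z|=r_s\})$. Areas and lengths are counted with multiplicity. Call $F\in\mathcal A_V(\Omega_h,0)$ a *model annulus* in $\Omega_h$ if 1. $F=X\circ T$ for an injective holomorphic map $T:A_{R_0,R_1}\to\mathbb C\setminus\{0\}$ and a map $X:\mathbb C\setminus\{0\}\to\mathbb R^3$ with $$\frac{\partial X_k}{\partial x}-i\frac{\partial X_k}{\partial y}=\phi_k,\qquad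 \phi_1=\frac{G_-^2-G_+^2}{2z},\quad \phi_2=\frac{i(G_-^2+G_+^2)}{2z},\quad \phi_3=\frac{G_-G_+}{z},$$ where $G_-(z)=a_{-1}z^{-1}+a_0+a_1z$, $G_+(z)=b_{-1}z^{-1}+b_0+b_1z$, all six coefficients are nonzero complex numbers, $a_0^2+2a_{-1}a_1=0$ and $b_0^2+2b_{-1}b_1=0$; and 2. for all $s\in(-h,h)$, $$2\Big(\frac{2\pi}{F_3}\Big)^2\ell(s)<\ell''(s)<4\Big(\frac{2\pi}{F_3}\Big)^2\ell(s).$$ Call $F$ *reflection-symmetric* if $F(R_0R_1/\bar z)=R_3F(z)$ for all $z\in A_{R_0,R_1}$, where $R_3(x_1,x_2,x_3)=(x_1,x_2,-x_3)$. **Theorem.** (a) For every $H>0$ there is a reflection-symmetric model annulus in $\Omega_H$. (b) Let $H>0$ and let $F$, parametrizing $\Sigma$, be any reflection-symmetric model annulus in $\Omega_H$, with flux $(0,0,F_3)$. Then there is $\varepsilon\in(0,H]$ such that for every $0<h<\varepsilon$ the following holds. Let $C_2$ be a $2$-fold cover, with either orientation, of a vertical catenoid that is symmetric with respect to reflection through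 $\{x_3=0\}$, such that $C_2$ has flux $(0,0,F_3)$. Then $$\mathrm{Area}(\Sigma\cap\Omega_h)<\mathrm{Area}(C_2\cap\Omega_h).$$ -/

import Mathlib

open Complex Set MeasureTheory

noncomputable section

namespace MinAnnuli

/-- Euclidean three-space; the height coordinate `x₃` is the coordinate with index `2`. -/
abbrev E3 := EuclideanSpace ℝ (Fin 3)

/-- The open round annulus `{R₀ < |z| < R₁}`. -/
def annulus (R₀ R₁ : ℝ) : Set ℂ := {z | R₀ < ‖z‖ ∧ ‖z‖ < R₁}

/-- The open slab `{-h < x₃ < h}`. -/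
def slab (h : ℝ) : Set E3 := {x | -h < x 2 ∧ x 2 < h}

/-- Reflection through the plane `{x₃ = 0}`. -/
def reflect (x : E3) : E3 := !₂[x 0, x 1, -x 2]

/-- `∂F/∂x`, with `z = x + iy`. -/
def partialX (F : ℂ → E3) (z : ℂ) : E3 := fderiv ℝ F z 1

/-- `∂F/∂y`, with `z = x + iy`. -/
def partialY (F : ℂ → E3) (z : ℂ) : E3 := fderiv ℝ F z I

/-- `φ_k = ∂F_k/∂x - i ∂F_k/∂y`. -/
def phi (F : ℂ → E3) (k : Fin 3) (z : ℂ) : ℂ :=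
  (partialX F z k : ℂ) - I * (partialY F z k : ℂ)

/-- The (stereographically projected) Gauss map `g = φ₃ / (φ₁ - i φ₂)`. -/
def gaussMap (F : ℂ → E3) (z : ℂ) : ℂ := phi F 2 z / (phi F 0 z - I * phi F 1 z)

/-- `F` restricts to a proper conformal harmonic immersion of the annulus `{R₀ < |z| < R₁}`
into the slab `{-h < x₃ < h}`. -/
structure IsMinimalAnnulus (h R₀ R₁ : ℝ) (F : ℂ → E3) : Prop where
  slab_pos : 0 < h
  inner_pos : 0 < R₀
  inner_lt_outer : R₀ < R₁
  mapsTo : MapsTo F (annulus R₀ R₁) (slab h)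
  proper : ∀ K ⊆ slab h, IsCompact K → IsCompact (annulus R₀ R₁ ∩ F ⁻¹' K)
  harmonic : InnerProductSpace.HarmonicOnNhd F (annulus R₀ R₁)
  conformal : ∀ z ∈ annulus R₀ R₁,
    ‖partialX F z‖ = ‖partialY F z‖ ∧ inner ℝ (partialX F z) (partialY F z) = 0
  immersion : ∀ z ∈ annulus R₀ R₁, partialX F z ≠ 0

/-- The Gauss map has no zeros and no poles on the annulus, and its winding number along the
circles `{|z| = r}` is `k`. -/
def HasWindingNumber (F : ℂ → E3) (R₀ R₁ : ℝ) (k : ℤ) : Prop :=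
  (∀ z ∈ annulus R₀ R₁, gaussMap F z ≠ 0) ∧
  ∀ r ∈ Ioo R₀ R₁, (∮ z in C(0, r), deriv (gaussMap F) z / gaussMap F z) = 2 * Real.pi * I * k

/-- The flux `∫ ν ds` along the image of `{|z| = r}`. At `z = r e^{iθ}` the velocity of the curve is
`dF_z(iz)`, and for a conformal immersion the outward unit conormal is `dF_z(z) / |dF_z(z)|`. -/
def flux (F : ℂ → E3) (r : ℝ) : E3 :=
  ∫ θ in (0 : ℝ)..2 * Real.pi,
    ‖fderiv ℝ F (circleMap 0 r θ) (I * circleMap 0 r θ)‖ •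
      (‖fderiv ℝ F (circleMap 0 r θ) (circleMap 0 r θ)‖⁻¹ •
        fderiv ℝ F (circleMap 0 r θ) (circleMap 0 r θ))

/-- The flux along each of the circles with radius in `S` is the vertical vector `(0, 0, F₃)`. -/
def HasVerticalFlux (F : ℂ → E3) (S : Set ℝ) (F₃ : ℝ) : Prop :=
  ∀ r ∈ S, flux F r = !₂[0, 0, F₃]

/-- The length of the image of the circle `{|z| = r}`. -/
def circleLength (F : ℂ → E3) (r : ℝ) : ℝ :=
  ∫ θ in (0 : ℝ)..2 * Real.pi, ‖fderiv ℝ F (circleMap 0 r θ) (I * circleMap 0 r θ)‖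

/-- The radius `r_s` with `{x₃ ∘ F = s} = {|z| = r_s}`. (For a proper minimal annulus the height is
an affine function of `log |z|`, so that there is exactly one such radius.) -/
def levelRadius (F : ℂ → E3) (R₀ R₁ s : ℝ) : ℝ :=
  sInf {r | r ∈ Ioo R₀ R₁ ∧ ∀ z : ℂ, ‖z‖ = r → F z 2 = s}

/-- The length `ℓ(s)` of the level curve at height `s`. -/
def levelLength (F : ℂ → E3) (R₀ R₁ s : ℝ) : ℝ := circleLength F (levelRadius F R₀ R₁ s)

/-- `2 κ² ℓ < ℓ'' < 4 κ² ℓ` on `(-h, h)`, where `κ = 2π / F₃`. -/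
def HasLengthConvexity (h R₀ R₁ F₃ : ℝ) (F : ℂ → E3) : Prop :=
  ∀ s ∈ Ioo (-h) h,
    2 * (2 * Real.pi / F₃) ^ 2 * levelLength F R₀ R₁ s < deriv (deriv (levelLength F R₀ R₁)) s ∧
    deriv (deriv (levelLength F R₀ R₁)) s < 4 * (2 * Real.pi / F₃) ^ 2 * levelLength F R₀ R₁ s

/-- `G(z) = c₋₁ z⁻¹ + c₀ + c₁ z`. -/
def laurent (cm c₀ cp : ℂ) (z : ℂ) : ℂ := cm * z⁻¹ + c₀ + cp * z

/-- `X` is a surface defined on all of `ℂ \ {0}` whose Weierstrass data come from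
`G₋ = a₋₁ z⁻¹ + a₀ + a₁ z` and `G₊ = b₋₁ z⁻¹ + b₀ + b₁ z`, that is `g = G₊ / G₋` and
`f = z⁻¹ G₋²`; all coefficients are nonzero and the constant terms of `G₋²`, `G₊²` vanish. -/
structure HasLaurentData (X : ℂ → E3) (am a₀ ap bm b₀ bp : ℂ) : Prop where
  am_ne : am ≠ 0
  a₀_ne : a₀ ≠ 0
  ap_ne : ap ≠ 0
  bm_ne : bm ≠ 0
  b₀_ne : b₀ ≠ 0
  bp_ne : bp ≠ 0
  period_a : a₀ ^ 2 + 2 * am * ap = 0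
  period_b : b₀ ^ 2 + 2 * bm * bp = 0
  differentiable : ∀ z : ℂ, z ≠ 0 → DifferentiableAt ℝ X z
  phi_one : ∀ z : ℂ, z ≠ 0 →
    phi X 0 z = 1 / 2 * z⁻¹ * (laurent am a₀ ap z ^ 2 - laurent bm b₀ bp z ^ 2)
  phi_two : ∀ z : ℂ, z ≠ 0 →
    phi X 1 z = I / 2 * z⁻¹ * (laurent am a₀ ap z ^ 2 + laurent bm b₀ bp z ^ 2)
  phi_three : ∀ z : ℂ, z ≠ 0 →
    phi X 2 z = z⁻¹ * laurent am a₀ ap z * laurent bm b₀ bp z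

/-- The annuli of winding number zero and flux `(0, 0, F₃)` in the slab `{-h < x₃ < h}` that are
conformally parametrized pieces `F = X ∘ T` of the surfaces `X` with data as in `HasLaurentData`
and whose length function satisfies the two-sided convexity estimate. -/
structure IsModelAnnulus (h R₀ R₁ F₃ : ℝ) (F : ℂ → E3) : Prop where
  minimal : IsMinimalAnnulus h R₀ R₁ F
  winding : HasWindingNumber F R₀ R₁ 0
  verticalFlux : HasVerticalFlux F (Ioo R₀ R₁) F₃
  data : ∃ (X : ℂ → E3) (am a₀ ap bm b₀ bp : ℂ) (T : ℂ → ℂ),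
    HasLaurentData X am a₀ ap bm b₀ bp ∧
    DifferentiableOn ℂ T (annulus R₀ R₁) ∧ InjOn T (annulus R₀ R₁) ∧
    (∀ z ∈ annulus R₀ R₁, T z ≠ 0) ∧ EqOn F (X ∘ T) (annulus R₀ R₁)
  convexity : HasLengthConvexity h R₀ R₁ F₃ F

/-- Symmetry of the immersed annulus with respect to reflection through `{x₃ = 0}`: the reflection
is induced by the inversion of `{R₀ < |z| < R₁}` that exchanges the two boundary circles. -/
def IsReflectionSymmetric (R₀ R₁ : ℝ) (F : ℂ → E3) : Prop :=
  ∀ z ∈ annulus R₀ R₁, F ((R₀ * R₁ : ℝ) / (starRingEnd ℂ) z) = reflect (F z)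

/-- The area of `F` restricted to `D`, counted with multiplicity: the integral over `D` of the
area element `|F_x × F_y|`. -/
def area (F : ℂ → E3) (D : Set ℂ) : ENNReal :=
  ∫⁻ z in D, ENNReal.ofReal (Real.sqrt
    (‖partialX F z‖ ^ 2 * ‖partialY F z‖ ^ 2 - inner ℝ (partialX F z) (partialY F z) ^ 2))

/-- Conformal parametrization, by `w ∈ ℂ \ {0}`, of the vertical catenoid with axis through
`(p, q, 0)` and waist circle of radius `ρ` in the plane `{x₃ = 0}`. It is symmetric with respect
to reflection through that plane. -/
def catenoid (p q ρ : ℝ) (w : ℂ) : E3 :=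
  !₂[p + ρ * Real.cosh (Real.log ‖w‖) * (w.re / ‖w‖),
     q + ρ * Real.cosh (Real.log ‖w‖) * (w.im / ‖w‖),
     ρ * Real.log ‖w‖]

/-- The `|k|`-fold cover of the catenoid, obtained by composition with `z ↦ z ^ k`; the sign of `k`
is the orientation. -/
def catenoidCover (p q ρ : ℝ) (k : ℤ) (z : ℂ) : E3 := catenoid p q ρ (z ^ k)

end MinAnnuli

end

/-!
The area of an annulus in a slab, written in the coordinates `(t, θ)` with `z = e^{t + iθ}`, is the
integral over `t` of the energies `∫ λ² dθ`, where `λ` is the speed of the circles `|z| = e^t`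
(`area_eq_lintegral`), and the length of such a circle is `∫ λ dθ`.

**Comparison.** The length estimate is strict and forces `ℓ > 0`, so every height in the slab is
attained on some circle. On two level circles the holomorphic function `z φ₃` is real, hence by the
maximum principle it is a real constant `c`; so the height is an affine function of `log |z|`, the
flux is `2πc`, and level curves are circles (`exists_eq_mul_log_add`). Reflection symmetry makes `λ`
even about the middle circle `t = t₀`, and there the radial velocity is vertical, so `λ = |c|`
(`speed_middle`). Hence the energy agrees at `t₀` to first order with that of the double catenoid of
the same flux, which is `2πc² cosh² (2 (t - t₀))`, and its second derivative is `2 |c| ∫ λ''`. The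
upper bound `ℓ'' < 4 (2π / F₃)² ℓ` at height zero says exactly that this is smaller than the
catenoid's `16πc²`, so the strict inequality holds for small `t - t₀ ≠ 0`
(`energy_lt_of_second_deriv_lt`) and can be integrated (`exists_area_lt_catenoidCover`).

**Existence.** With `G₋ = z + √2 - z⁻¹` and `G₊ = z⁻¹ + √2 - z` the complexified height is
`4 (τ - sinh (2τ) / 4)` for `τ = log z`. On the strip `|re τ| ≤ 1/2` the map `τ ↦ sinh (2τ) / 4` is
a contraction, so `τ ↦ τ - sinh (2τ) / 4` is injective there with holomorphic inverse on a smaller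
strip (`hasDerivAt_chartInv`); this yields the conformal parametrization by a round annulus in which
the height is `4 log |z|`. The Gauss map is `(1 - p) / (1 + p)` with `p = √2 sinh τ`, and `p` is
never a real number outside `(-1, 1)`, so the Gauss map has a holomorphic logarithm `L` and winding
number zero. The speed is `4 cosh (re L)`, with `re L = 0` on the unit circle, so the second
derivative of the length there is `4 ∫ (re L')²`. The substitution `θ = α - sin (2α) / 4` turns this
into a rational trigonometric integral equal to `80/3 ∫ (2 - cos 2α)⁻¹ dα`, which lies strictly
between `2` and `4` times the length `8π` (`integral_reduction`,
`integral_inv_two_sub_cos_bounds`). By continuity the length estimate holds near the unit circle,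
and a homothety makes the resulting annulus fill the slab of any prescribed height.
-/

noncomputable section

namespace MinAnnuli

/-! ### Logarithmic polar coordinates -/

/-- Logarithmic polar coordinates `(t, θ) ↦ e^{t + iθ}` on `ℂ \ {0}`. -/
def logPolar (p : ℝ × ℝ) : ℂ := exp (p.1 + p.2 * I)

/-- The derivative in the first variable of a function of `(t, θ)`. -/
def partialT (f : ℝ × ℝ → ℝ) (p : ℝ × ℝ) : ℝ := fderiv ℝ f p (1, 0)

lemma logPolar_ne_zero (p : ℝ × ℝ) : logPolar p ≠ 0 := exp_ne_zero _

lemma norm_logPolar (p : ℝ × ℝ) : ‖logPolar p‖ = Real.exp p.1 := by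
  simp [logPolar, norm_exp]

lemma circleMap_exp (t θ : ℝ) : circleMap 0 (Real.exp t) θ = logPolar (t, θ) := by
  simp [circleMap, logPolar, exp_add]

lemma circleMap_eq_logPolar {r : ℝ} (hr : 0 < r) (θ : ℝ) :
    circleMap 0 r θ = logPolar (Real.log r, θ) := by
  rw [← circleMap_exp, Real.exp_log hr]

lemma exists_logPolar_eq {z : ℂ} (hz : z ≠ 0) : logPolar (Real.log ‖z‖, arg z) = z := by
  rw [← circleMap_eq_logPolar (norm_pos_iff.2 hz), circleMap, zero_add, norm_mul_exp_arg_mul_I]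

lemma logPolar_mem_annulus {a b : ℝ} {p : ℝ × ℝ} (hp : p.1 ∈ Ioo a b) :
    logPolar p ∈ annulus (Real.exp a) (Real.exp b) := by
  simpa [annulus, norm_logPolar] using hp

lemma contDiff_logPolar {n : WithTop ℕ∞} : ContDiff ℝ n logPolar := by
  have h1 : ContDiff ℝ n (fun p : ℝ × ℝ => (p.1 : ℂ)) := ofRealCLM.contDiff.comp contDiff_fst
  have h2 : ContDiff ℝ n (fun p : ℝ × ℝ => (p.2 : ℂ)) := ofRealCLM.contDiff.comp contDiff_snd
  exact (h1.add (h2.mul contDiff_const)).cexp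

lemma hasDerivAt_logPolar_fst (t θ : ℝ) :
    HasDerivAt (fun t : ℝ => logPolar (t, θ)) (logPolar (t, θ)) t := by
  have h : HasDerivAt (fun t : ℝ => (t : ℂ) + θ * I) 1 t :=
    (hasDerivAt_id _).ofReal_comp.add_const _
  simpa [logPolar] using h.cexp

lemma hasDerivAt_logPolar_snd (t θ : ℝ) :
    HasDerivAt (fun θ : ℝ => logPolar (t, θ)) (I * logPolar (t, θ)) θ := by
  have h : HasDerivAt (fun θ : ℝ => (t : ℂ) + θ * I) (1 * I) θ :=
    ((hasDerivAt_id _).ofReal_comp.mul_const I).const_add _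
  simpa [logPolar, mul_comm] using h.cexp

lemma logPolar_add_two_pi (t θ : ℝ) : logPolar (t, θ + 2 * Real.pi) = logPolar (t, θ) := by
  simp only [logPolar]
  rw [show ((t : ℂ) + ((θ + 2 * Real.pi : ℝ) : ℂ) * I) = (t + θ * I) + 2 * Real.pi * I by
    push_cast; ring, exp_add, exp_two_pi_mul_I, mul_one]

/-! ### Integrals depending on a parameter -/

lemma isOpen_strip (a b : ℝ) : IsOpen (Ioo a b ×ˢ (univ : Set ℝ)) := isOpen_Ioo.prod isOpen_univ

lemma contDiffOn_partialT {a b : ℝ} {f : ℝ × ℝ → ℝ} {m n : WithTop ℕ∞}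
    (hf : ContDiffOn ℝ n f (Ioo a b ×ˢ univ)) (hmn : m + 1 ≤ n) :
    ContDiffOn ℝ m (partialT f) (Ioo a b ×ˢ univ) :=
  (hf.fderiv_of_isOpen (isOpen_strip a b) hmn).clm_apply contDiffOn_const

lemma hasDerivAt_partialT {a b t θ : ℝ} {f : ℝ × ℝ → ℝ}
    (hf : ContDiffOn ℝ 1 f (Ioo a b ×ˢ univ)) (ht : t ∈ Ioo a b) :
    HasDerivAt (fun t => f (t, θ)) (partialT f (t, θ)) t := by
  have h1 : HasFDerivAt f (fderiv ℝ f (t, θ)) (t, θ) :=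
    ((hf.contDiffAt ((isOpen_strip a b).mem_nhds ⟨ht, mem_univ _⟩)).differentiableAt
      one_ne_zero).hasFDerivAt
  have h2 : HasDerivAt (fun t : ℝ => (t, θ)) ((1 : ℝ), (0 : ℝ)) t :=
    (hasDerivAt_id t).prodMk (hasDerivAt_const t θ)
  exact h1.comp_hasDerivAt t h2

lemma continuous_slice {a b t : ℝ} {f : ℝ × ℝ → ℝ} (hf : ContinuousOn f (Ioo a b ×ˢ univ))
    (ht : t ∈ Ioo a b) : Continuous fun θ => f (t, θ) :=
  hf.comp_continuous (by fun_prop) fun _ => ⟨ht, mem_univ _⟩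

lemma hasDerivAt_integral_slice {a b c d t : ℝ} {f : ℝ × ℝ → ℝ}
    (hf : ContDiffOn ℝ 1 f (Ioo a b ×ˢ univ)) (ht : t ∈ Ioo a b) :
    HasDerivAt (fun t => ∫ θ in c..d, f (t, θ)) (∫ θ in c..d, partialT f (t, θ)) t := by
  have hf' : ContinuousOn (partialT f) (Ioo a b ×ˢ univ) :=
    (contDiffOn_partialT (m := 0) hf (by simp)).continuousOn
  obtain ⟨η, hη, hsub⟩ := Metric.isOpen_iff.1 isOpen_Ioo t ht
  have hK : Icc (t - η / 2) (t + η / 2) ⊆ Ioo a b := fun x hx => hsub (by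
    rw [Metric.mem_ball, Real.dist_eq, abs_lt]; constructor <;> linarith [hx.1, hx.2])
  obtain ⟨C, hC⟩ := (isCompact_Icc.prod isCompact_uIcc).exists_bound_of_continuousOn
    (hf'.mono (prod_mono hK (subset_univ (uIcc c d))))
  refine (intervalIntegral.hasDerivAt_integral_of_dominated_loc_of_deriv_le
    (F := fun t θ => f (t, θ)) (F' := fun t θ => partialT f (t, θ)) (bound := fun _ => C)
    (Icc_mem_nhds (by linarith : t - η / 2 < t) (by linarith : t < t + η / 2)) ?_
    ((continuous_slice hf.continuousOn ht).intervalIntegrable _ _)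
    (continuous_slice hf' ht).aestronglyMeasurable ?_ intervalIntegrable_const ?_).2
  · filter_upwards [isOpen_Ioo.mem_nhds ht] with x hx
    exact (continuous_slice hf.continuousOn hx).aestronglyMeasurable
  · exact Filter.Eventually.of_forall fun θ hθ x hx => hC (x, θ) ⟨hx, uIoc_subset_uIcc hθ⟩
  · exact Filter.Eventually.of_forall fun θ _ x hx => hasDerivAt_partialT hf (hK hx)

/-! ### Conformal maps and area in logarithmic polar coordinates -/

/-- The Gram determinant of two vectors. -/
def gram (v w : E3) : ℝ := ‖v‖ ^ 2 * ‖w‖ ^ 2 - inner ℝ v w ^ 2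

lemma clm_apply_eq (L : ℂ →L[ℝ] E3) (z : ℂ) : L z = z.re • L 1 + z.im • L I := by
  conv_lhs => rw [show z = z.re • (1 : ℂ) + z.im • I by simp]
  rw [map_add, map_smul, map_smul]

lemma clm_apply_I_mul (L : ℂ →L[ℝ] E3) (z : ℂ) : L (I * z) = (-z.im) • L 1 + z.re • L I := by
  rw [clm_apply_eq]; simp

/-- The Gram determinant of the images of `z` and `iz` is `|z|⁴` times that of the images of `1` and
`i`; no conformality is needed. -/
lemma gram_apply (L : ℂ →L[ℝ] E3) (z : ℂ) :
    gram (L z) (L (I * z)) = (‖z‖ ^ 2) ^ 2 * gram (L 1) (L I) := by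
  have e : ‖z‖ ^ 2 = z.re ^ 2 + z.im ^ 2 := by rw [← normSq_eq_norm_sq, normSq_apply]; ring
  rw [clm_apply_I_mul, clm_apply_eq L z, e]
  simp only [gram, ← real_inner_self_eq_norm_sq, inner_add_left, inner_add_right, inner_smul_left,
    inner_smul_right, real_inner_comm (L 1) (L I), conj_trivial]
  ring

lemma norm_conformal {L : ℂ →L[ℝ] E3} (h1 : ‖L 1‖ = ‖L I‖) (h2 : inner ℝ (L 1) (L I) = 0) (z : ℂ) :
    ‖L z‖ = ‖z‖ * ‖L 1‖ := by
  have e : ‖z‖ ^ 2 = z.re ^ 2 + z.im ^ 2 := by rw [← normSq_eq_norm_sq, normSq_apply]; ring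
  have : ‖L z‖ ^ 2 = (‖z‖ * ‖L 1‖) ^ 2 := by
    rw [clm_apply_eq, mul_pow, e]
    have h3 : inner ℝ (L I) (L I) = inner ℝ (L 1) (L 1) := by
      rw [real_inner_self_eq_norm_sq, real_inner_self_eq_norm_sq, h1]
    simp only [← real_inner_self_eq_norm_sq, inner_add_left, inner_add_right, inner_smul_left,
      inner_smul_right, real_inner_comm (L 1) (L I), conj_trivial, h2, h3]
    ring
  exact (pow_left_inj₀ (norm_nonneg _) (by positivity) two_ne_zero).1 this

/-- Area in logarithmic polar coordinates: the density is the area of the parallelogram spanned by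
the two coordinate velocities. -/
lemma area_eq_lintegral (F : ℂ → E3) {D : Set ℂ} {a b : ℝ} (hD : MeasurableSet D)
    (h : ∀ z : ℂ, z ≠ 0 → (z ∈ D ↔ Real.log ‖z‖ ∈ Ioo a b))
    {J : ℝ × ℝ → ℝ}
    (hJ : ∀ t ∈ Ioo a b, ∀ θ, Real.sqrt (gram (fderiv ℝ F (logPolar (t, θ)) (logPolar (t, θ)))
      (fderiv ℝ F (logPolar (t, θ)) (I * logPolar (t, θ)))) = J (t, θ))
    (hJc : ContinuousOn J (Ioo a b ×ˢ univ)) :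
    area F D = ∫⁻ t in Ioo a b, ∫⁻ θ in Ioo (-Real.pi) Real.pi, ENNReal.ofReal (J (t, θ)) := by
  have hset : MeasurableSet (Ioo (Real.exp a) (Real.exp b) ×ˢ Ioo (-Real.pi) Real.pi) :=
    measurableSet_Ioo.prod measurableSet_Ioo
  have hlog : ∀ r : ℝ, 0 < r → (r ∈ Ioo (Real.exp a) (Real.exp b) ↔ Real.log r ∈ Ioo a b) := by
    intro r hr
    simp only [mem_Ioo, Real.lt_log_iff_exp_lt hr, Real.log_lt_iff_lt_exp hr]
  have step1 : area F D = ∫⁻ p in Ioo (Real.exp a) (Real.exp b) ×ˢ Ioo (-Real.pi) Real.pi,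
      ENNReal.ofReal (p.1⁻¹ * J (Real.log p.1, p.2)) := by
    rw [area, ← lintegral_indicator hD, ← Complex.lintegral_comp_polarCoord_symm,
      ← lintegral_indicator hset, ← lintegral_indicator polarCoord.open_target.measurableSet]
    congr 1
    ext p
    by_cases hp : p ∈ polarCoord.target
    · have hr : 0 < p.1 := hp.1
      have hz : Complex.polarCoord.symm p = logPolar (Real.log p.1, p.2) := by
        rw [← circleMap_eq_logPolar hr, Complex.polarCoord_symm_apply, circleMap, zero_add,
          exp_mul_I]
        simp
      have hn : ‖logPolar (Real.log p.1, p.2)‖ = p.1 := by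
        rw [norm_logPolar, Real.exp_log hr]
      rw [indicator_of_mem hp, hz]
      by_cases hr' : Real.log p.1 ∈ Ioo a b
      · have h1 : logPolar (Real.log p.1, p.2) ∈ D :=
          (h _ (logPolar_ne_zero _)).2 (by rwa [hn])
        have h2 : p ∈ Ioo (Real.exp a) (Real.exp b) ×ˢ Ioo (-Real.pi) Real.pi :=
          ⟨(hlog _ hr).2 hr', hp.2⟩
        rw [indicator_of_mem h1, indicator_of_mem h2, ← hJ _ hr' p.2, gram_apply, hn,
          Real.sqrt_mul (by positivity), Real.sqrt_sq (by positivity), smul_eq_mul,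
          ← ENNReal.ofReal_mul hr.le]
        congr 1
        simp only [gram, partialX, partialY]
        field_simp
      · have h1 : logPolar (Real.log p.1, p.2) ∉ D := fun hD' =>
          hr' (by simpa [hn] using (h _ (logPolar_ne_zero _)).1 hD')
        have h2 : p ∉ Ioo (Real.exp a) (Real.exp b) ×ˢ Ioo (-Real.pi) Real.pi :=
          fun h2 => hr' ((hlog _ hr).1 h2.1)
        rw [indicator_of_notMem h1, indicator_of_notMem h2, smul_zero]
    · have h2 : p ∉ Ioo (Real.exp a) (Real.exp b) ×ˢ Ioo (-Real.pi) Real.pi :=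
        fun h2 => hp ⟨(Real.exp_pos a).trans h2.1.1, h2.2⟩
      rw [indicator_of_notMem hp, indicator_of_notMem h2]
  have hcont : ContinuousOn (fun p : ℝ × ℝ => p.1⁻¹ * J (Real.log p.1, p.2))
      (Ioo (Real.exp a) (Real.exp b) ×ˢ Ioo (-Real.pi) Real.pi) := by
    have hne : ∀ p ∈ Ioo (Real.exp a) (Real.exp b) ×ˢ Ioo (-Real.pi) Real.pi, p.1 ≠ 0 :=
      fun p hp => ((Real.exp_pos a).trans hp.1.1).ne'
    refine (continuousOn_fst.inv₀ hne).mul (hJc.comp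
      ((continuousOn_fst.log hne).prodMk continuousOn_snd) fun p hp => ⟨?_, mem_univ _⟩)
    exact (hlog _ ((Real.exp_pos a).trans hp.1.1)).1 hp.1
  rw [step1, Measure.volume_eq_prod, ← Measure.prod_restrict, lintegral_prod _ (by
    rw [Measure.prod_restrict, ← Measure.volume_eq_prod]
    exact (hcont.aemeasurable hset).ennreal_ofReal)]
  have himage : Real.exp '' Ioo a b = Ioo (Real.exp a) (Real.exp b) := by
    ext r
    constructor
    · rintro ⟨t, ht, rfl⟩
      exact ⟨Real.exp_lt_exp.2 ht.1, Real.exp_lt_exp.2 ht.2⟩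
    · intro hr
      have h0 : 0 < r := (Real.exp_pos a).trans hr.1
      exact ⟨Real.log r, (hlog r h0).1 hr, Real.exp_log h0⟩
  rw [← himage, lintegral_image_eq_lintegral_abs_deriv_mul measurableSet_Ioo
    (fun t _ => (Real.hasDerivAt_exp t).hasDerivWithinAt) Real.exp_injective.injOn]
  refine setLIntegral_congr_fun measurableSet_Ioo fun t _ => ?_
  simp only
  rw [← lintegral_const_mul' _ _ ENNReal.ofReal_ne_top]
  refine lintegral_congr fun θ => ?_
  rw [← ENNReal.ofReal_mul (abs_nonneg _), Real.log_exp, abs_of_pos (Real.exp_pos t), ← mul_assoc,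
    mul_inv_cancel₀ (Real.exp_pos t).ne', one_mul]

lemma lintegral_slice_eq {g : ℝ → ℝ} (hg : Continuous g) (h0 : ∀ θ, 0 ≤ g θ)
    (hper : Function.Periodic g (2 * Real.pi)) :
    ∫⁻ θ in Ioo (-Real.pi) Real.pi, ENNReal.ofReal (g θ) =
      ENNReal.ofReal (∫ θ in (0 : ℝ)..2 * Real.pi, g θ) := by
  have h := hper.intervalIntegral_add_eq 0 (-Real.pi)
  rw [zero_add, show -Real.pi + 2 * Real.pi = Real.pi by ring] at h
  have hi : Integrable g (volume.restrict (Ioc (-Real.pi) Real.pi)) :=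
    (hg.intervalIntegrable _ _).1
  rw [h, intervalIntegral.integral_of_le (by linarith [Real.pi_pos]),
    ofReal_integral_eq_lintegral_ofReal hi (Filter.Eventually.of_forall h0),
    restrict_Ioo_eq_restrict_Ioc]

lemma lintegral_Ioo_ofReal {M : ℝ → ℝ} {a b : ℝ} (hab : a ≤ b) (hM : ContinuousOn M (Icc a b))
    (h0 : ∀ t ∈ Icc a b, 0 ≤ M t) :
    ∫⁻ t in Ioo a b, ENNReal.ofReal (M t) = ENNReal.ofReal (∫ t in a..b, M t) := by
  have hi : Integrable M (volume.restrict (Ioc a b)) :=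
    hM.integrableOn_Icc.mono_set Ioc_subset_Icc_self
  rw [intervalIntegral.integral_of_le hab, ofReal_integral_eq_lintegral_ofReal hi
      ((ae_restrict_iff' measurableSet_Ioc).2
        (Filter.Eventually.of_forall fun t ht => h0 t (Ioc_subset_Icc_self ht))),
    restrict_Ioo_eq_restrict_Ioc]

/-! ### The height function -/

lemma isOpen_annulus (R₀ R₁ : ℝ) : IsOpen (annulus R₀ R₁) :=
  (isOpen_lt continuous_const continuous_norm).inter (isOpen_lt continuous_norm continuous_const)

/-- The imaginary part of a function holomorphic on an annulus vanishes between two circles on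
which it vanishes. -/
lemma im_eq_zero_between {W : ℂ → ℂ} {R₀ R₁ r₁ r₂ : ℝ} (hW : DifferentiableOn ℂ W (annulus R₀ R₁))
    (h1 : R₀ < r₁) (h2 : r₂ < R₁) (hz1 : ∀ z : ℂ, ‖z‖ = r₁ → (W z).im = 0)
    (hz2 : ∀ z : ℂ, ‖z‖ = r₂ → (W z).im = 0) {z : ℂ} (hz : z ∈ annulus r₁ r₂) : (W z).im = 0 := by
  have hcl : closure (annulus r₁ r₂) ⊆ {z | r₁ ≤ ‖z‖ ∧ ‖z‖ ≤ r₂} := by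
    refine closure_minimal (fun z hz => ⟨hz.1.le, hz.2.le⟩) ?_
    exact (isClosed_le continuous_const continuous_norm).inter
      (isClosed_le continuous_norm continuous_const)
  have hfr : ∀ z ∈ frontier (annulus r₁ r₂), (W z).im = 0 := by
    intro z hz
    rw [(isOpen_annulus r₁ r₂).frontier_eq] at hz
    have h := hcl hz.1
    by_cases h3 : r₁ = ‖z‖
    · exact hz1 z h3.symm
    by_cases h4 : ‖z‖ = r₂
    · exact hz2 z h4
    · exact absurd ⟨lt_of_le_of_ne h.1 h3, lt_of_le_of_ne h.2 h4⟩ hz.2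
  have hbd : Bornology.IsBounded (annulus r₁ r₂) :=
    (Metric.isBounded_closedBall (x := (0 : ℂ)) (r := r₂)).subset fun z hz => by
      simpa using hz.2.le
  have hWc : DifferentiableOn ℂ W (closure (annulus r₁ r₂)) :=
    hW.mono fun z hz => ⟨h1.trans_le (hcl hz).1, (hcl hz).2.trans_lt h2⟩
  -- the maximum principle for `exp (-k i W)`, whose norm is `exp (k im W)`
  have key : ∀ k : ℝ, k * (W z).im ≤ 0 := by
    intro k
    have hd : DiffContOnCl ℂ (fun z => exp (-(k * I) * W z)) (annulus r₁ r₂) :=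
      (hWc.const_mul (-(k * I))).cexp.diffContOnCl
    have := Complex.norm_le_of_forall_mem_frontier_norm_le hbd hd (C := 1)
      (fun w hw => by simp [norm_exp, hfr w hw]) (subset_closure hz)
    simpa [norm_exp] using this
  linarith [key 1, key (-1)]

/-- A harmonic function on an annulus that is constant on each of two circles is an affine function
of `log |z|`. -/
lemma exists_eq_mul_log_add {u : ℂ → ℝ} {R₀ R₁ r₁ r₂ s₁ s₂ : ℝ} (h0 : 0 < R₀)
    (hu : InnerProductSpace.HarmonicOnNhd u (annulus R₀ R₁))
    (h1 : R₀ < r₁) (h12 : r₁ < r₂) (h2 : r₂ < R₁)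
    (hs1 : ∀ z : ℂ, ‖z‖ = r₁ → u z = s₁) (hs2 : ∀ z : ℂ, ‖z‖ = r₂ → u z = s₂) :
    ∃ c d : ℝ, ∀ z ∈ annulus R₀ R₁, u z = c * Real.log ‖z‖ + d := by
  set W : ℂ → ℂ := fun z => z * (fderiv ℝ u z 1 - I * fderiv ℝ u z I) with hWdef
  have hW : DifferentiableOn ℂ W (annulus R₀ R₁) := fun z hz =>
    (differentiableAt_id.mul
      (HarmonicAt.differentiableAt_complex_partial (hu z hz))).differentiableWithinAt
  have hlin : ∀ z v : ℂ, fderiv ℝ u z v = v.re * fderiv ℝ u z 1 + v.im * fderiv ℝ u z I := by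
    intro z v
    conv_lhs => rw [show v = v.re • (1 : ℂ) + v.im • I by simp]
    rw [map_add, map_smul, map_smul, smul_eq_mul, smul_eq_mul]
  have hWim : ∀ z, (W z).im = -fderiv ℝ u z (I * z) := by
    intro z
    rw [hlin z (I * z)]
    simp [hWdef]
  have hWre : ∀ z, (W z).re = fderiv ℝ u z z := by
    intro z
    rw [hlin z z]
    simp [hWdef]
  have hdiff : ∀ z ∈ annulus R₀ R₁, DifferentiableAt ℝ u z := fun z hz =>
    (hu z hz).1.differentiableAt two_ne_zero
  have hcirc : ∀ r s : ℝ, R₀ < r → r < R₁ → (∀ z : ℂ, ‖z‖ = r → u z = s) →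
      ∀ z : ℂ, ‖z‖ = r → (W z).im = 0 := by
    intro r s hr hr' hs z hz
    have hz0 : z ≠ 0 := by rintro rfl; simp at hz; linarith
    have hd1 := (hdiff z ⟨by linarith, by linarith⟩).hasFDerivAt
    rw [← exists_logPolar_eq hz0] at hd1
    have hd2 := hd1.comp_hasDerivAt _ (hasDerivAt_logPolar_snd (Real.log ‖z‖) (arg z))
    have hconst : (u ∘ fun θ : ℝ => logPolar (Real.log ‖z‖, θ)) = fun _ => s := by
      ext θ
      refine hs _ ?_
      rw [norm_logPolar, Real.exp_log (norm_pos_iff.2 hz0), hz]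
    rw [hconst, exists_logPolar_eq hz0] at hd2
    rw [hWim, hd2.unique (hasDerivAt_const _ _), neg_zero]
  have hbetween : ∀ z ∈ annulus r₁ r₂, (W z).im = 0 := fun z hz =>
    im_eq_zero_between hW h1 h2 (hcirc r₁ s₁ h1 (h12.trans h2) hs1)
      (hcirc r₂ s₂ (h1.trans h12) h2 hs2) hz
  -- a real-valued holomorphic function is locally constant
  obtain ⟨r, hr1, hr2⟩ := exists_between h12
  have hr0 : 0 < r := h0.trans (h1.trans hr1)
  have hrm : (r : ℂ) ∈ annulus r₁ r₂ := by simp [annulus, abs_of_pos hr0, hr1, hr2]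
  obtain ⟨ρ, hρ, hball⟩ := Metric.isOpen_iff.1 (isOpen_annulus r₁ r₂) _ hrm
  have hsub : annulus r₁ r₂ ⊆ annulus R₀ R₁ := fun z hz => ⟨h1.trans hz.1, hz.2.trans h2⟩
  have hWan : AnalyticOnNhd ℂ W (annulus R₀ R₁) := hW.analyticOnNhd (isOpen_annulus _ _)
  have hloc : ∃ w, ∀ z ∈ Metric.ball (r : ℂ) ρ, W z = w := by
    rcases (hWan.mono (hball.trans hsub)).is_constant_or_isOpen
      (convex_ball _ _).isPreconnected with h | h
    · exact h
    · exfalso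
      have ho := h _ Subset.rfl Metric.isOpen_ball
      obtain ⟨η, hη, hη'⟩ := Metric.isOpen_iff.1 ho _ (mem_image_of_mem W (Metric.mem_ball_self hρ))
      have hm : W r + (η / 2 : ℝ) * I ∈ W '' Metric.ball (r : ℂ) ρ := hη' (by
        rw [Metric.mem_ball, dist_eq_norm, add_sub_cancel_left, norm_mul, norm_I, mul_one,
          norm_real, Real.norm_eq_abs, abs_of_pos (half_pos hη)]
        linarith)
      obtain ⟨z, hz, hz'⟩ := hm
      have := congrArg Complex.im hz'
      rw [hbetween z (hball hz)] at this
      simp [hbetween _ hrm] at this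
      linarith
  obtain ⟨w, hw⟩ := hloc
  -- continuation to the whole annulus, in the coordinate `log z`
  set S : Set ℂ := re ⁻¹' Ioo (Real.log R₀) (Real.log R₁) with hS
  have hSo : IsOpen S := isOpen_Ioo.preimage continuous_re
  have hSc : IsPreconnected S :=
    ((convex_Ioo (Real.log R₀) (Real.log R₁)).linear_preimage reLm).isPreconnected
  have hR1 : 0 < R₁ := h0.trans (h1.trans (h12.trans h2))
  have hSm : ∀ σ ∈ S, exp σ ∈ annulus R₀ R₁ := fun σ hσ => by
    have hσ' : Real.log R₀ < σ.re ∧ σ.re < Real.log R₁ := hσ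
    simpa [annulus, norm_exp, ← Real.log_lt_iff_lt_exp h0, ← Real.lt_log_iff_exp_lt hR1] using hσ'
  have hcon : EqOn (W ∘ exp) (fun _ => w) S := by
    refine AnalyticOnNhd.eqOn_of_preconnected_of_eventuallyEq (z₀ := ((Real.log r : ℝ) : ℂ))
      (hWan.comp (fun σ _ => analyticAt_cexp) hSm) (fun σ _ => analyticAt_const) hSc ?_ ?_
    · exact ⟨by simpa using Real.log_lt_log h0 (h1.trans hr1),
        by simpa using Real.log_lt_log hr0 (hr2.trans h2)⟩
    · have : exp ((Real.log r : ℝ) : ℂ) = r := by rw [← ofReal_exp, Real.exp_log hr0]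
      have hc := continuous_exp.continuousAt.preimage_mem_nhds
        (by rw [this]; exact Metric.ball_mem_nhds (r : ℂ) hρ :
          Metric.ball (r : ℂ) ρ ∈ nhds (exp ((Real.log r : ℝ) : ℂ)))
      filter_upwards [hc] with σ hσ using hw _ hσ
  have hwim : w.im = 0 := by
    rw [← hw r (Metric.mem_ball_self hρ)]
    exact hbetween _ hrm
  -- the function `u (e ^ σ) - c re σ` has vanishing derivative
  have hfd : ∀ σ ∈ S, HasFDerivAt (fun σ => u (exp σ) - w.re * σ.re) (0 : ℂ →L[ℝ] ℝ) σ := by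
    intro σ hσ
    have hd1 := (hdiff _ (hSm σ hσ)).hasFDerivAt.comp σ
      ((Complex.hasDerivAt_exp σ).hasFDerivAt.restrictScalars ℝ)
    have hd2 := hd1.sub (reCLM.hasFDerivAt.const_mul w.re (x := σ))
    refine hd2.congr_fderiv ?_
    have hWσ : W (exp σ) = w := hcon hσ
    ext v
    have h3 : fderiv ℝ u (exp σ) (v * exp σ) = w.re * v.re := by
      have e1 : fderiv ℝ u (exp σ) (exp σ) = w.re := by rw [← hWre, hWσ]
      have e2 : fderiv ℝ u (exp σ) (I * exp σ) = 0 := by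
        have := hWim (exp σ); rw [hWσ, hwim] at this; linarith
      have : v * exp σ = v.re • exp σ + v.im • (I * exp σ) := by
        conv_lhs => rw [← re_add_im v]
        simp only [real_smul]; ring
      rw [this, map_add, map_smul, map_smul, e1, e2]
      simp [mul_comm]
    simpa [sub_eq_zero] using h3
  have hcst : ∀ σ ∈ S, u (exp σ) - w.re * σ.re =
      u (exp (Real.log r : ℝ)) - w.re * ((Real.log r : ℝ) : ℂ).re := by
    intro σ hσ
    refine hSo.is_const_of_fderiv_eq_zero (𝕜 := ℝ) (f := fun σ => u (exp σ) - w.re * σ.re) hSc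
      (fun σ hσ => (hfd σ hσ).differentiableAt.differentiableWithinAt)
      (fun σ hσ => (hfd σ hσ).fderiv) hσ ?_
    exact ⟨by simpa using Real.log_lt_log h0 (h1.trans hr1),
      by simpa using Real.log_lt_log hr0 (hr2.trans h2)⟩
  refine ⟨w.re, u (exp (Real.log r : ℝ)) - w.re * ((Real.log r : ℝ) : ℂ).re, fun z hz => ?_⟩
  have hz0 : z ≠ 0 := norm_pos_iff.1 (h0.trans hz.1)
  have hzl : (log z).re = Real.log ‖z‖ := log_re z
  have := hcst (log z) (by
    rw [hS, mem_preimage, hzl]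
    exact ⟨Real.log_lt_log h0 hz.1, Real.log_lt_log (norm_pos_iff.2 hz0) hz.2⟩)
  rw [exp_log hz0, hzl] at this
  linarith

/-! ### Curves in Euclidean three-space -/

lemma hasFDerivAt_E3 {E : Type*} [NormedAddCommGroup E] [NormedSpace ℝ E] {f : E → E3}
    {f' : E →L[ℝ] E3} {y : E} :
    HasFDerivAt f f' y ↔
      ∀ i, HasFDerivAt (fun x => f x i) ((EuclideanSpace.proj i : E3 →L[ℝ] ℝ).comp f') y := by
  simp only [← hasFDerivWithinAt_univ]
  exact hasFDerivWithinAt_euclidean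

lemma hasDerivAt_E3 {γ : ℝ → E3} {v : E3} {t : ℝ} :
    HasDerivAt γ v t ↔ ∀ i, HasDerivAt (fun t => γ t i) (v i) t := by
  simp only [hasDerivAt_iff_hasFDerivAt, hasFDerivAt_E3]
  refine forall_congr' fun i => ?_
  have : (EuclideanSpace.proj i : E3 →L[ℝ] ℝ).comp (ContinuousLinearMap.toSpanSingleton ℝ v) =
      ContinuousLinearMap.toSpanSingleton ℝ (v i) := by
    ext; simp
  rw [this]

lemma fderiv_apply_coord {F : ℂ → E3} {z : ℂ} (hF : DifferentiableAt ℝ F z) (i : Fin 3) (v : ℂ) :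
    (fderiv ℝ F z v) i = fderiv ℝ (fun z => F z i) z v := by
  rw [(hasFDerivAt_E3.1 hF.hasFDerivAt i).fderiv]
  rfl

lemma norm_sq_E3 (v : E3) : ‖v‖ ^ 2 = v 0 ^ 2 + v 1 ^ 2 + v 2 ^ 2 := by
  rw [EuclideanSpace.norm_sq_eq, Fin.sum_univ_three]
  simp

lemma inner_E3 (v w : E3) : inner ℝ v w = v 0 * w 0 + v 1 * w 1 + v 2 * w 2 := by
  rw [PiLp.inner_apply, Fin.sum_univ_three]
  simp [mul_comm]

lemma isOpen_slab (h : ℝ) : IsOpen (slab h) := by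
  have hc : Continuous fun x : E3 => x 2 := (EuclideanSpace.proj 2 : E3 →L[ℝ] ℝ).continuous
  exact (isOpen_lt continuous_const hc).inter (isOpen_lt hc continuous_const)

lemma norm_reflect (x : E3) : ‖reflect x‖ = ‖x‖ := by
  have : ‖reflect x‖ ^ 2 = ‖x‖ ^ 2 := by
    rw [norm_sq_E3, norm_sq_E3]; simp [reflect]
  exact (pow_left_inj₀ (norm_nonneg _) (norm_nonneg _) two_ne_zero).1 this

lemma hasDerivAt_reflect {γ : ℝ → E3} {v : E3} {t : ℝ} (h : HasDerivAt γ v t) :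
    HasDerivAt (fun t => reflect (γ t)) (reflect v) t := by
  have h' := hasDerivAt_E3.1 h
  refine hasDerivAt_E3.2 fun i => ?_
  fin_cases i
  · simpa [reflect] using h' 0
  · simpa [reflect] using h' 1
  · simpa [reflect] using (h' 2).fun_neg

lemma hasDerivAt_radial {F : ℂ → E3} {t θ : ℝ} (hF : DifferentiableAt ℝ F (logPolar (t, θ))) :
    HasDerivAt (fun t => F (logPolar (t, θ)))
      (fderiv ℝ F (logPolar (t, θ)) (logPolar (t, θ))) t :=
  hF.hasFDerivAt.comp_hasDerivAt t (hasDerivAt_logPolar_fst t θ)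

lemma hasDerivAt_angular {F : ℂ → E3} {t θ : ℝ} (hF : DifferentiableAt ℝ F (logPolar (t, θ))) :
    HasDerivAt (fun θ => F (logPolar (t, θ)))
      (fderiv ℝ F (logPolar (t, θ)) (I * logPolar (t, θ))) θ :=
  hF.hasFDerivAt.comp_hasDerivAt θ (hasDerivAt_logPolar_snd t θ)

/-! ### The speed of the level curves -/

/-- The speed `|∂F/∂θ|` of the circles `{|z| = e^t}`, in logarithmic polar coordinates. -/
def speed (F : ℂ → E3) (p : ℝ × ℝ) : ℝ := ‖fderiv ℝ F (logPolar p) (I * logPolar p)‖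

lemma circleLength_exp (F : ℂ → E3) (t : ℝ) :
    circleLength F (Real.exp t) = ∫ θ in (0 : ℝ)..2 * Real.pi, speed F (t, θ) := by
  simp only [circleLength, circleMap_exp, speed]

lemma speed_periodic (F : ℂ → E3) (t : ℝ) :
    Function.Periodic (fun θ => speed F (t, θ)) (2 * Real.pi) := fun θ => by
  simp only [speed, logPolar_add_two_pi]

lemma contDiffOn_speed {F : ℂ → E3} {a b : ℝ}
    (hF : ∀ z ∈ annulus (Real.exp a) (Real.exp b), ContDiffAt ℝ 3 F z)
    (h0 : ∀ p : ℝ × ℝ, p.1 ∈ Ioo a b → speed F p ≠ 0) :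
    ContDiffOn ℝ 2 (speed F) (Ioo a b ×ˢ univ) := by
  intro p hp
  have h1 : ContDiffAt ℝ 2 (fderiv ℝ F) (logPolar p) :=
    (hF _ (logPolar_mem_annulus hp.1)).fderiv_right (by norm_num)
  have h2 : ContDiffAt ℝ 2 (fun p => fderiv ℝ F (logPolar p)) p :=
    h1.comp p contDiff_logPolar.contDiffAt
  have h3 : ContDiffAt ℝ 2 (fun p => fderiv ℝ F (logPolar p) (I * logPolar p)) p :=
    h2.clm_apply (contDiffAt_const.mul contDiff_logPolar.contDiffAt)
  exact (h3.norm ℝ (norm_ne_zero_iff.1 (h0 p hp.1))).contDiffWithinAt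

namespace IsMinimalAnnulus

variable {h R₀ R₁ : ℝ} {F : ℂ → E3}

lemma contDiffAt (hF : IsMinimalAnnulus h R₀ R₁ F) {n : WithTop ℕ∞} {z : ℂ}
    (hz : z ∈ annulus R₀ R₁) : ContDiffAt ℝ n F z := by
  refine contDiffAt_euclidean.2 fun i => ?_
  have h1 := (hF.harmonic z hz).comp_CLM (EuclideanSpace.proj i : E3 →L[ℝ] ℝ)
  exact (HarmonicAt.analyticAt h1).contDiffAt

lemma differentiableAt (hF : IsMinimalAnnulus h R₀ R₁ F) {z : ℂ} (hz : z ∈ annulus R₀ R₁) :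
    DifferentiableAt ℝ F z := (hF.contDiffAt (n := 1) hz).differentiableAt one_ne_zero

lemma annulus_eq (hF : IsMinimalAnnulus h R₀ R₁ F) :
    annulus R₀ R₁ = annulus (Real.exp (Real.log R₀)) (Real.exp (Real.log R₁)) := by
  rw [Real.exp_log hF.inner_pos, Real.exp_log (hF.inner_pos.trans hF.inner_lt_outer)]

lemma logPolar_mem (hF : IsMinimalAnnulus h R₀ R₁ F) {p : ℝ × ℝ}
    (hp : p.1 ∈ Ioo (Real.log R₀) (Real.log R₁)) : logPolar p ∈ annulus R₀ R₁ := by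
  rw [hF.annulus_eq]; exact logPolar_mem_annulus hp

lemma norm_radial (hF : IsMinimalAnnulus h R₀ R₁ F) {p : ℝ × ℝ}
    (hp : p.1 ∈ Ioo (Real.log R₀) (Real.log R₁)) :
    ‖fderiv ℝ F (logPolar p) (logPolar p)‖ = speed F p := by
  obtain ⟨h1, h2⟩ := hF.conformal _ (hF.logPolar_mem hp)
  rw [speed, norm_conformal h1 h2 (logPolar p), norm_conformal h1 h2 (I * logPolar p), norm_mul,
    norm_I, one_mul]

lemma speed_pos (hF : IsMinimalAnnulus h R₀ R₁ F) {p : ℝ × ℝ}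
    (hp : p.1 ∈ Ioo (Real.log R₀) (Real.log R₁)) : 0 < speed F p := by
  obtain ⟨h1, h2⟩ := hF.conformal _ (hF.logPolar_mem hp)
  rw [← hF.norm_radial hp, norm_conformal h1 h2]
  exact mul_pos (norm_pos_iff.2 (logPolar_ne_zero p))
    (norm_pos_iff.2 (hF.immersion _ (hF.logPolar_mem hp)))

lemma contDiffOn_speed (hF : IsMinimalAnnulus h R₀ R₁ F) :
    ContDiffOn ℝ 2 (speed F) (Ioo (Real.log R₀) (Real.log R₁) ×ˢ univ) :=
  MinAnnuli.contDiffOn_speed (fun z hz => hF.contDiffAt (by rwa [hF.annulus_eq]))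
    fun _ hp => (hF.speed_pos hp).ne'

lemma sqrt_gram (hF : IsMinimalAnnulus h R₀ R₁ F) {p : ℝ × ℝ}
    (hp : p.1 ∈ Ioo (Real.log R₀) (Real.log R₁)) :
    Real.sqrt (gram (fderiv ℝ F (logPolar p) (logPolar p))
      (fderiv ℝ F (logPolar p) (I * logPolar p))) = speed F p ^ 2 := by
  obtain ⟨h1, h2⟩ := hF.conformal _ (hF.logPolar_mem hp)
  have h3 : ‖fderiv ℝ F (logPolar p) (logPolar p)‖ = ‖logPolar p‖ * ‖fderiv ℝ F (logPolar p) 1‖ :=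
    norm_conformal h1 h2 _
  have h1' : ‖fderiv ℝ F (logPolar p) 1‖ = ‖fderiv ℝ F (logPolar p) I‖ := h1
  have h2' : inner ℝ (fderiv ℝ F (logPolar p) 1) (fderiv ℝ F (logPolar p) I) = 0 := h2
  rw [gram_apply, gram, h2', ← h1', ← hF.norm_radial hp, h3,
    show (‖logPolar p‖ ^ 2) ^ 2 * (‖fderiv ℝ F (logPolar p) 1‖ ^ 2 *
      ‖fderiv ℝ F (logPolar p) 1‖ ^ 2 - 0 ^ 2) =
      ((‖logPolar p‖ * ‖fderiv ℝ F (logPolar p) 1‖) ^ 2) ^ 2 by ring, Real.sqrt_sq (by positivity)]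

end IsMinimalAnnulus

/-! ### Consequences of the length estimate -/

namespace HasLengthConvexity

variable {h R₀ R₁ F₃ : ℝ} {F : ℂ → E3}

lemma flux_ne_zero (hh : 0 < h) (hc : HasLengthConvexity h R₀ R₁ F₃ F) : F₃ ≠ 0 := by
  rintro rfl
  have := hc 0 ⟨by linarith, hh⟩
  simp at this
  linarith [this.1, this.2]

/-- Were there no level circle at height `s`, the level radius would be `0` and the length would
vanish, against the strict estimate. -/
lemma exists_level (hc : HasLengthConvexity h R₀ R₁ F₃ F) {s : ℝ}
    (hs : s ∈ Ioo (-h) h) : ∃ r ∈ Ioo R₀ R₁, ∀ z : ℂ, ‖z‖ = r → F z 2 = s := by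
  by_contra hne
  have hempty : {r | r ∈ Ioo R₀ R₁ ∧ ∀ z : ℂ, ‖z‖ = r → F z 2 = s} = ∅ := by
    ext r
    simp only [mem_ofPred_eq, mem_empty_iff_false, iff_false]
    exact fun hr => hne ⟨r, hr.1, hr.2⟩
  have h0 : levelLength F R₀ R₁ s = 0 := by
    rw [levelLength, levelRadius, hempty, Real.sInf_empty]
    simp [circleLength, circleMap]
  have := hc s hs
  rw [h0] at this
  linarith [this.1, this.2]

end HasLengthConvexity

/-! ### Second-order comparison -/

/-- A strict form of the second derivative test. -/
lemma eventually_neg_of_second_deriv_neg {D D' : ℝ → ℝ} {D'' t₀ : ℝ}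
    (h1 : ∀ᶠ t in nhds t₀, HasDerivAt D (D' t) t) (h2 : HasDerivAt D' D'' t₀)
    (hD : D t₀ = 0) (hD' : D' t₀ = 0) (hD'' : D'' < 0) :
    ∀ᶠ t in nhds t₀, t ≠ t₀ → D t < 0 := by
  -- half of the second derivative is still available after adding a small multiple of `(t - t₀)²`
  set η := -D'' / 4 with hη
  have hη0 : 0 < η := by rw [hη]; linarith
  have g1 : ∀ᶠ t in nhds t₀, HasDerivAt (fun t => D t + η * (t - t₀) ^ 2)
      (D' t + η * (2 * (t - t₀))) t := by
    filter_upwards [h1] with t ht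
    have : HasDerivAt (fun t : ℝ => η * (t - t₀) ^ 2) (η * (2 * (t - t₀))) t := by
      simpa using (((hasDerivAt_id t).sub_const t₀).pow 2).const_mul η
    exact ht.add this
  have g2 : HasDerivAt (fun t => D' t + η * (2 * (t - t₀))) (D'' + η * (2 * 1)) t₀ :=
    h2.add ((((hasDerivAt_id t₀).sub_const t₀).const_mul 2).const_mul η)
  have g3 : deriv (fun t => D t + η * (t - t₀) ^ 2) =ᶠ[nhds t₀]
      fun t => D' t + η * (2 * (t - t₀)) := by
    filter_upwards [g1] with t ht using ht.deriv
  have hmax := isLocalMax_of_deriv_deriv_neg (f := fun t => D t + η * (t - t₀) ^ 2) (x₀ := t₀)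
    (by rw [g3.deriv_eq, g2.deriv, hη]; linarith)
    (by rw [g3.eq_of_nhds]; simp [hD']) g1.self_of_nhds.continuousAt
  filter_upwards [hmax] with t ht hne
  have : 0 < η * (t - t₀) ^ 2 := mul_pos hη0 (by have := sub_ne_zero.2 hne; positivity)
  simp only [hD, sub_self] at ht
  norm_num at ht
  linarith

/-- If `ℓ` is `Λ` in the rescaled variable `t₀ + s / c`, then `ℓ'' = Λ'' / c²`. -/
lemma deriv_deriv_rescale {ℓ L L' : ℝ → ℝ} {L'' t₀ c s : ℝ}
    (hℓ : ℓ =ᶠ[nhds s] fun s => L (t₀ + s / c))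
    (h1 : ∀ᶠ t in nhds (t₀ + s / c), HasDerivAt L (L' t) t)
    (h2 : HasDerivAt L' L'' (t₀ + s / c)) : deriv (deriv ℓ) s = L'' / c ^ 2 := by
  have haff : ∀ s : ℝ, HasDerivAt (fun s : ℝ => t₀ + s / c) (1 / c) s := fun s =>
    ((hasDerivAt_id s).div_const c).const_add t₀
  have hc : ContinuousAt (fun s : ℝ => t₀ + s / c) s := (haff s).continuousAt
  have e1 : deriv ℓ =ᶠ[nhds s] fun s => L' (t₀ + s / c) * (1 / c) := by
    refine hℓ.deriv.trans ?_
    filter_upwards [hc.eventually h1] with x hx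
    exact (hx.comp x (haff x)).deriv
  have e2 : HasDerivAt (fun s => L' (t₀ + s / c) * (1 / c)) (L'' * (1 / c) * (1 / c)) s :=
    (h2.comp s (haff s)).mul_const (1 / c)
  rw [e1.deriv_eq, e2.deriv]
  by_cases h : c = 0
  · simp [h]
  · field_simp

section Square

variable {f : ℝ × ℝ → ℝ} {a b t₀ : ℝ}

lemma partialT_sq (hf : ContDiffOn ℝ 2 f (Ioo a b ×ˢ univ)) {p : ℝ × ℝ} (hp : p.1 ∈ Ioo a b) :
    partialT (fun p => f p ^ 2) p = 2 * f p * partialT f p := by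
  have h1 := hasDerivAt_partialT (θ := p.2) (hf.of_le one_le_two) hp
  have h2 := hasDerivAt_partialT (θ := p.2) (f := fun p => f p ^ 2)
    ((hf.pow 2).of_le one_le_two) hp
  rw [h2.unique (h1.fun_pow 2)]
  norm_num

lemma partialT_partialT_sq (hf : ContDiffOn ℝ 2 f (Ioo a b ×ˢ univ)) {p : ℝ × ℝ}
    (hp : p.1 ∈ Ioo a b) (h0 : partialT f p = 0) :
    partialT (partialT fun p => f p ^ 2) p = 2 * f p * partialT (partialT f) p := by
  have h1 := hasDerivAt_partialT (θ := p.2) (hf.of_le one_le_two) hp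
  have h2 := hasDerivAt_partialT (θ := p.2) (contDiffOn_partialT hf (m := 1) (by norm_num)) hp
  have h3 := hasDerivAt_partialT (θ := p.2) (f := partialT fun p => f p ^ 2)
    (contDiffOn_partialT (hf.pow 2) (m := 1) (by norm_num)) hp
  have h4 : (fun t => partialT (fun p => f p ^ 2) (t, p.2)) =ᶠ[nhds p.1]
      fun t => 2 * f (t, p.2) * partialT f (t, p.2) := by
    filter_upwards [isOpen_Ioo.mem_nhds hp] with t ht using partialT_sq hf ht
  have h5 := (h3.congr_of_eventuallyEq h4.symm).unique ((h1.const_mul 2).mul h2)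
  have h0' : partialT f (p.1, p.2) = 0 := h0
  rw [h0'] at h5
  simpa using h5

/-- A family of loops whose speed `f` is, at time `t₀`, constant and stationary. If the length has
second derivative below `4` times itself, then for small `t - t₀ ≠ 0` the energy `∫ f²` lies
strictly below the one with `f = C cosh (2 (t - t₀))`. -/
lemma energy_lt_of_second_deriv_lt {C : ℝ} (hC : 0 < C)
    (hf : ContDiffOn ℝ 2 f (Ioo a b ×ˢ univ)) (ht₀ : t₀ ∈ Ioo a b)
    (h0 : ∀ θ, f (t₀, θ) = C) (h1 : ∀ θ, partialT f (t₀, θ) = 0)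
    (h2 : ∫ θ in (0 : ℝ)..2 * Real.pi, partialT (partialT f) (t₀, θ) < 4 * (2 * Real.pi * C)) :
    ∀ᶠ t in nhds t₀, t ≠ t₀ → ∫ θ in (0 : ℝ)..2 * Real.pi, f (t, θ) ^ 2 <
      2 * Real.pi * C ^ 2 * Real.cosh (2 * (t - t₀)) ^ 2 := by
  set E : ℝ × ℝ → ℝ := fun p => f p ^ 2 with hE
  have hEs : ContDiffOn ℝ 2 E (Ioo a b ×ˢ univ) := hf.pow 2
  have hlin : ∀ t, HasDerivAt (fun t : ℝ => 2 * (t - t₀)) 2 t := fun t => by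
    simpa using ((hasDerivAt_id t).sub_const t₀).const_mul 2
  have hN : ∀ t, HasDerivAt (fun t => 2 * Real.pi * C ^ 2 * Real.cosh (2 * (t - t₀)) ^ 2)
      (2 * Real.pi * C ^ 2 * (4 * Real.cosh (2 * (t - t₀)) * Real.sinh (2 * (t - t₀)))) t := by
    intro t
    refine (((hlin t).cosh.fun_pow 2).const_mul (2 * Real.pi * C ^ 2)).congr_deriv ?_
    push_cast; ring
  have hN' : HasDerivAt (fun t => 2 * Real.pi * C ^ 2 *
      (4 * Real.cosh (2 * (t - t₀)) * Real.sinh (2 * (t - t₀)))) (2 * Real.pi * C ^ 2 * 8) t₀ := by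
    refine ((((hlin t₀).cosh.const_mul 4).mul (hlin t₀).sinh).const_mul
      (2 * Real.pi * C ^ 2)).congr_deriv ?_
    norm_num
  have hM : ∀ t ∈ Ioo a b, HasDerivAt (fun t => ∫ θ in (0 : ℝ)..2 * Real.pi, E (t, θ))
      (∫ θ in (0 : ℝ)..2 * Real.pi, partialT E (t, θ)) t := fun t ht =>
    hasDerivAt_integral_slice (hEs.of_le one_le_two) ht
  have hM' := hasDerivAt_integral_slice (c := 0) (d := 2 * Real.pi)
    (contDiffOn_partialT hEs (m := 1) (by norm_num)) ht₀
  have key := eventually_neg_of_second_deriv_neg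
    (D := fun t => (∫ θ in (0 : ℝ)..2 * Real.pi, E (t, θ)) -
      2 * Real.pi * C ^ 2 * Real.cosh (2 * (t - t₀)) ^ 2) (t₀ := t₀)
    (by filter_upwards [isOpen_Ioo.mem_nhds ht₀] with t ht using (hM t ht).sub (hN t))
    (hM'.sub hN') (by simp [hE, h0]) ?_ ?_
  · filter_upwards [key] with t ht hne using sub_neg.1 (ht hne)
  · have : ∀ θ, partialT E (t₀, θ) = 0 := fun θ => by
      rw [hE, partialT_sq hf ht₀, h1, mul_zero]
    simp [this]
  · have : ∀ θ, partialT (partialT E) (t₀, θ) = 2 * C * partialT (partialT f) (t₀, θ) :=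
      fun θ => by rw [hE, partialT_partialT_sq hf ht₀ (h1 θ), h0]
    simp only [this, intervalIntegral.integral_const_mul]
    nlinarith

end Square

/-! ### Covers of the catenoid -/

section Catenoid

variable {p q ρ : ℝ} {k : ℤ}

lemma catenoidCover_logPolar (t θ : ℝ) : catenoidCover p q ρ k (logPolar (t, θ)) =
    !₂[p + ρ * Real.cosh (k * t) * Real.cos (k * θ), q + ρ * Real.cosh (k * t) * Real.sin (k * θ),
      ρ * (k * t)] := by
  have h1 : logPolar (t, θ) ^ k = exp ((k * t : ℝ) : ℂ) * exp ((k * θ : ℝ) * I) := by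
    rw [logPolar, ← exp_int_mul, ← exp_add]; congr 1; push_cast; ring
  have h2 : ‖logPolar (t, θ) ^ k‖ = Real.exp (k * t) := by
    rw [h1, norm_mul, norm_exp_ofReal_mul_I, mul_one, ← ofReal_exp, norm_real, Real.norm_eq_abs,
      Real.abs_exp]
  have h3 : (logPolar (t, θ) ^ k).re = Real.exp (k * t) * Real.cos (k * θ) := by
    rw [h1, ← ofReal_exp, re_ofReal_mul, exp_ofReal_mul_I_re]
  have h4 : (logPolar (t, θ) ^ k).im = Real.exp (k * t) * Real.sin (k * θ) := by
    rw [h1, ← ofReal_exp, im_ofReal_mul, exp_ofReal_mul_I_im]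
  have h5 := (Real.exp_pos (k * t)).ne'
  rw [catenoidCover, catenoid, h2, h3, h4, Real.log_exp, mul_div_cancel_left₀ _ h5,
    mul_div_cancel_left₀ _ h5]

lemma differentiableAt_catenoidCover {z : ℂ} (hz : z ≠ 0) :
    DifferentiableAt ℝ (catenoidCover p q ρ k) z := by
  have h1 : DifferentiableAt ℝ (fun z : ℂ => z ^ k) z :=
    (differentiableAt_zpow.2 (Or.inl hz)).restrictScalars ℝ
  have hne : z ^ k ≠ 0 := zpow_ne_zero k hz
  have h2 : DifferentiableAt ℝ (fun z : ℂ => ‖z ^ k‖) z := h1.norm ℝ hne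
  have h3 : ‖z ^ k‖ ≠ 0 := norm_ne_zero_iff.2 hne
  have h4 : DifferentiableAt ℝ (fun z : ℂ => Real.log ‖z ^ k‖) z := h2.log h3
  have h5 : DifferentiableAt ℝ (fun z : ℂ => (z ^ k).re) z := reCLM.differentiableAt.comp z h1
  have h6 : DifferentiableAt ℝ (fun z : ℂ => (z ^ k).im) z := imCLM.differentiableAt.comp z h1
  refine differentiableAt_euclidean.2 fun i => ?_
  fin_cases i
  · simpa [catenoidCover, catenoid, div_eq_mul_inv] using
      ((h4.cosh.const_mul ρ).mul (h5.mul (h2.inv h3))).const_add p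
  · simpa [catenoidCover, catenoid, div_eq_mul_inv] using
      ((h4.cosh.const_mul ρ).mul (h6.mul (h2.inv h3))).const_add q
  · simpa [catenoidCover, catenoid] using h4.const_mul ρ

lemma catenoidCover_radial (t θ : ℝ) :
    fderiv ℝ (catenoidCover p q ρ k) (logPolar (t, θ)) (logPolar (t, θ)) =
      !₂[ρ * k * Real.sinh (k * t) * Real.cos (k * θ), ρ * k * Real.sinh (k * t) * Real.sin (k * θ),
        ρ * k] := by
  have h := hasDerivAt_radial (differentiableAt_catenoidCover (p := p) (q := q) (ρ := ρ) (k := k)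
    (logPolar_ne_zero (t, θ)))
  simp only [catenoidCover_logPolar] at h
  refine h.unique (hasDerivAt_E3.2 fun i => ?_)
  have hk : HasDerivAt (fun t : ℝ => k * t) (k : ℝ) t := by
    simpa using (hasDerivAt_id t).const_mul (k : ℝ)
  fin_cases i
  · refine (((hk.cosh.const_mul ρ).mul_const (Real.cos (k * θ))).const_add p).congr_deriv ?_
    change _ = ρ * k * Real.sinh (k * t) * Real.cos (k * θ)
    ring
  · refine (((hk.cosh.const_mul ρ).mul_const (Real.sin (k * θ))).const_add q).congr_deriv ?_
    change _ = ρ * k * Real.sinh (k * t) * Real.sin (k * θ)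
    ring
  · exact hk.const_mul ρ

lemma catenoidCover_angular (t θ : ℝ) :
    fderiv ℝ (catenoidCover p q ρ k) (logPolar (t, θ)) (I * logPolar (t, θ)) =
      !₂[-(ρ * k * Real.cosh (k * t) * Real.sin (k * θ)),
        ρ * k * Real.cosh (k * t) * Real.cos (k * θ), 0] := by
  have h := hasDerivAt_angular (differentiableAt_catenoidCover (p := p) (q := q) (ρ := ρ) (k := k)
    (logPolar_ne_zero (t, θ)))
  simp only [catenoidCover_logPolar] at h
  refine h.unique (hasDerivAt_E3.2 fun i => ?_)
  have hk : HasDerivAt (fun θ : ℝ => k * θ) (k : ℝ) θ := by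
    simpa using (hasDerivAt_id θ).const_mul (k : ℝ)
  fin_cases i
  · refine ((hk.cos.const_mul (ρ * Real.cosh (k * t))).const_add p).congr_deriv ?_
    change _ = -(ρ * k * Real.cosh (k * t) * Real.sin (k * θ))
    ring
  · refine ((hk.sin.const_mul (ρ * Real.cosh (k * t))).const_add q).congr_deriv ?_
    change _ = ρ * k * Real.cosh (k * t) * Real.cos (k * θ)
    ring
  · exact hasDerivAt_const _ _

lemma norm_catenoidCover_radial (t θ : ℝ) :
    ‖fderiv ℝ (catenoidCover p q ρ k) (logPolar (t, θ)) (logPolar (t, θ))‖ ^ 2 =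
      (ρ * k * Real.cosh (k * t)) ^ 2 := by
  rw [catenoidCover_radial, norm_sq_E3]
  simp only [Matrix.cons_val]
  linear_combination (ρ * k) ^ 2 * (Real.sinh (k * t)) ^ 2 * Real.sin_sq_add_cos_sq (k * θ) -
    (ρ * k) ^ 2 * Real.cosh_sq (k * t)

lemma norm_catenoidCover_angular (t θ : ℝ) :
    ‖fderiv ℝ (catenoidCover p q ρ k) (logPolar (t, θ)) (I * logPolar (t, θ))‖ ^ 2 =
      (ρ * k * Real.cosh (k * t)) ^ 2 := by
  rw [catenoidCover_angular, norm_sq_E3]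
  simp only [Matrix.cons_val]
  linear_combination (ρ * k * Real.cosh (k * t)) ^ 2 * Real.sin_sq_add_cos_sq (k * θ)

lemma sqrt_gram_catenoidCover (t θ : ℝ) :
    Real.sqrt (gram (fderiv ℝ (catenoidCover p q ρ k) (logPolar (t, θ)) (logPolar (t, θ)))
      (fderiv ℝ (catenoidCover p q ρ k) (logPolar (t, θ)) (I * logPolar (t, θ)))) =
      (ρ * k * Real.cosh (k * t)) ^ 2 := by
  have hin : inner ℝ (fderiv ℝ (catenoidCover p q ρ k) (logPolar (t, θ)) (logPolar (t, θ)))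
      (fderiv ℝ (catenoidCover p q ρ k) (logPolar (t, θ)) (I * logPolar (t, θ))) = 0 := by
    rw [catenoidCover_radial, catenoidCover_angular, inner_E3]
    simp only [Matrix.cons_val]
    ring
  rw [gram, hin, norm_catenoidCover_radial, norm_catenoidCover_angular,
    show ∀ x : ℝ, x * x - 0 ^ 2 = x ^ 2 by intro x; ring, Real.sqrt_sq (by positivity)]

end Catenoid

/-! ### Flux in logarithmic polar coordinates -/

/-- When the radial and angular velocities have equal norms, the normalizations in the flux
integrand cancel and the radial velocity remains. -/
lemma flux_apply {F : ℂ → E3} {t : ℝ} (i : Fin 3)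
    (hc : Continuous fun θ : ℝ => fderiv ℝ F (logPolar (t, θ)) (logPolar (t, θ)))
    (hn : ∀ θ : ℝ, ‖fderiv ℝ F (logPolar (t, θ)) (I * logPolar (t, θ))‖ =
      ‖fderiv ℝ F (logPolar (t, θ)) (logPolar (t, θ))‖) :
    flux F (Real.exp t) i =
      ∫ θ in (0 : ℝ)..2 * Real.pi, (fderiv ℝ F (logPolar (t, θ)) (logPolar (t, θ))) i := by
  have h : flux F (Real.exp t) =
      ∫ θ in (0 : ℝ)..2 * Real.pi, fderiv ℝ F (logPolar (t, θ)) (logPolar (t, θ)) := by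
    simp only [flux, circleMap_exp]
    refine intervalIntegral.integral_congr fun θ _ => ?_
    simp only [hn]
    by_cases h0 : fderiv ℝ F (logPolar (t, θ)) (logPolar (t, θ)) = 0
    · simp [h0]
    · rw [smul_smul, mul_inv_cancel₀ (norm_ne_zero_iff.2 h0), one_smul]
  rw [h]
  exact ((EuclideanSpace.proj i : E3 →L[ℝ] ℝ).intervalIntegral_comp_comm
    (hc.intervalIntegrable 0 (2 * Real.pi))).symm

lemma continuous_radial {F : ℂ → E3} {t : ℝ} (hF : ∀ θ : ℝ, ContDiffAt ℝ 1 F (logPolar (t, θ))) :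
    Continuous fun θ : ℝ => fderiv ℝ F (logPolar (t, θ)) (logPolar (t, θ)) := by
  have h0 : Continuous fun θ : ℝ => logPolar (t, θ) :=
    (contDiff_logPolar (n := 0)).continuous.comp (by fun_prop)
  refine Continuous.clm_apply (continuous_iff_continuousAt.2 fun θ => ?_) h0
  exact ((hF θ).fderiv_right (m := 0) (by norm_num)).continuousAt.comp
    (f := fun θ : ℝ => logPolar (t, θ)) h0.continuousAt

lemma flux_catenoidCover {p q ρ F₃ : ℝ} {k : ℤ}
    (h : HasVerticalFlux (catenoidCover p q ρ k) (Ioi 0) F₃) : F₃ = 2 * Real.pi * (ρ * k) := by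
  have h1 := h (Real.exp 0) (Real.exp_pos 0)
  have h2 := flux_apply (F := catenoidCover p q ρ k) (t := 0) 2
    (by
      simp only [catenoidCover_radial]
      exact (PiLp.continuous_toLp 2 _).comp (continuous_pi fun i => by
        fin_cases i <;> simp <;> fun_prop))
    (fun θ => (pow_left_inj₀ (norm_nonneg _) (norm_nonneg _) two_ne_zero).1
      ((norm_catenoidCover_angular 0 θ).trans (norm_catenoidCover_radial 0 θ).symm))
  rw [h1] at h2
  have h3 : F₃ = ρ * (2 * Real.pi * k) := by simpa [catenoidCover_radial] using h2
  rw [h3]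
  ring

lemma area_catenoidCover {p q ρ h : ℝ} {k : ℤ} (hρ : 0 < ρ) (hk : |k| = 2) (hh : 0 < h) :
    area (catenoidCover p q ρ k) ({z : ℂ | z ≠ 0} ∩ catenoidCover p q ρ k ⁻¹' slab h) =
      ENNReal.ofReal (∫ t in -(h / (2 * ρ))..h / (2 * ρ),
        2 * Real.pi * (2 * ρ) ^ 2 * Real.cosh (2 * t) ^ 2) := by
  have hk' : |(k : ℝ)| = 2 := by exact_mod_cast hk
  have hk2 : (k : ℝ) ^ 2 = 2 ^ 2 := by rw [← hk', sq_abs]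
  have hcosh : ∀ t : ℝ, Real.cosh (k * t) = Real.cosh (2 * t) := fun t => by
    rcases (abs_eq zero_le_two).1 hk' with h | h <;> rw [h]
    rw [neg_mul, Real.cosh_neg]
  have hheight : ∀ z : ℂ, z ≠ 0 → catenoidCover p q ρ k z 2 = ρ * (k * Real.log ‖z‖) := by
    intro z hz
    conv_lhs => rw [← exists_logPolar_eq hz, catenoidCover_logPolar]
    rfl
  have hD : IsOpen ({z : ℂ | z ≠ 0} ∩ catenoidCover p q ρ k ⁻¹' slab h) := by
    refine ContinuousOn.isOpen_inter_preimage (fun z hz => ?_) isOpen_ne (isOpen_slab h)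
    exact (differentiableAt_catenoidCover hz).continuousAt.continuousWithinAt
  have hτ : 0 < h / (2 * ρ) := by positivity
  rw [area_eq_lintegral (catenoidCover p q ρ k) hD.measurableSet (a := -(h / (2 * ρ)))
    (b := h / (2 * ρ)) (J := fun x => (ρ * k * Real.cosh (k * x.1)) ^ 2) ?_
    (fun t _ θ => sqrt_gram_catenoidCover t θ) (by fun_prop)]
  · have hin : ∀ t : ℝ, ∫⁻ _ in Ioo (-Real.pi) Real.pi,
        ENNReal.ofReal ((ρ * k * Real.cosh (k * t)) ^ 2) =
        ENNReal.ofReal (2 * Real.pi * (2 * ρ) ^ 2 * Real.cosh (2 * t) ^ 2) := by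
      intro t
      rw [lintegral_slice_eq continuous_const (fun _ => by positivity) (fun _ => rfl)]
      congr 1
      simp only [intervalIntegral.integral_const, smul_eq_mul, sub_zero, hcosh]
      rw [mul_pow, mul_pow, hk2]
      ring
    simp only [hin]
    exact lintegral_Ioo_ofReal (by linarith) (by fun_prop) fun t _ => by positivity
  · intro z hz
    have : z ∈ ({z : ℂ | z ≠ 0} ∩ catenoidCover p q ρ k ⁻¹' slab h) ↔
        |catenoidCover p q ρ k z 2| < h := by
      rw [abs_lt]
      exact ⟨fun h => h.2, fun h => ⟨hz, h⟩⟩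
    rw [this, hheight z hz, abs_mul, abs_mul, hk', abs_of_pos hρ, mem_Ioo, ← abs_lt,
      lt_div_iff₀ (by positivity)]
    rw [show ρ * (2 * |Real.log ‖z‖|) = |Real.log ‖z‖| * (2 * ρ) by ring]

/-! ### The area comparison -/

section Comparison

variable {H R₀ R₁ F₃ : ℝ} {F : ℂ → E3}

/-- On a reflection-symmetric annulus satisfying the length estimate, the height is a multiple of
the logarithmic distance to the middle circle. -/
lemma exists_height_eq (hF : IsMinimalAnnulus H R₀ R₁ F) (hc : HasLengthConvexity H R₀ R₁ F₃ F)
    (hs : IsReflectionSymmetric R₀ R₁ F) :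
    ∃ c : ℝ, ∀ z ∈ annulus R₀ R₁,
      F z 2 = c * (Real.log ‖z‖ - (Real.log R₀ + Real.log R₁) / 2) := by
  have hH := hF.slab_pos
  obtain ⟨r, hr, hrs⟩ := hc.exists_level (s := 0) ⟨by linarith, hH⟩
  obtain ⟨r', hr', hrs'⟩ := hc.exists_level (s := H / 2) ⟨by linarith, by linarith⟩
  have hu : InnerProductSpace.HarmonicOnNhd (fun z => F z 2) (annulus R₀ R₁) :=
    hF.harmonic.comp_CLM (EuclideanSpace.proj 2 : E3 →L[ℝ] ℝ)
  have hne : r ≠ r' := by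
    rintro rfl
    have hr0 : 0 < r := hF.inner_pos.trans hr.1
    have h1 := hrs r (by simp [abs_of_pos hr0])
    have h2 := hrs' r (by simp [abs_of_pos hr0])
    linarith
  have hex : ∃ c d : ℝ, ∀ z ∈ annulus R₀ R₁, F z 2 = c * Real.log ‖z‖ + d := by
    rcases lt_or_gt_of_ne hne with h | h
    · exact exists_eq_mul_log_add hF.inner_pos hu hr.1 h hr'.2 hrs hrs'
    · exact exists_eq_mul_log_add hF.inner_pos hu hr'.1 h hr.2 hrs' hrs
  obtain ⟨c, d, hcd⟩ := hex
  refine ⟨c, fun z hz => ?_⟩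
  -- the reflection fixes the middle circle, so the height vanishes there
  set t₀ := (Real.log R₀ + Real.log R₁) / 2 with ht₀
  have hR1 := hF.inner_pos.trans hF.inner_lt_outer
  have hlt := Real.log_lt_log hF.inner_pos hF.inner_lt_outer
  have hm : logPolar (t₀, 0) ∈ annulus R₀ R₁ :=
    hF.logPolar_mem ⟨by simp only [ht₀]; linarith, by simp only [ht₀]; linarith⟩
  have hreal : logPolar (t₀, 0) = (Real.exp t₀ : ℝ) := by simp [logPolar]
  have hsq : R₀ * R₁ = Real.exp t₀ * Real.exp t₀ := by
    rw [← Real.exp_add, ht₀, add_halves, Real.exp_add, Real.exp_log hF.inner_pos,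
      Real.exp_log hR1]
  have h1 := hs _ hm
  rw [hreal, conj_ofReal, ← ofReal_div, hsq, mul_div_cancel_right₀ _ (Real.exp_pos t₀).ne',
    ← hreal] at h1
  have h2 : F (logPolar (t₀, 0)) 2 = -F (logPolar (t₀, 0)) 2 := by
    conv_lhs => rw [h1]
    simp [reflect]
  have h3 := hcd _ hm
  rw [norm_logPolar, Real.log_exp] at h3
  have h4 : c * t₀ + d = 0 := by linarith
  rw [hcd z hz]
  linarith

lemma reflect_logPolar (hF : IsMinimalAnnulus H R₀ R₁ F) (hs : IsReflectionSymmetric R₀ R₁ F)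
    {t θ : ℝ} (ht : t ∈ Ioo (Real.log R₀) (Real.log R₁)) :
    F (logPolar (Real.log R₀ + Real.log R₁ - t, θ)) = reflect (F (logPolar (t, θ))) := by
  rw [← hs _ (hF.logPolar_mem ht)]
  congr 1
  have hR1 := hF.inner_pos.trans hF.inner_lt_outer
  have h1 : ((R₀ * R₁ : ℝ) : ℂ) = exp ((Real.log R₀ + Real.log R₁ : ℝ) : ℂ) := by
    rw [← ofReal_exp, Real.exp_add, Real.exp_log hF.inner_pos, Real.exp_log hR1]
  rw [h1, logPolar, logPolar, ← exp_conj, ← exp_sub]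
  congr 1
  simp only [map_add, map_mul, conj_ofReal, conj_I]
  push_cast
  ring

lemma speed_reflect (hF : IsMinimalAnnulus H R₀ R₁ F) (hs : IsReflectionSymmetric R₀ R₁ F)
    {t θ : ℝ} (ht : t ∈ Ioo (Real.log R₀) (Real.log R₁)) :
    speed F (Real.log R₀ + Real.log R₁ - t, θ) = speed F (t, θ) := by
  have ht' : Real.log R₀ + Real.log R₁ - t ∈ Ioo (Real.log R₀) (Real.log R₁) :=
    ⟨by linarith [ht.2], by linarith [ht.1]⟩
  have h1 := hasDerivAt_angular (θ := θ) (hF.differentiableAt (hF.logPolar_mem (p := (_, θ)) ht'))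
  have h2 := hasDerivAt_reflect
    (hasDerivAt_angular (θ := θ) (hF.differentiableAt (hF.logPolar_mem (p := (_, θ)) ht)))
  simp only [reflect_logPolar hF hs ht] at h1
  rw [speed, h1.unique h2, norm_reflect, speed]

/-- On the middle circle the radial velocity is vertical. -/
lemma speed_middle (hF : IsMinimalAnnulus H R₀ R₁ F) (hs : IsReflectionSymmetric R₀ R₁ F) {c : ℝ}
    (hc : ∀ z ∈ annulus R₀ R₁, F z 2 = c * (Real.log ‖z‖ - (Real.log R₀ + Real.log R₁) / 2))
    (θ : ℝ) : speed F ((Real.log R₀ + Real.log R₁) / 2, θ) = |c| := by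
  set t₀ := (Real.log R₀ + Real.log R₁) / 2 with ht₀
  have hlt := Real.log_lt_log hF.inner_pos hF.inner_lt_outer
  have hm : t₀ ∈ Ioo (Real.log R₀) (Real.log R₁) :=
    ⟨by simp only [ht₀]; linarith, by simp only [ht₀]; linarith⟩
  have hd := hF.differentiableAt (hF.logPolar_mem (p := (t₀, θ)) hm)
  have h1 := hasDerivAt_radial hd
  set v := fderiv ℝ F (logPolar (t₀, θ)) (logPolar (t₀, θ)) with hv
  have h2 : HasDerivAt (fun t => F (logPolar (2 * t₀ - t, θ))) (-v) t₀ := by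
    have h3 : HasDerivAt (fun t => F (logPolar (t, θ))) v (2 * t₀ - t₀) := by
      rwa [show 2 * t₀ - t₀ = t₀ by ring]
    exact h3.comp_const_sub (2 * t₀) t₀
  have h4 : -v = reflect v := by
    refine (h2.congr_of_eventuallyEq ?_).unique (hasDerivAt_reflect h1)
    filter_upwards [isOpen_Ioo.mem_nhds hm] with t ht
    rw [← reflect_logPolar hF hs ht, ht₀, mul_div_cancel₀ _ two_ne_zero]
  have h5 : v 2 = c := by
    have h6 := hasDerivAt_E3.1 h1 2
    have h7 : HasDerivAt (fun t : ℝ => c * (t - t₀)) c t₀ := by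
      simpa using ((hasDerivAt_id t₀).sub_const t₀).const_mul c
    refine h6.unique (h7.congr_of_eventuallyEq ?_)
    filter_upwards [isOpen_Ioo.mem_nhds hm] with t ht
    rw [hc _ (hF.logPolar_mem (p := (t, θ)) ht), norm_logPolar, Real.log_exp]
  have h6 : v 0 = 0 := by
    have := congrArg (fun x : E3 => x 0) h4
    simp [reflect] at this
    linarith
  have h7 : v 1 = 0 := by
    have := congrArg (fun x : E3 => x 1) h4
    simp [reflect] at this
    linarith
  rw [← hF.norm_radial hm, ← hv]
  have : ‖v‖ ^ 2 = |c| ^ 2 := by rw [norm_sq_E3, h5, h6, h7, sq_abs]; ring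
  exact (pow_left_inj₀ (norm_nonneg _) (abs_nonneg _) two_ne_zero).1 this

lemma partialT_speed_middle (hF : IsMinimalAnnulus H R₀ R₁ F)
    (hs : IsReflectionSymmetric R₀ R₁ F) (θ : ℝ) :
    partialT (speed F) ((Real.log R₀ + Real.log R₁) / 2, θ) = 0 := by
  set t₀ := (Real.log R₀ + Real.log R₁) / 2 with ht₀
  have hlt := Real.log_lt_log hF.inner_pos hF.inner_lt_outer
  have hm : t₀ ∈ Ioo (Real.log R₀) (Real.log R₁) :=
    ⟨by simp only [ht₀]; linarith, by simp only [ht₀]; linarith⟩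
  have h1 := hasDerivAt_partialT (θ := θ) (hF.contDiffOn_speed.of_le one_le_two) hm
  have h2 : HasDerivAt (fun t => speed F (2 * t₀ - t, θ)) (-partialT (speed F) (t₀, θ)) t₀ := by
    have h3 : HasDerivAt (fun t => speed F (t, θ)) (partialT (speed F) (t₀, θ)) (2 * t₀ - t₀) := by
      rwa [show 2 * t₀ - t₀ = t₀ by ring]
    exact h3.comp_const_sub (2 * t₀) t₀
  have h4 := (h2.congr_of_eventuallyEq (f₁ := fun t => speed F (t, θ)) (by
    filter_upwards [isOpen_Ioo.mem_nhds hm] with t ht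
    rw [← speed_reflect hF hs ht, ht₀, mul_div_cancel₀ _ two_ne_zero])).unique h1
  linarith

lemma flux_eq_two_pi_mul (hF : IsMinimalAnnulus H R₀ R₁ F)
    (hfl : HasVerticalFlux F (Ioo R₀ R₁) F₃) {c d : ℝ}
    (hc : ∀ z ∈ annulus R₀ R₁, F z 2 = c * (Real.log ‖z‖ - d)) : F₃ = 2 * Real.pi * c := by
  obtain ⟨r, hr⟩ := exists_between hF.inner_lt_outer
  have hr0 := hF.inner_pos.trans hr.1
  have ht : Real.log r ∈ Ioo (Real.log R₀) (Real.log R₁) :=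
    ⟨Real.log_lt_log hF.inner_pos hr.1, Real.log_lt_log hr0 hr.2⟩
  have h1 := flux_apply (F := F) (t := Real.log r) 2
    (continuous_radial fun θ => hF.contDiffAt (hF.logPolar_mem (p := (_, θ)) ht))
    (fun θ => (hF.norm_radial (p := (_, θ)) ht).symm)
  rw [Real.exp_log hr0, hfl r hr] at h1
  have h2 : ∀ θ : ℝ, (fderiv ℝ F (logPolar (Real.log r, θ)) (logPolar (Real.log r, θ))) 2 = c := by
    intro θ
    have h6 := hasDerivAt_E3.1 (hasDerivAt_radial (hF.differentiableAt
      (hF.logPolar_mem (p := (Real.log r, θ)) ht))) 2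
    have h7 : HasDerivAt (fun t : ℝ => c * (t - d)) c (Real.log r) := by
      simpa using ((hasDerivAt_id (Real.log r)).sub_const d).const_mul c
    refine h6.unique (h7.congr_of_eventuallyEq ?_)
    filter_upwards [isOpen_Ioo.mem_nhds ht] with t ht
    rw [hc _ (hF.logPolar_mem (p := (t, θ)) ht), norm_logPolar, Real.log_exp]
  simpa [h2] using h1

/-- If the height is `c (log |z| - t₀)` and every height in `(-h, h)` is attained on a circle, then
the level circle at height `s` is `{log |z| = t₀ + s / c}`. -/
lemma levelLength_eq {h c t₀ : ℝ} (h0 : 0 < R₀) (hc0 : c ≠ 0)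
    (hc : ∀ z ∈ annulus R₀ R₁, F z 2 = c * (Real.log ‖z‖ - t₀))
    (hlev : ∀ s ∈ Ioo (-h) h, ∃ r ∈ Ioo R₀ R₁, ∀ z : ℂ, ‖z‖ = r → F z 2 = s) {s : ℝ}
    (hs : s ∈ Ioo (-h) h) :
    t₀ + s / c ∈ Ioo (Real.log R₀) (Real.log R₁) ∧
    levelLength F R₀ R₁ s = ∫ θ in (0 : ℝ)..2 * Real.pi, speed F (t₀ + s / c, θ) := by
  have hval : ∀ r ∈ Ioo R₀ R₁, (∀ z : ℂ, ‖z‖ = r → F z 2 = s) → Real.log r = t₀ + s / c := by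
    intro r hr hrs
    have hr0 := h0.trans hr.1
    have hn : ‖(r : ℂ)‖ = r := by simp [abs_of_pos hr0]
    have h1 := hrs r hn
    rw [hc r (by rw [annulus, mem_ofPred_eq, hn]; exact hr), hn] at h1
    rw [← h1]
    field_simp
    ring
  obtain ⟨r, hr, hrs⟩ := hlev s hs
  have hr0 := h0.trans hr.1
  have hl := hval r hr hrs
  have hset : {r | r ∈ Ioo R₀ R₁ ∧ ∀ z : ℂ, ‖z‖ = r → F z 2 = s} = {Real.exp (t₀ + s / c)} := by
    ext r'
    simp only [mem_ofPred_eq, mem_singleton_iff]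
    constructor
    · rintro ⟨h1, h2⟩
      rw [← hval r' h1 h2, Real.exp_log (h0.trans h1.1)]
    · rintro rfl
      rw [← hl, Real.exp_log hr0]
      exact ⟨hr, hrs⟩
  refine ⟨?_, ?_⟩
  · rw [← hl]
    exact ⟨Real.log_lt_log h0 hr.1, Real.log_lt_log hr0 hr.2⟩
  · rw [levelLength, levelRadius, hset, csInf_singleton, circleLength_exp]

/-- Both areas are integrals of energies of level curves; at the middle circle the two energies
agree to first order, and the length estimate compares their second derivatives. -/
theorem exists_area_lt_catenoidCover (hF : IsMinimalAnnulus H R₀ R₁ F)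
    (hfl : HasVerticalFlux F (Ioo R₀ R₁) F₃) (hconv : HasLengthConvexity H R₀ R₁ F₃ F)
    (hs : IsReflectionSymmetric R₀ R₁ F) :
    ∃ ε : ℝ, 0 < ε ∧ ε ≤ H ∧ ∀ h : ℝ, 0 < h → h < ε →
      ∀ (p q ρ : ℝ) (k : ℤ), 0 < ρ → |k| = 2 →
        HasVerticalFlux (catenoidCover p q ρ k) (Ioi 0) F₃ →
        area F (annulus R₀ R₁ ∩ F ⁻¹' slab h) <
          area (catenoidCover p q ρ k)
            ({z : ℂ | z ≠ 0} ∩ catenoidCover p q ρ k ⁻¹' slab h) := by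
  have hH := hF.slab_pos
  obtain ⟨c, hc⟩ := exists_height_eq hF hconv hs
  have hspeed := speed_middle hF hs hc
  have hpartial := partialT_speed_middle hF hs
  set t₀ := (Real.log R₀ + Real.log R₁) / 2 with ht₀
  have hF3 : F₃ = 2 * Real.pi * c := flux_eq_two_pi_mul hF hfl hc
  have hF30 := hconv.flux_ne_zero hH
  have hc0 : c ≠ 0 := by rintro rfl; simp at hF3; exact hF30 hF3
  have hcpos : 0 < |c| := abs_pos.2 hc0
  have hlevel : ∀ s ∈ Ioo (-H) H, t₀ + s / c ∈ Ioo (Real.log R₀) (Real.log R₁) ∧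
      levelLength F R₀ R₁ s = ∫ θ in (0 : ℝ)..2 * Real.pi, speed F (t₀ + s / c, θ) :=
    fun s hs => levelLength_eq hF.inner_pos hc0 hc (fun s hs => hconv.exists_level hs) hs
  have h0H : (0 : ℝ) ∈ Ioo (-H) H := ⟨by linarith, hH⟩
  have hm : t₀ ∈ Ioo (Real.log R₀) (Real.log R₁) := by simpa using (hlevel 0 h0H).1
  have hsm := hF.contDiffOn_speed
  -- the upper length estimate at height zero, in terms of `t = log |z|`
  have hsecond : ∫ θ in (0 : ℝ)..2 * Real.pi, partialT (partialT (speed F)) (t₀, θ) <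
      4 * (2 * Real.pi * |c|) := by
    have h1 : deriv (deriv (levelLength F R₀ R₁)) 0 =
        (∫ θ in (0 : ℝ)..2 * Real.pi, partialT (partialT (speed F)) (t₀ + 0 / c, θ)) / c ^ 2 := by
      refine deriv_deriv_rescale (L := fun t => ∫ θ in (0 : ℝ)..2 * Real.pi, speed F (t, θ))
        (L' := fun t => ∫ θ in (0 : ℝ)..2 * Real.pi, partialT (speed F) (t, θ)) (t₀ := t₀) ?_ ?_ ?_
      · filter_upwards [isOpen_Ioo.mem_nhds h0H] with s hs using (hlevel s hs).2
      · filter_upwards [isOpen_Ioo.mem_nhds (hlevel 0 h0H).1] with t ht using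
          hasDerivAt_integral_slice (hsm.of_le one_le_two) ht
      · exact hasDerivAt_integral_slice (contDiffOn_partialT hsm (by norm_num)) (hlevel 0 h0H).1
    have h2 := (hconv 0 h0H).2
    rw [h1, (hlevel 0 h0H).2, hF3] at h2
    simp only [zero_div, add_zero, hspeed] at h2
    rw [div_lt_iff₀ (by positivity)] at h2
    have h3 : 2 * Real.pi / (2 * Real.pi * c) = 1 / c := by
      have := Real.pi_pos.ne'
      field_simp
    rw [h3] at h2
    simp only [intervalIntegral.integral_const, smul_eq_mul, sub_zero] at h2
    have h4 : 4 * (1 / c) ^ 2 * (2 * Real.pi * |c|) * c ^ 2 = 4 * (2 * Real.pi * |c|) := by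
      field_simp
    linarith
  obtain ⟨δ, hδ, hball⟩ := Metric.eventually_nhds_iff.1
    (energy_lt_of_second_deriv_lt hcpos hsm hm hspeed hpartial hsecond)
  refine ⟨min H (|c| * δ), lt_min hH (by positivity), min_le_left _ _, ?_⟩
  intro h hh hhε p q ρ k hρ hk hcat
  have hhH : h < H := hhε.trans_le (min_le_left _ _)
  have hhδ : h / |c| < δ := by
    rw [div_lt_iff₀ hcpos, mul_comm]; exact hhε.trans_le (min_le_right _ _)
  have hτ : 0 < h / |c| := by positivity
  have hk' : |(k : ℝ)| = 2 := by exact_mod_cast hk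
  have hρc : 2 * ρ = |c| := by
    have h1 := flux_catenoidCover hcat
    rw [hF3] at h1
    rw [mul_left_cancel₀ (by positivity) h1, abs_mul, hk', abs_of_pos hρ, mul_comm]
  have hsub : Icc (t₀ - h / |c|) (t₀ + h / |c|) ⊆ Ioo (Real.log R₀) (Real.log R₁) := by
    have h1 := (hlevel h ⟨by linarith, hhH⟩).1
    have h2 := (hlevel (-h) ⟨by linarith, by linarith⟩).1
    rw [neg_div] at h2
    intro t ht
    rcases abs_choice c with h3 | h3 <;> rw [h3] at ht
    · exact ⟨by linarith [h2.1, ht.1], by linarith [h1.2, ht.2]⟩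
    · rw [div_neg] at ht
      exact ⟨by linarith [h1.1, ht.1], by linarith [h2.2, ht.2]⟩
  have hMcont : ContinuousOn (fun t => ∫ θ in (0 : ℝ)..2 * Real.pi, speed F (t, θ) ^ 2)
      (Icc (t₀ - h / |c|) (t₀ + h / |c|)) := fun t ht =>
    (hasDerivAt_integral_slice (f := fun p => speed F p ^ 2)
      ((hsm.pow 2).of_le one_le_two) (hsub ht)).continuousAt.continuousWithinAt
  have hareaF : area F (annulus R₀ R₁ ∩ F ⁻¹' slab h) = ENNReal.ofReal
      (∫ t in (t₀ - h / |c|)..(t₀ + h / |c|), ∫ θ in (0 : ℝ)..2 * Real.pi, speed F (t, θ) ^ 2) := by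
    have hD : IsOpen (annulus R₀ R₁ ∩ F ⁻¹' slab h) := by
      exact ContinuousOn.isOpen_inter_preimage
        (fun z hz => (hF.differentiableAt hz).continuousAt.continuousWithinAt)
        (isOpen_annulus _ _) (isOpen_slab h)
    rw [area_eq_lintegral F hD.measurableSet (a := t₀ - h / |c|) (b := t₀ + h / |c|)
      (J := fun x => speed F x ^ 2) ?_
      (fun t ht θ => hF.sqrt_gram (p := (t, θ)) (hsub (Ioo_subset_Icc_self ht)))
      ((hsm.continuousOn.pow 2).mono (prod_mono (Ioo_subset_Icc_self.trans hsub) Subset.rfl))]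
    · rw [← lintegral_Ioo_ofReal (by linarith) hMcont fun t _ =>
        intervalIntegral.integral_nonneg (by positivity) fun _ _ => by positivity]
      refine setLIntegral_congr_fun measurableSet_Ioo fun t ht => ?_
      exact lintegral_slice_eq
        ((continuous_slice hsm.continuousOn (hsub (Ioo_subset_Icc_self ht))).pow 2)
        (fun _ => by positivity) fun θ => by simp only [speed_periodic F t θ]
    · intro z hz
      have hiff : ∀ z ∈ annulus R₀ R₁, (F z ∈ slab h ↔
          Real.log ‖z‖ ∈ Ioo (t₀ - h / |c|) (t₀ + h / |c|)) := by
        intro z hz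
        have h1 : F z ∈ slab h ↔ |F z 2| < h := by rw [abs_lt]; rfl
        rw [h1, hc z hz, abs_mul, ← lt_div_iff₀' hcpos, abs_lt, mem_Ioo]
        constructor <;> rintro ⟨h2, h3⟩ <;> constructor <;> linarith
      constructor
      · exact fun hz' => (hiff z hz'.1).1 hz'.2
      · intro hz'
        have h1 := hsub (Ioo_subset_Icc_self hz')
        have h2 : z ∈ annulus R₀ R₁ := by
          rw [← exists_logPolar_eq hz]
          exact hF.logPolar_mem (p := (_, _)) h1
        exact ⟨h2, (hiff z h2).2 hz'⟩
  have hshift : ∫ t in -(h / (2 * ρ))..h / (2 * ρ),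
      2 * Real.pi * (2 * ρ) ^ 2 * Real.cosh (2 * t) ^ 2 =
      ∫ t in (t₀ - h / |c|)..(t₀ + h / |c|),
        2 * Real.pi * |c| ^ 2 * Real.cosh (2 * (t - t₀)) ^ 2 := by
    rw [intervalIntegral.integral_comp_sub_right
      (fun t => 2 * Real.pi * |c| ^ 2 * Real.cosh (2 * t) ^ 2), hρc]
    congr 1 <;> ring
  rw [hareaF, area_catenoidCover hρ hk hh, hshift]
  have hlt : ∀ t ∈ Icc (t₀ - h / |c|) (t₀ + h / |c|), t ≠ t₀ →
      ∫ θ in (0 : ℝ)..2 * Real.pi, speed F (t, θ) ^ 2 <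
        2 * Real.pi * |c| ^ 2 * Real.cosh (2 * (t - t₀)) ^ 2 := by
    intro t ht hne
    refine hball ?_ hne
    rw [Real.dist_eq, abs_lt]
    constructor <;> linarith [ht.1, ht.2]
  have hle : ∀ t ∈ Icc (t₀ - h / |c|) (t₀ + h / |c|),
      ∫ θ in (0 : ℝ)..2 * Real.pi, speed F (t, θ) ^ 2 ≤
        2 * Real.pi * |c| ^ 2 * Real.cosh (2 * (t - t₀)) ^ 2 := by
    intro t ht
    by_cases hne : t = t₀
    · subst hne
      simp [hspeed]
    · exact (hlt t ht hne).le
  have hint := intervalIntegral.integral_lt_integral_of_continuousOn_of_le_of_exists_lt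
    (by linarith) hMcont (by fun_prop) (fun t ht => hle t (Ioc_subset_Icc_self ht))
    ⟨t₀ + h / |c|, right_mem_Icc.2 (by linarith), hlt _ (right_mem_Icc.2 (by linarith))
      (by linarith)⟩
  refine (ENNReal.ofReal_lt_ofReal_iff (lt_of_le_of_lt ?_ hint)).2 hint
  exact intervalIntegral.integral_nonneg (by linarith) fun t _ =>
    intervalIntegral.integral_nonneg (by positivity) fun _ _ => by positivity

end Comparison

/-! ### The complexified height and its inverse -/

/-- A quarter of the complexified height `∫ φ₃` of the model surface, in the coordinate
`τ = log z`. -/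
def heightChart (τ : ℂ) : ℂ := τ - sinh (2 * τ) / 4

/-- The closed strip on which `heightChart` is injective. -/
def chartStrip : Set ℂ := {τ | |τ.re| ≤ 1 / 2}

lemma norm_cosh_le (z : ℂ) : ‖cosh z‖ ≤ Real.cosh z.re := by
  rw [Complex.cosh, Real.cosh_eq, norm_div, norm_ofNat]
  gcongr
  refine (norm_add_le _ _).trans_eq ?_
  rw [norm_exp, norm_exp, neg_re]

lemma cosh_one_le : Real.cosh 1 ≤ 8 / 5 := by
  rw [Real.cosh_eq, Real.exp_neg]
  have h1 := Real.exp_one_lt_d9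
  have h2 := Real.exp_one_gt_d9
  have h3 : (Real.exp 1)⁻¹ ≤ 2.7⁻¹ := inv_anti₀ (by norm_num) (by linarith)
  norm_num at h1 h2 h3 ⊢
  linarith

lemma sinh_one_le : Real.sinh 1 ≤ 6 / 5 := by
  rw [Real.sinh_eq, Real.exp_neg]
  have h1 := Real.exp_one_lt_d9
  have h3 : 2.72⁻¹ ≤ (Real.exp 1)⁻¹ := inv_anti₀ (Real.exp_pos 1) (by linarith)
  norm_num at h1 h3 ⊢
  linarith

lemma cosh_two_mul_re_le {τ : ℂ} (hτ : τ ∈ chartStrip) : Real.cosh (2 * τ.re) ≤ 8 / 5 := by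
  refine le_trans (Real.cosh_le_cosh.2 ?_) cosh_one_le
  rw [abs_mul, abs_two, abs_one]
  have : |τ.re| ≤ 1 / 2 := hτ
  linarith

lemma norm_cosh_two_mul_le {τ : ℂ} (hτ : τ ∈ chartStrip) : ‖cosh (2 * τ)‖ ≤ 8 / 5 := by
  refine (norm_cosh_le _).trans ?_
  simpa using cosh_two_mul_re_le hτ

lemma convex_chartStrip : Convex ℝ chartStrip := by
  have : chartStrip = reLm ⁻¹' Icc (-(1 / 2)) (1 / 2) := by
    ext τ
    simp [chartStrip, abs_le]
  rw [this]
  exact (convex_Icc _ _).linear_preimage reLm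

lemma isClosed_chartStrip : IsClosed chartStrip :=
  isClosed_le (continuous_abs.comp continuous_re) continuous_const

lemma hasDerivAt_sinh_two_mul (τ : ℂ) :
    HasDerivAt (fun τ => sinh (2 * τ) / 4) (cosh (2 * τ) / 2) τ := by
  have h : HasDerivAt (fun τ : ℂ => 2 * τ) 2 τ := by simpa using (hasDerivAt_id τ).const_mul 2
  refine (h.csinh.div_const 4).congr_deriv ?_
  ring

lemma norm_sinh_sub_le {τ₁ τ₂ : ℂ} (h1 : τ₁ ∈ chartStrip) (h2 : τ₂ ∈ chartStrip) :
    ‖sinh (2 * τ₁) / 4 - sinh (2 * τ₂) / 4‖ ≤ 4 / 5 * ‖τ₁ - τ₂‖ := by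
  refine convex_chartStrip.norm_image_sub_le_of_norm_hasDerivWithin_le
    (f := fun τ => sinh (2 * τ) / 4) (fun τ _ => (hasDerivAt_sinh_two_mul τ).hasDerivWithinAt)
    (fun τ hτ => ?_) h2 h1
  rw [norm_div, norm_ofNat]
  linarith [norm_cosh_two_mul_le hτ]

/-- Since `sinh (2τ) / 4` has Lipschitz constant `4/5` on the strip, `heightChart` expands distances
by at least `1/5`. -/
lemma norm_sub_le_heightChart {τ₁ τ₂ : ℂ} (h1 : τ₁ ∈ chartStrip) (h2 : τ₂ ∈ chartStrip) :
    ‖τ₁ - τ₂‖ ≤ 5 * ‖heightChart τ₁ - heightChart τ₂‖ := by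
  have h3 := norm_sinh_sub_le h1 h2
  have h4 : τ₁ - τ₂ = (heightChart τ₁ - heightChart τ₂) +
      (sinh (2 * τ₁) / 4 - sinh (2 * τ₂) / 4) := by
    simp only [heightChart]; ring
  have h5 := norm_add_le (heightChart τ₁ - heightChart τ₂) (sinh (2 * τ₁) / 4 - sinh (2 * τ₂) / 4)
  rw [← h4] at h5
  linarith

lemma injOn_heightChart : InjOn heightChart chartStrip := by
  intro τ₁ h1 τ₂ h2 h
  have := norm_sub_le_heightChart h1 h2
  rw [h, sub_self, norm_zero, mul_zero] at this
  exact sub_eq_zero.1 (norm_le_zero_iff.1 this)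

/-- Solving `heightChart τ = σ` amounts to finding a fixed point of `τ ↦ σ + sinh (2 τ) / 4`, which
is a contraction of the strip. -/
lemma exists_heightChart_eq {σ : ℂ} (hσ : |σ.re| ≤ 1 / 5) :
    ∃ τ ∈ chartStrip, heightChart τ = σ := by
  have hmaps : MapsTo (fun τ => σ + sinh (2 * τ) / 4) chartStrip chartStrip := by
    intro τ hτ
    have h0 : |τ.re| ≤ 1 / 2 := hτ
    have h1 : (sinh (2 * τ) / 4).re = Real.sinh (2 * τ.re) * Real.cos (2 * τ.im) / 4 := by
      have e : sinh (2 * τ) = sinh ((2 * τ.re : ℝ) + (2 * τ.im : ℝ) * I) := by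
        congr 1
        apply Complex.ext <;> simp
      rw [e, sinh_add, sinh_mul_I, cosh_mul_I]
      simp [← ofReal_sinh, ← ofReal_cosh, ← ofReal_cos, ← ofReal_sin, -ofReal_mul]
    have h2 : |Real.sinh (2 * τ.re)| ≤ 6 / 5 := by
      rw [Real.abs_sinh]
      refine (Real.sinh_le_sinh.2 ?_).trans sinh_one_le
      rw [abs_mul, abs_two]
      linarith
    have h3 : |Real.sinh (2 * τ.re) * Real.cos (2 * τ.im)| ≤ 6 / 5 := by
      rw [abs_mul]
      exact (mul_le_of_le_one_right (abs_nonneg _) (Real.abs_cos_le_one _)).trans h2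
    change |(σ + sinh (2 * τ) / 4).re| ≤ 1 / 2
    rw [add_re, h1]
    refine (abs_add_le _ _).trans ?_
    rw [abs_div, abs_of_pos (by norm_num : (0 : ℝ) < 4)]
    linarith
  have hcontr : ContractingWith (4 / 5) (hmaps.restrict _ chartStrip chartStrip) := by
    refine ⟨by rw [div_lt_one] <;> norm_num, LipschitzWith.of_dist_le_mul fun x y => ?_⟩
    have := norm_sinh_sub_le x.2 y.2
    rw [Subtype.dist_eq, Subtype.dist_eq, dist_eq_norm, dist_eq_norm]
    change ‖(σ + sinh (2 * (x : ℂ)) / 4) - (σ + sinh (2 * (y : ℂ)) / 4)‖ ≤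
      ((4 / 5 : NNReal) : ℝ) * ‖(x : ℂ) - y‖
    rw [add_sub_add_left_eq_sub]
    simpa using this
  obtain ⟨τ, hτ, hfix, -⟩ := hcontr.exists_fixedPoint' isClosed_chartStrip.isComplete hmaps
    (x := 0) (by simp [chartStrip]) (edist_ne_top _ _)
  refine ⟨τ, hτ, ?_⟩
  have : σ + sinh (2 * τ) / 4 = τ := hfix
  rw [heightChart, sub_eq_iff_eq_add, this]

/-- The inverse of `heightChart`, with values in the strip. -/
def chartInv : ℂ → ℂ := Function.invFunOn heightChart chartStrip

lemma chartInv_mem {σ : ℂ} (hσ : |σ.re| ≤ 1 / 5) : chartInv σ ∈ chartStrip :=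
  Function.invFunOn_mem (exists_heightChart_eq hσ)

lemma heightChart_chartInv {σ : ℂ} (hσ : |σ.re| ≤ 1 / 5) : heightChart (chartInv σ) = σ :=
  Function.invFunOn_eq (exists_heightChart_eq hσ)

lemma chartInv_eq {σ τ : ℂ} (hτ : τ ∈ chartStrip) (h : heightChart τ = σ) : chartInv σ = τ :=
  injOn_heightChart (Function.invFunOn_mem ⟨τ, hτ, h⟩) hτ
    ((Function.invFunOn_eq ⟨τ, hτ, h⟩).trans h.symm)

lemma one_sub_cosh_ne_zero {τ : ℂ} (hτ : τ ∈ chartStrip) : 1 - cosh (2 * τ) / 2 ≠ 0 := by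
  intro h
  have h1 := norm_cosh_two_mul_le hτ
  have h2 : cosh (2 * τ) = 2 := by linear_combination -2 * h
  rw [h2, norm_ofNat] at h1
  norm_num at h1

lemma isOpen_reStrip (δ : ℝ) : IsOpen {σ : ℂ | |σ.re| < δ} :=
  isOpen_lt (continuous_abs.comp continuous_re) continuous_const

lemma hasDerivAt_chartInv {σ : ℂ} (hσ : |σ.re| < 1 / 5) :
    HasDerivAt chartInv (1 - cosh (2 * chartInv σ) / 2)⁻¹ σ := by
  have hev : ∀ᶠ σ' in nhds σ, |σ'.re| < 1 / 5 := (isOpen_reStrip _).mem_nhds hσ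
  refine HasDerivAt.of_local_left_inverse (f := heightChart) ?_ ?_
    (one_sub_cosh_ne_zero (chartInv_mem hσ.le)) ?_
  · rw [ContinuousAt, tendsto_iff_norm_sub_tendsto_zero]
    have h1 : Filter.Tendsto (fun σ' => 5 * ‖σ' - σ‖) (nhds σ) (nhds 0) := by
      have : Continuous fun σ' : ℂ => 5 * ‖σ' - σ‖ := by fun_prop
      simpa using this.tendsto σ
    refine squeeze_zero' (Filter.Eventually.of_forall fun _ => norm_nonneg _) ?_ h1
    filter_upwards [hev] with σ' hσ'
    have := norm_sub_le_heightChart (chartInv_mem hσ'.le) (chartInv_mem hσ.le)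
    rwa [heightChart_chartInv hσ'.le, heightChart_chartInv hσ.le] at this
  · exact (hasDerivAt_id _).sub (hasDerivAt_sinh_two_mul _)
  · filter_upwards [hev] with σ' hσ' using heightChart_chartInv hσ'.le

lemma chartInv_add_int_mul {σ : ℂ} (hσ : |σ.re| ≤ 1 / 5) (n : ℤ) :
    chartInv (σ + n * (2 * Real.pi * I)) = chartInv σ + n * (2 * Real.pi * I) := by
  refine chartInv_eq ?_ ?_
  · have := chartInv_mem hσ
    simpa [chartStrip] using this
  · have h : sinh (2 * (chartInv σ + n * (2 * Real.pi * I))) = sinh (2 * chartInv σ) := by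
      have e1 : exp (2 * (chartInv σ + n * (2 * Real.pi * I))) = exp (2 * chartInv σ) :=
        exp_eq_exp_iff_exists_int.2 ⟨2 * n, by push_cast; ring⟩
      have e2 : exp (-(2 * (chartInv σ + n * (2 * Real.pi * I)))) = exp (-(2 * chartInv σ)) :=
        exp_eq_exp_iff_exists_int.2 ⟨-2 * n, by push_cast; ring⟩
      rw [Complex.sinh, Complex.sinh, e1, e2]
    have h' := heightChart_chartInv hσ
    rw [heightChart] at h'
    rw [heightChart, h]
    linear_combination h'

/-- The reflection in the unit circle, in the logarithmic coordinate, commutes with `chartInv`. -/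
lemma chartInv_neg_conj {σ : ℂ} (hσ : |σ.re| ≤ 1 / 5) :
    chartInv (-(starRingEnd ℂ) σ) = -(starRingEnd ℂ) (chartInv σ) := by
  refine chartInv_eq ?_ ?_
  · have := chartInv_mem hσ
    simpa [chartStrip] using this
  · have h := congrArg (starRingEnd ℂ) (heightChart_chartInv hσ)
    simp only [heightChart, map_sub, map_div₀, map_ofNat, ← sinh_conj, map_mul] at h
    rw [heightChart, mul_neg, sinh_neg]
    linear_combination -h

lemma chartInv_mul_I (α : ℝ) : chartInv ((α - Real.sin (2 * α) / 4 : ℝ) * I) = α * I := by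
  refine chartInv_eq (by simp [chartStrip]) ?_
  rw [heightChart, ← mul_assoc, show (2 : ℂ) * α = (2 * α : ℝ) by push_cast; ring, sinh_mul_I,
    ← ofReal_sin]
  push_cast
  ring

/-! ### A trigonometric integral -/

lemma two_sub_cos_pos (x : ℝ) : 0 < 2 - Real.cos x := by linarith [Real.cos_le_one x]

/-- The integral reduces to `10/3` times the integral of `1 / (2 - cos 2α)`, up to the derivative
of a periodic function. -/
lemma integral_reduction : ∫ α in (0 : ℝ)..2 * Real.pi,
      (Real.cos α) ^ 2 / (1 - Real.cos (2 * α) / 2) ^ 3 =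
    10 / 3 * ∫ α in (0 : ℝ)..2 * Real.pi, (2 - Real.cos (2 * α))⁻¹ := by
  have hne : ∀ α : ℝ, 2 - Real.cos (2 * α) ≠ 0 := fun α => (two_sub_cos_pos _).ne'
  have hcont : Continuous fun α : ℝ => (2 - Real.cos (2 * α))⁻¹ :=
    Continuous.inv₀ (by fun_prop) hne
  have hlin : ∀ α : ℝ, HasDerivAt (fun α : ℝ => 2 * α) 2 α := fun α => by
    simpa using (hasDerivAt_id α).const_mul 2
  have hy : ∀ α : ℝ, HasDerivAt (fun α => (2 - Real.cos (2 * α))⁻¹)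
      (-(2 * Real.sin (2 * α)) * (2 - Real.cos (2 * α))⁻¹ ^ 2) α := by
    intro α
    refine (((hlin α).cos.const_sub 2).fun_inv (hne α)).congr_deriv ?_
    field_simp
  have hG : ∀ α : ℝ, HasDerivAt (fun α => Real.sin (2 * α) * (2 - Real.cos (2 * α))⁻¹ ^ 2 +
      4 / 3 * (Real.sin (2 * α) * (2 - Real.cos (2 * α))⁻¹))
      ((Real.cos α) ^ 2 / (1 - Real.cos (2 * α) / 2) ^ 3 -
        10 / 3 * (2 - Real.cos (2 * α))⁻¹) α := by
    intro α
    have hs := (hlin α).sin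
    refine ((hs.mul ((hy α).fun_pow 2)).add ((hs.mul (hy α)).const_mul (4 / 3))).congr_deriv ?_
    have h1 : Real.cos α ^ 2 = (1 + Real.cos (2 * α)) / 2 := by rw [Real.cos_sq]; ring
    have h2 : Real.sin (2 * α) ^ 2 = 1 - Real.cos (2 * α) ^ 2 := Real.sin_sq _
    have h3 : 1 - Real.cos (2 * α) / 2 = (2 - Real.cos (2 * α)) / 2 := by ring
    rw [h1, h3]
    have h4 := hne α
    generalize Real.cos (2 * α) = C at *
    generalize Real.sin (2 * α) = s at *
    push_cast
    field_simp
    ring_nf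
    rw [h2]
    ring
  have h := intervalIntegral.integral_eq_sub_of_hasDerivAt (a := 0) (b := 2 * Real.pi)
    (fun α _ => hG α) (Continuous.intervalIntegrable (by
      refine Continuous.sub (Continuous.div (by fun_prop) (by fun_prop) fun α => ?_)
        (continuous_const.mul hcont)
      have := hne α
      refine pow_ne_zero 3 fun h => this ?_
      linarith) _ _)
  have e : Real.sin (2 * (2 * Real.pi)) = 0 := by
    rw [show 2 * (2 * Real.pi) = (4 : ℕ) * Real.pi by push_cast; ring, Real.sin_nat_mul_pi]
  rw [intervalIntegral.integral_sub, intervalIntegral.integral_const_mul, e] at h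
  · simpa [sub_eq_zero] using h
  · refine (Continuous.div (by fun_prop) (by fun_prop) fun α => ?_).intervalIntegrable _ _
    have := hne α
    refine pow_ne_zero 3 fun h => this ?_
    linarith
  · exact (continuous_const.mul hcont).intervalIntegrable _ _

lemma integral_inv_two_sub_cos_bounds :
    3 / 5 * Real.pi < ∫ α in (0 : ℝ)..2 * Real.pi, (2 - Real.cos (2 * α))⁻¹ ∧
    ∫ α in (0 : ℝ)..2 * Real.pi, (2 - Real.cos (2 * α))⁻¹ < 6 / 5 * Real.pi := by
  have hne : ∀ α : ℝ, 2 - Real.cos (2 * α) ≠ 0 := fun α => (two_sub_cos_pos _).ne'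
  have hcont : Continuous fun α : ℝ => (2 - Real.cos (2 * α))⁻¹ :=
    Continuous.inv₀ (by fun_prop) hne
  have hpi : (0 : ℝ) < 2 * Real.pi := by positivity
  constructor
  · have h := intervalIntegral.integral_mono_on (μ := volume) (a := 0) (b := 2 * Real.pi) hpi.le
      (f := fun _ => 1 / 3) intervalIntegrable_const (hcont.intervalIntegrable _ _) fun α _ => by
        rw [one_div]
        exact inv_anti₀ (two_sub_cos_pos _) (by linarith [Real.neg_one_le_cos (2 * α)])
    simp only [intervalIntegral.integral_const, smul_eq_mul, sub_zero] at h
    linarith [Real.pi_pos]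
  · -- the quadratic majorant touches `1 / (2 - C)` at `C = 1` and, to second order, at `C = -1/2`
    set P : ℝ → ℝ := fun α =>
      13 / 25 + 8 / 25 * Real.cos (2 * α) + 4 / 25 * Real.cos (2 * α) ^ 2 with hP
    have hdiff : ∀ α, P α - (2 - Real.cos (2 * α))⁻¹ =
        4 / 25 * (1 - Real.cos (2 * α)) * (Real.cos (2 * α) + 1 / 2) ^ 2 *
          (2 - Real.cos (2 * α))⁻¹ := by
      intro α
      have := hne α
      simp only [hP]
      field_simp
      ring
    have hle : ∀ α, (2 - Real.cos (2 * α))⁻¹ ≤ P α := by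
      intro α
      rw [← sub_nonneg, hdiff]
      have h1 := inv_pos.2 (two_sub_cos_pos (2 * α))
      have h2 : 0 ≤ 1 - Real.cos (2 * α) := by linarith [Real.cos_le_one (2 * α)]
      positivity
    have hlt : (2 - Real.cos (2 * (Real.pi / 2)))⁻¹ < P (Real.pi / 2) := by
      simp only [hP]
      rw [mul_div_cancel₀ _ two_ne_zero, Real.cos_pi]
      norm_num
    have h := intervalIntegral.integral_lt_integral_of_continuousOn_of_le_of_exists_lt hpi
      hcont.continuousOn (by simp only [hP]; fun_prop : ContinuousOn P (Icc 0 (2 * Real.pi)))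
      (fun α _ => hle α) ⟨Real.pi / 2, ⟨by positivity, by linarith [Real.pi_pos]⟩, hlt⟩
    have hint : ∫ α in (0 : ℝ)..2 * Real.pi, P α = 6 / 5 * Real.pi := by
      have hd : ∀ α : ℝ, HasDerivAt (fun α => 3 / 5 * α + 4 / 25 * Real.sin (2 * α) +
          1 / 50 * Real.sin (4 * α)) (P α) α := by
        intro α
        have h2 : HasDerivAt (fun α : ℝ => 2 * α) 2 α := by
          simpa using (hasDerivAt_id α).const_mul 2
        have h4 : HasDerivAt (fun α : ℝ => 4 * α) 4 α := by
          simpa using (hasDerivAt_id α).const_mul 4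
        refine ((((hasDerivAt_id α).const_mul (3 / 5)).add (h2.sin.const_mul (4 / 25))).add
          (h4.sin.const_mul (1 / 50))).congr_deriv ?_
        have : Real.cos (4 * α) = 2 * Real.cos (2 * α) ^ 2 - 1 := by
          rw [show 4 * α = 2 * (2 * α) by ring, Real.cos_two_mul]
        rw [this]
        simp only [hP]
        ring
      rw [intervalIntegral.integral_eq_sub_of_hasDerivAt (fun α _ => hd α)
        (Continuous.intervalIntegrable (by simp only [hP]; fun_prop) _ _),
        show 2 * (2 * Real.pi) = (4 : ℕ) * Real.pi by push_cast; ring, Real.sin_nat_mul_pi,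
        show 4 * (2 * Real.pi) = (8 : ℕ) * Real.pi by push_cast; ring, Real.sin_nat_mul_pi]
      simp
      ring
    linarith

/-! ### Maps whose coordinates are real parts of holomorphic functions -/

section RealParts

variable {F : ℂ → E3} {g : Fin 3 → ℂ → ℂ} {d : Fin 3 → ℂ}

lemma fderiv_of_eq_re {z : ℂ} (hg : ∀ k, HasDerivAt (g k) (d k) z)
    (hF : ∀ᶠ w in nhds z, ∀ k, F w k = (g k w).re) :
    DifferentiableAt ℝ F z ∧ ∀ v k, (fderiv ℝ F z v) k = (d k * v).re := by
  have hk : ∀ k, HasFDerivAt (fun w => F w k)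
      (reCLM.comp (((ContinuousLinearMap.toSpanSingleton ℂ (d k)).restrictScalars ℝ))) z := by
    intro k
    refine (reCLM.hasFDerivAt.comp z
      ((hg k).hasFDerivAt.restrictScalars ℝ)).congr_of_eventuallyEq ?_
    filter_upwards [hF] with w hw using hw k
  have hd : DifferentiableAt ℝ F z := differentiableAt_euclidean.2 fun k => (hk k).differentiableAt
  refine ⟨hd, fun v k => ?_⟩
  rw [fderiv_apply_coord hd, (hk k).fderiv]
  simp [mul_comm]

lemma phi_of_eq_re {z : ℂ} (hg : ∀ k, HasDerivAt (g k) (d k) z)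
    (hF : ∀ᶠ w in nhds z, ∀ k, F w k = (g k w).re) (k : Fin 3) : phi F k z = d k := by
  have h := (fderiv_of_eq_re hg hF).2
  rw [phi, partialX, partialY, h, h]
  apply Complex.ext <;> simp

/-- The branch of the logarithm near `e^σ` that takes the value `σ` there. -/
lemma exists_log_branch (σ : ℂ) : ∃ l : ℂ → ℂ, l (exp σ) = σ ∧ AnalyticAt ℂ l (exp σ) ∧
    HasDerivAt l (exp σ)⁻¹ (exp σ) ∧ (∀ᶠ z in nhds (exp σ), exp (l z) = z) := by
  have h0 := exp_ne_zero σ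
  refine ⟨fun z => σ + log (z / exp σ), by simp, ?_, ?_, ?_⟩
  · exact analyticAt_const.add ((analyticAt_id.div analyticAt_const h0).clog (by simp))
  · have h1 : HasDerivAt (fun z => z / exp σ) (1 / exp σ) (exp σ) := (hasDerivAt_id _).div_const _
    refine ((h1.clog (by simp)).const_add σ).congr_deriv ?_
    simp
  · filter_upwards [isOpen_ne.mem_nhds h0] with z hz
    rw [exp_add, exp_log (div_ne_zero hz h0), mul_div_cancel₀ _ h0]

/-- A function of `z` that is holomorphic as a function of `σ = log z` near one logarithm of a point
is holomorphic at that point. -/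
lemma hasDerivAt_of_exp {f h : ℂ → ℂ} {h' σ : ℂ} (hh : HasDerivAt h h' σ)
    (hf : ∀ᶠ σ' in nhds σ, f (exp σ') = h σ') : HasDerivAt f (h' * (exp σ)⁻¹) (exp σ) := by
  obtain ⟨l, hl1, -, hl2, hl3⟩ := exists_log_branch σ
  rw [← hl1] at hh hf
  have h1 : HasDerivAt (h ∘ l) (h' * (exp σ)⁻¹) (exp σ) := hh.comp (exp σ) hl2
  refine h1.congr_of_eventuallyEq ?_
  filter_upwards [hl2.continuousAt.eventually hf, hl3] with z hz1 hz2
  rw [Function.comp_apply, ← hz1, hz2]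

lemma eventually_re_of_exp {σ : ℂ} (hF : ∀ᶠ σ' in nhds σ, ∀ k, F (exp σ') k = (g k σ').re) :
    ∃ l : ℂ → ℂ, l (exp σ) = σ ∧ AnalyticAt ℂ l (exp σ) ∧ HasDerivAt l (exp σ)⁻¹ (exp σ) ∧
      ∀ᶠ z in nhds (exp σ), ∀ k, F z k = (g k (l z)).re := by
  obtain ⟨l, hl1, hla, hl2, hl3⟩ := exists_log_branch σ
  refine ⟨l, hl1, hla, hl2, ?_⟩
  have hF' : ∀ᶠ σ' in nhds (l (exp σ)), ∀ k, F (exp σ') k = (g k σ').re := by rwa [hl1]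
  filter_upwards [hl2.continuousAt.eventually hF', hl3] with z hz1 hz2 k
  rw [← hz1, hz2]

lemma fderiv_of_exp_eq_re {σ : ℂ} (hg : ∀ k, HasDerivAt (g k) (d k) σ)
    (hF : ∀ᶠ σ' in nhds σ, ∀ k, F (exp σ') k = (g k σ').re) :
    DifferentiableAt ℝ F (exp σ) ∧ (∀ v k, (fderiv ℝ F (exp σ) v) k = (d k * (exp σ)⁻¹ * v).re) ∧
      ∀ k, phi F k (exp σ) = d k * (exp σ)⁻¹ := by
  obtain ⟨l, hl1, -, hl2, hl3⟩ := eventually_re_of_exp hF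
  have hg' : ∀ k, HasDerivAt (fun z => g k (l z)) (d k * (exp σ)⁻¹) (exp σ) := fun k => by
    have h := hg k
    rw [← hl1] at h
    exact h.comp (exp σ) hl2
  have := fderiv_of_eq_re (d := fun k => d k * (exp σ)⁻¹) hg' hl3
  exact ⟨this.1, this.2, phi_of_eq_re (d := fun k => d k * (exp σ)⁻¹) hg' hl3⟩

lemma harmonicAt_E3 {z : ℂ}
    (h : ∀ k, InnerProductSpace.HarmonicAt (fun w => F w k) z) :
    InnerProductSpace.HarmonicAt F z := by
  have e : F = (fun w => F w 0 • (EuclideanSpace.single 0 1 : E3)) +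
      (fun w => F w 1 • (EuclideanSpace.single 1 1 : E3)) +
      fun w => F w 2 • (EuclideanSpace.single 2 1 : E3) := by
    ext w i
    fin_cases i <;> simp
  rw [e]
  have h' : ∀ k, InnerProductSpace.HarmonicAt
      (fun w => F w k • (EuclideanSpace.single k 1 : E3)) z := fun k =>
    (h k).comp_CLM (ContinuousLinearMap.toSpanSingleton ℝ (EuclideanSpace.single k 1 : E3))
  exact ((h' 0).add (h' 1)).add (h' 2)

lemma harmonicAt_of_exp_eq_re {σ : ℂ} (hg : ∀ k, AnalyticAt ℂ (g k) σ)
    (hF : ∀ᶠ σ' in nhds σ, ∀ k, F (exp σ') k = (g k σ').re) :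
    InnerProductSpace.HarmonicAt F (exp σ) := by
  obtain ⟨l, hl1, hla, -, hl3⟩ := eventually_re_of_exp hF
  refine harmonicAt_E3 fun k => ?_
  have h1 : AnalyticAt ℂ (fun z => g k (l z)) (exp σ) :=
    AnalyticAt.fun_comp (by rw [hl1]; exact hg k) hla
  refine (InnerProductSpace.harmonicAt_congr_nhds ?_).1 h1.harmonicAt_re
  filter_upwards [hl3] with z hz using (hz k).symm

/-- A real linear map `v ↦ re (a v)` with `a` a null vector is conformal. -/
lemma conformal_of_null {L : ℂ →L[ℝ] E3} {a : Fin 3 → ℂ} (hL : ∀ v k, (L v) k = (a k * v).re)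
    (ha : a 0 ^ 2 + a 1 ^ 2 + a 2 ^ 2 = 0) : ‖L 1‖ = ‖L I‖ ∧ inner ℝ (L 1) (L I) = 0 := by
  have h1 := congrArg Complex.re ha
  have h2 := congrArg Complex.im ha
  simp [pow_two] at h1 h2
  constructor
  · have : ‖L 1‖ ^ 2 = ‖L I‖ ^ 2 := by
      rw [norm_sq_E3, norm_sq_E3]
      simp only [hL, mul_one, mul_I_re]
      linarith
    exact (pow_left_inj₀ (norm_nonneg _) (norm_nonneg _) two_ne_zero).1 this
  · rw [inner_E3]
    simp only [hL, mul_one, mul_I_re]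
    linarith

end RealParts

/-! ### The model surface -/

/-- The surface with Weierstrass data `G₋ = √μ (z + √2 - z⁻¹)` and `G₊ = √μ (z⁻¹ + √2 - z)`. -/
def modelSurface (μ : ℝ) (w : ℂ) : E3 :=
  !₂[(μ * (2 * Real.sqrt 2 * (w + w⁻¹)) : ℂ).re, (μ * (I / 2 * (w ^ 2 - w⁻¹ ^ 2)) : ℂ).re,
    μ * (4 * Real.log ‖w‖ - ((w ^ 2 - w⁻¹ ^ 2) / 2).re)]

lemma sqrt_two_sq : (Real.sqrt 2 : ℂ) ^ 2 = 2 := by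
  rw [← ofReal_pow, Real.sq_sqrt zero_le_two, ofReal_ofNat]

lemma hasLaurentData_modelSurface {μ : ℝ} (hμ : 0 < μ) :
    HasLaurentData (modelSurface μ) (-(Real.sqrt μ : ℂ)) (Real.sqrt 2 * Real.sqrt μ) (Real.sqrt μ)
      (Real.sqrt μ) (Real.sqrt 2 * Real.sqrt μ) (-(Real.sqrt μ : ℂ)) := by
  have hq : (Real.sqrt μ : ℂ) ≠ 0 := ofReal_ne_zero.2 (Real.sqrt_pos.2 hμ).ne'
  have h2 : (Real.sqrt 2 : ℂ) ≠ 0 := ofReal_ne_zero.2 (Real.sqrt_pos.2 two_pos).ne'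
  have hq2 : (Real.sqrt μ : ℂ) ^ 2 = μ := by rw [← ofReal_pow, Real.sq_sqrt hμ.le]
  have hs2 := sqrt_two_sq
  -- holomorphic functions with the coordinates as real parts, near a given point
  have key : ∀ z : ℂ, z ≠ 0 → ∃ g : Fin 3 → ℂ → ℂ,
      (∀ k, HasDerivAt (g k) ((![μ * (2 * Real.sqrt 2 * (1 - z⁻¹ ^ 2)),
        μ * (I * (z + z⁻¹ ^ 3)), μ * (4 * z⁻¹ - z - z⁻¹ ^ 3)] : Fin 3 → ℂ) k) z) ∧
      ∀ᶠ w in nhds z, ∀ k, modelSurface μ w k = (g k w).re := by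
    intro z hz
    have hinv : HasDerivAt (fun w : ℂ => w⁻¹) (-z⁻¹ ^ 2) z := by
      simpa using hasDerivAt_inv hz
    have hsq : HasDerivAt (fun w : ℂ => w ^ 2 - w⁻¹ ^ 2) (2 * z + 2 * z⁻¹ ^ 3) z := by
      refine ((hasDerivAt_pow 2 z).sub (hinv.fun_pow 2)).congr_deriv ?_
      push_cast
      ring
    have hlog : HasDerivAt (fun w : ℂ => log (w / z) + Real.log ‖z‖) z⁻¹ z := by
      have h1 : HasDerivAt (fun w : ℂ => w / z) (1 / z) z := (hasDerivAt_id _).div_const _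
      refine ((h1.clog (by simp [div_self hz])).add_const _).congr_deriv ?_
      simp [div_self hz]
    refine ⟨![fun w => μ * (2 * Real.sqrt 2 * (w + w⁻¹)), fun w => μ * (I / 2 * (w ^ 2 - w⁻¹ ^ 2)),
      fun w => μ * (4 * (log (w / z) + Real.log ‖z‖) - (w ^ 2 - w⁻¹ ^ 2) / 2)], ?_, ?_⟩
    · intro k
      fin_cases k
      · refine ((((hasDerivAt_id z).add hinv).const_mul (2 * Real.sqrt 2 : ℂ)).const_mul
          (μ : ℂ)).congr_deriv ?_
        simp [sub_eq_add_neg]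
      · refine ((hsq.const_mul (I / 2)).const_mul (μ : ℂ)).congr_deriv ?_
        change _ = μ * (I * (z + z⁻¹ ^ 3))
        ring
      · refine (((hlog.const_mul 4).sub (hsq.div_const 2)).const_mul (μ : ℂ)).congr_deriv ?_
        change _ = μ * (4 * z⁻¹ - z - z⁻¹ ^ 3)
        ring
    · filter_upwards [isOpen_ne.mem_nhds hz] with w hw k
      fin_cases k
      · rfl
      · rfl
      · change μ * (4 * Real.log ‖w‖ - ((w ^ 2 - w⁻¹ ^ 2) / 2).re) =
          (μ * (4 * (log (w / z) + Real.log ‖z‖) - (w ^ 2 - w⁻¹ ^ 2) / 2) : ℂ).re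
        rw [re_ofReal_mul, sub_re, show (4 : ℂ) = ((4 : ℝ) : ℂ) by norm_num, re_ofReal_mul, add_re,
          log_re, ofReal_re, norm_div,
          Real.log_div (norm_ne_zero_iff.2 hw) (norm_ne_zero_iff.2 hz), sub_add_cancel]
  refine ⟨neg_ne_zero.2 hq, mul_ne_zero h2 hq, hq, hq, mul_ne_zero h2 hq, neg_ne_zero.2 hq, ?_, ?_,
    ?_, ?_, ?_, ?_⟩
  · linear_combination (Real.sqrt μ : ℂ) ^ 2 * hs2
  · linear_combination (Real.sqrt μ : ℂ) ^ 2 * hs2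
  · intro z hz
    obtain ⟨g, h1, h2⟩ := key z hz
    exact (fderiv_of_eq_re h1 h2).1
  all_goals
    intro z hz
    obtain ⟨g, h1, h3⟩ := key z hz
    rw [phi_of_eq_re h1 h3]
    simp only [laurent, Matrix.cons_val]
  · rw [← hq2]
    field_simp
    ring
  · rw [← hq2]
    field_simp
    linear_combination (-z ^ 2 * 2) * hs2
  · rw [← hq2]
    field_simp
    linear_combination (-z ^ 2) * hs2

/-! ### The conformal parametrization by a round annulus -/

/-- The conformal parametrization `e^σ ↦ e^{chartInv σ}` of a neighbourhood of the unit circle in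
which the height of the model surface becomes a multiple of `log |z|`. -/
def modelParam (z : ℂ) : ℂ := exp (chartInv (log z))

lemma modelParam_exp {σ : ℂ} (hσ : |σ.re| ≤ 1 / 5) : modelParam (exp σ) = exp (chartInv σ) := by
  obtain ⟨n, hn⟩ := exp_eq_exp_iff_exists_int.1 (exp_log (exp_ne_zero σ))
  rw [modelParam, hn, chartInv_add_int_mul hσ]
  exact exp_eq_exp_iff_exists_int.2 ⟨n, rfl⟩

lemma hasDerivAt_modelParam {σ : ℂ} (hσ : |σ.re| < 1 / 5) :
    HasDerivAt modelParam (exp (chartInv σ) * (1 - cosh (2 * chartInv σ) / 2)⁻¹ * (exp σ)⁻¹)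
      (exp σ) := by
  refine hasDerivAt_of_exp (hasDerivAt_chartInv hσ).cexp ?_
  filter_upwards [(isOpen_reStrip _).mem_nhds hσ] with σ' (hσ' : |σ'.re| < 1 / 5)
  exact modelParam_exp hσ'.le

/-- The model annulus, a conformally parametrized piece of the model surface. -/
def modelAnnulus (μ : ℝ) (z : ℂ) : E3 := modelSurface μ (modelParam z)

/-- The holomorphic functions of `σ = log z` whose real parts are the coordinates. -/
def modelPrimitive (μ : ℝ) : Fin 3 → ℂ → ℂ :=
  ![fun σ => μ * (4 * Real.sqrt 2 * cosh (chartInv σ)), fun σ => μ * (I * sinh (2 * chartInv σ)),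
    fun σ => μ * (4 * σ)]

/-- The derivatives of the functions `modelPrimitive`. -/
def modelForm (μ : ℝ) (σ : ℂ) : Fin 3 → ℂ :=
  ![μ * (4 * Real.sqrt 2 * (sinh (chartInv σ) * (1 - cosh (2 * chartInv σ) / 2)⁻¹)),
    μ * (I * (cosh (2 * chartInv σ) * (2 * (1 - cosh (2 * chartInv σ) / 2)⁻¹))), μ * 4]

lemma modelAnnulus_exp (μ : ℝ) {σ : ℂ} (hσ : |σ.re| ≤ 1 / 5) (k : Fin 3) :
    modelAnnulus μ (exp σ) k = (modelPrimitive μ k σ).re := by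
  have h1 : ∀ τ : ℂ, exp τ + (exp τ)⁻¹ = 2 * cosh τ := fun τ => by
    rw [← exp_neg, Complex.cosh]; ring
  have h2 : ∀ τ : ℂ, exp τ ^ 2 - (exp τ)⁻¹ ^ 2 = 2 * sinh (2 * τ) := fun τ => by
    rw [← exp_neg, ← exp_nat_mul, ← exp_nat_mul, Complex.sinh, Nat.cast_ofNat, mul_neg]; ring
  fin_cases k <;> simp only [modelAnnulus, modelParam_exp hσ, modelSurface, h1, h2]
  · change (_ : ℂ).re = (μ * (4 * Real.sqrt 2 * cosh (chartInv σ)) : ℂ).re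
    congr 1
    ring
  · change (_ : ℂ).re = (μ * (I * sinh (2 * chartInv σ)) : ℂ).re
    congr 1
    ring
  · change μ * (_ - _) = (μ * (4 * σ) : ℂ).re
    rw [norm_exp, Real.log_exp, re_ofReal_mul]
    conv_rhs => rw [← heightChart_chartInv hσ, heightChart]
    rw [show 4 * (chartInv σ - sinh (2 * chartInv σ) / 4) =
      ((4 : ℝ) : ℂ) * chartInv σ - 2 * sinh (2 * chartInv σ) / 2 by push_cast; ring, sub_re,
      re_ofReal_mul]

lemma eventually_modelAnnulus_exp (μ : ℝ) {σ : ℂ} (hσ : |σ.re| < 1 / 5) :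
    ∀ᶠ σ' in nhds σ, ∀ k, modelAnnulus μ (exp σ') k = (modelPrimitive μ k σ').re := by
  filter_upwards [(isOpen_reStrip _).mem_nhds hσ] with σ' (hσ' : |σ'.re| < 1 / 5) k
  exact modelAnnulus_exp μ hσ'.le k

lemma hasDerivAt_modelPrimitive (μ : ℝ) {σ : ℂ} (hσ : |σ.re| < 1 / 5) (k : Fin 3) :
    HasDerivAt (modelPrimitive μ k) (modelForm μ σ k) σ := by
  have h := hasDerivAt_chartInv hσ
  have h2 : HasDerivAt (fun σ => 2 * chartInv σ)
      (2 * (1 - cosh (2 * chartInv σ) / 2)⁻¹) σ := h.const_mul 2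
  fin_cases k
  · exact (h.ccosh.const_mul _).const_mul _
  · exact (h2.csinh.const_mul _).const_mul _
  · simpa [modelPrimitive, modelForm] using! ((hasDerivAt_id σ).const_mul 4).const_mul (μ : ℂ)

lemma analyticAt_modelPrimitive (μ : ℝ) {σ : ℂ} (hσ : |σ.re| < 1 / 5) (k : Fin 3) :
    AnalyticAt ℂ (modelPrimitive μ k) σ :=
  DifferentiableOn.analyticAt (s := {σ : ℂ | |σ.re| < 1 / 5})
    (fun _ h => (hasDerivAt_modelPrimitive μ h k).differentiableAt.differentiableWithinAt)
    ((isOpen_reStrip _).mem_nhds hσ)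

/-- Conformality: the coordinate differentials form a null vector. -/
lemma modelForm_null (μ : ℝ) {σ : ℂ} (hσ : |σ.re| < 1 / 5) :
    modelForm μ σ 0 ^ 2 + modelForm μ σ 1 ^ 2 + modelForm μ σ 2 ^ 2 = 0 := by
  have h0 := one_sub_cosh_ne_zero (chartInv_mem hσ.le)
  simp only [modelForm, Matrix.cons_val]
  have h1 := cosh_two_mul (chartInv σ)
  have h2 := cosh_sq (chartInv σ)
  have h3 := I_sq
  have h4 := sqrt_two_sq
  rw [h2] at h1
  generalize cosh (2 * chartInv σ) = C at *
  generalize sinh (chartInv σ) = s at *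
  generalize (Real.sqrt 2 : ℂ) = q at *
  have h6 : (1 - C / 2) * (1 - C / 2)⁻¹ = 1 := mul_inv_cancel₀ h0
  generalize (1 - C / 2)⁻¹ = y at *
  linear_combination μ ^ 2 * (16 * s ^ 2 * y ^ 2) * h4 + μ ^ 2 * (4 * C ^ 2 * y ^ 2) * h3 -
    16 * μ ^ 2 * y ^ 2 * h1 - 16 * μ ^ 2 * ((1 - C / 2) * y + 1) * h6

/-! ### The logarithm of the Gauss map -/

/-- The function `p = √2 sinh τ`, in terms of which the Gauss map is `(1 - p) / (1 + p)`. -/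
def gaussParam (σ : ℂ) : ℂ := Real.sqrt 2 * sinh (chartInv σ)

/-- A logarithm of the Gauss map of the model annulus, in the coordinate `σ = log z`. -/
def logGauss (σ : ℂ) : ℂ := log (1 - gaussParam σ) - log (1 + gaussParam σ)

/-- `1 - p²` is twice the derivative of `heightChart`. -/
lemma one_sub_gaussParam_sq (σ : ℂ) :
    1 - gaussParam σ ^ 2 = 2 * (1 - cosh (2 * chartInv σ) / 2) := by
  have h1 := cosh_two_mul (chartInv σ)
  rw [cosh_sq] at h1
  rw [gaussParam, mul_pow, sqrt_two_sq, h1]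
  ring

/-- `p` omits the real numbers outside `(-1, 1)`: it is real only where `sin (im τ) = 0`. -/
lemma abs_re_gaussParam_lt {σ : ℂ} (hσ : |σ.re| ≤ 1 / 5) (him : (gaussParam σ).im = 0) :
    |(gaussParam σ).re| < 1 := by
  set τ := chartInv σ with hτ
  have hs : sinh τ = (Real.sinh τ.re * Real.cos τ.im : ℝ) +
      (Real.cosh τ.re * Real.sin τ.im : ℝ) * I := by
    conv_lhs => rw [← re_add_im τ]
    rw [sinh_add, sinh_mul_I, cosh_mul_I]
    push_cast
    ring
  have h1 : (gaussParam σ).im = Real.sqrt 2 * (Real.cosh τ.re * Real.sin τ.im) := by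
    rw [gaussParam, ← hτ, hs, im_ofReal_mul]
    simp [-ofReal_mul]
  have h2 : (gaussParam σ).re = Real.sqrt 2 * (Real.sinh τ.re * Real.cos τ.im) := by
    rw [gaussParam, ← hτ, hs, re_ofReal_mul]
    simp [-ofReal_mul]
  have hsin : Real.sin τ.im = 0 := by
    rw [h1] at him
    rcases mul_eq_zero.1 him with h | h
    · exact absurd h (Real.sqrt_pos.2 two_pos).ne'
    · exact (mul_eq_zero.1 h).resolve_left (Real.cosh_pos _).ne'
  -- `2 sinh² (re τ) = cosh (2 re τ) - 1 < 1` on the strip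
  have h3 := cosh_two_mul_re_le (chartInv_mem hσ)
  rw [Real.cosh_two_mul, Real.cosh_sq] at h3
  rw [← sq_lt_one_iff_abs_lt_one, h2, mul_pow, mul_pow, Real.sq_sqrt zero_le_two, Real.cos_sq',
    hsin]
  linarith

lemma one_sub_gaussParam_mem {σ : ℂ} (hσ : |σ.re| ≤ 1 / 5) : 1 - gaussParam σ ∈ slitPlane := by
  rw [mem_slitPlane_iff]
  by_cases h : (gaussParam σ).im = 0
  · left
    have := (abs_lt.1 (abs_re_gaussParam_lt hσ h)).2
    simpa using this
  · right
    simpa using h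

lemma one_add_gaussParam_mem {σ : ℂ} (hσ : |σ.re| ≤ 1 / 5) : 1 + gaussParam σ ∈ slitPlane := by
  rw [mem_slitPlane_iff]
  by_cases h : (gaussParam σ).im = 0
  · left
    have := (abs_lt.1 (abs_re_gaussParam_lt hσ h)).1
    simp
    linarith
  · right
    simpa using h

/-- The derivative of `logGauss`. -/
def logGaussDeriv (σ : ℂ) : ℂ :=
  -(Real.sqrt 2 * cosh (chartInv σ) * (1 - cosh (2 * chartInv σ) / 2)⁻¹ ^ 2)

lemma hasDerivAt_logGauss {σ : ℂ} (hσ : |σ.re| < 1 / 5) :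
    HasDerivAt logGauss (logGaussDeriv σ) σ := by
  have hp : HasDerivAt gaussParam
      (Real.sqrt 2 * (cosh (chartInv σ) * (1 - cosh (2 * chartInv σ) / 2)⁻¹)) σ :=
    (hasDerivAt_chartInv hσ).csinh.const_mul _
  have h1 := one_sub_gaussParam_mem hσ.le
  have h2 := one_add_gaussParam_mem hσ.le
  refine (((hp.const_sub 1).clog h1).sub ((hp.const_add 1).clog h2)).congr_deriv ?_
  have h3 := slitPlane_ne_zero h1
  have h4 := slitPlane_ne_zero h2
  have h5 := one_sub_gaussParam_sq σ
  have h6 := one_sub_cosh_ne_zero (chartInv_mem hσ.le)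
  rw [logGaussDeriv]
  generalize gaussParam σ = p at *
  generalize 1 - cosh (2 * chartInv σ) / 2 = y at *
  field_simp
  linear_combination cosh (chartInv σ) * h5

lemma exp_logGauss {σ : ℂ} (hσ : |σ.re| ≤ 1 / 5) :
    exp (logGauss σ) = (1 - gaussParam σ) / (1 + gaussParam σ) := by
  rw [logGauss, exp_sub, exp_log (slitPlane_ne_zero (one_sub_gaussParam_mem hσ)),
    exp_log (slitPlane_ne_zero (one_add_gaussParam_mem hσ))]

lemma modelForm_zero (μ : ℝ) (σ : ℂ) :
    modelForm μ σ 0 = 4 * μ * gaussParam σ * (1 - cosh (2 * chartInv σ) / 2)⁻¹ := by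
  change μ * (4 * Real.sqrt 2 * (sinh (chartInv σ) * (1 - cosh (2 * chartInv σ) / 2)⁻¹)) = _
  rw [gaussParam]
  ring

lemma modelForm_one (μ : ℝ) (σ : ℂ) :
    modelForm μ σ 1 = 2 * μ * I * (1 + gaussParam σ ^ 2) *
      (1 - cosh (2 * chartInv σ) / 2)⁻¹ := by
  change μ * (I * (cosh (2 * chartInv σ) * (2 * (1 - cosh (2 * chartInv σ) / 2)⁻¹))) = _
  have : 1 + gaussParam σ ^ 2 = cosh (2 * chartInv σ) := by
    linear_combination -one_sub_gaussParam_sq σ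
  rw [this]
  ring

lemma gaussMap_modelAnnulus {μ : ℝ} (hμ : 0 < μ) {σ : ℂ} (hσ : |σ.re| < 1 / 5) :
    gaussMap (modelAnnulus μ) (exp σ) = exp (logGauss σ) := by
  have hphi := (fderiv_of_exp_eq_re (hasDerivAt_modelPrimitive μ hσ)
    (eventually_modelAnnulus_exp μ hσ)).2.2
  rw [gaussMap, hphi, hphi, hphi, exp_logGauss hσ.le]
  have h1 := slitPlane_ne_zero (one_add_gaussParam_mem hσ.le)
  have h5 := one_sub_gaussParam_sq σ
  have h6 := one_sub_cosh_ne_zero (chartInv_mem hσ.le)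
  have hμ' : (μ : ℂ) ≠ 0 := ofReal_ne_zero.2 hμ.ne'
  have e0 := modelForm_zero μ σ
  have e1 := modelForm_one μ σ
  have e2 : modelForm μ σ 2 = μ * 4 := rfl
  have e3 : modelForm μ σ 0 * (exp σ)⁻¹ - I * (modelForm μ σ 1 * (exp σ)⁻¹) =
      2 * μ * (1 + gaussParam σ) ^ 2 * (1 - cosh (2 * chartInv σ) / 2)⁻¹ * (exp σ)⁻¹ := by
    rw [e0, e1]
    linear_combination (-2 * μ * (1 + gaussParam σ ^ 2) * (1 - cosh (2 * chartInv σ) / 2)⁻¹ *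
      (exp σ)⁻¹) * I_sq
  rw [e3, e2]
  have h0 := exp_ne_zero σ
  generalize gaussParam σ = p at *
  generalize 1 - cosh (2 * chartInv σ) / 2 = y at *
  field_simp
  linear_combination -2 * h5

lemma logGauss_log_exp {σ : ℂ} (hσ : |σ.re| ≤ 1 / 5) : logGauss (log (exp σ)) = logGauss σ := by
  obtain ⟨n, hn⟩ := exp_eq_exp_iff_exists_int.1 (exp_log (exp_ne_zero σ))
  have h : gaussParam (log (exp σ)) = gaussParam σ := by
    have e1 : exp (chartInv σ + n * (2 * Real.pi * I)) = exp (chartInv σ) :=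
      exp_eq_exp_iff_exists_int.2 ⟨n, rfl⟩
    have e2 : exp (-(chartInv σ + n * (2 * Real.pi * I))) = exp (-chartInv σ) :=
      exp_eq_exp_iff_exists_int.2 ⟨-n, by push_cast; ring⟩
    rw [gaussParam, gaussParam, hn, chartInv_add_int_mul hσ, Complex.sinh, Complex.sinh, e1, e2]
  rw [logGauss, logGauss, h]

/-! ### The model annulus is a minimal annulus -/

lemma mem_annulus_exp {δ : ℝ} {σ : ℂ} :
    exp σ ∈ annulus (Real.exp (-δ)) (Real.exp δ) ↔ |σ.re| < δ := by
  simp [annulus, norm_exp, abs_lt]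

lemma exists_exp_of_mem_annulus {δ : ℝ} {z : ℂ} (hz : z ∈ annulus (Real.exp (-δ)) (Real.exp δ)) :
    ∃ σ : ℂ, |σ.re| < δ ∧ exp σ = z := by
  have h0 : z ≠ 0 := norm_pos_iff.1 ((Real.exp_pos _).trans hz.1)
  have h := exp_log h0
  exact ⟨log z, mem_annulus_exp.1 (by rwa [h]), h⟩

section Model

variable {μ δ : ℝ}

lemma modelAnnulus_height {σ : ℂ} (hσ : |σ.re| ≤ 1 / 5) :
    modelAnnulus μ (exp σ) 2 = 4 * μ * σ.re := by
  rw [modelAnnulus_exp μ hσ]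
  change (μ * (4 * σ) : ℂ).re = _
  rw [re_ofReal_mul, show (4 : ℂ) = ((4 : ℝ) : ℂ) by norm_num, re_ofReal_mul]
  ring

lemma isMinimalAnnulus_modelAnnulus (hμ : 0 < μ) (hδ : 0 < δ) (hδ' : δ ≤ 1 / 5) :
    IsMinimalAnnulus (4 * μ * δ) (Real.exp (-δ)) (Real.exp δ) (modelAnnulus μ) := by
  have hdata : ∀ σ : ℂ, |σ.re| < δ → _ := fun σ hσ =>
    fderiv_of_exp_eq_re (hasDerivAt_modelPrimitive μ (hσ.trans_le hδ'))
      (eventually_modelAnnulus_exp μ (hσ.trans_le hδ'))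
  refine ⟨by positivity, Real.exp_pos _, Real.exp_lt_exp.2 (by linarith), ?_, ?_, ?_, ?_, ?_⟩
  · intro z hz
    obtain ⟨σ, hσ, rfl⟩ := exists_exp_of_mem_annulus hz
    change -(4 * μ * δ) < modelAnnulus μ (exp σ) 2 ∧ modelAnnulus μ (exp σ) 2 < 4 * μ * δ
    rw [modelAnnulus_height (hσ.le.trans hδ'), ← abs_lt, abs_mul, abs_of_pos (by positivity)]
    exact mul_lt_mul_of_pos_left hσ (by positivity)
  · intro K hK hKc
    rcases K.eq_empty_or_nonempty with rfl | hne
    · simp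
    have hcont : Continuous fun x : E3 => |x 2| :=
      continuous_abs.comp (EuclideanSpace.proj 2 : E3 →L[ℝ] ℝ).continuous
    obtain ⟨x, hx, hmax⟩ := hKc.exists_isMaxOn hne hcont.continuousOn
    have hxm : |x 2| < 4 * μ * δ := abs_lt.2 (hK hx)
    -- the preimage stays in a smaller closed annulus
    set m := |x 2| / (4 * μ) with hm
    have hmδ : m < δ := by rw [hm, div_lt_iff₀ (by positivity)]; linarith
    set B : Set ℂ := {z | Real.exp (-m) ≤ ‖z‖ ∧ ‖z‖ ≤ Real.exp m} with hB
    have hBc : IsCompact B := by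
      refine (isCompact_closedBall (0 : ℂ) (Real.exp m)).of_isClosed_subset
        ((isClosed_le continuous_const continuous_norm).inter
          (isClosed_le continuous_norm continuous_const)) fun z hz => ?_
      simpa using hz.2
    have hBA : B ⊆ annulus (Real.exp (-δ)) (Real.exp δ) := fun z hz =>
      ⟨(Real.exp_lt_exp.2 (by linarith)).trans_le hz.1, hz.2.trans_lt (Real.exp_lt_exp.2 hmδ)⟩
    have hFB : ContinuousOn (modelAnnulus μ) B := by
      intro z hz
      obtain ⟨σ, hσ, rfl⟩ := exists_exp_of_mem_annulus (hBA hz)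
      exact (hdata σ hσ).1.continuousAt.continuousWithinAt
    have heq : annulus (Real.exp (-δ)) (Real.exp δ) ∩ modelAnnulus μ ⁻¹' K =
        B ∩ modelAnnulus μ ⁻¹' K := by
      refine Subset.antisymm (fun z hz => ⟨?_, hz.2⟩) fun z hz => ⟨hBA hz.1, hz.2⟩
      obtain ⟨σ, hσ, rfl⟩ := exists_exp_of_mem_annulus hz.1
      have h1 : |modelAnnulus μ (exp σ) 2| ≤ |x 2| := hmax hz.2
      rw [modelAnnulus_height (hσ.le.trans hδ'), abs_mul, abs_of_pos (by positivity),
        ← le_div_iff₀' (by positivity), ← hm, abs_le] at h1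
      simpa [hB, norm_exp] using h1
    rw [heq]
    exact hBc.of_isClosed_subset
      (hFB.preimage_isClosed_of_isClosed hBc.isClosed hKc.isClosed) inter_subset_left
  · intro z hz
    obtain ⟨σ, hσ, rfl⟩ := exists_exp_of_mem_annulus hz
    exact harmonicAt_of_exp_eq_re (analyticAt_modelPrimitive μ (hσ.trans_le hδ'))
      (eventually_modelAnnulus_exp μ (hσ.trans_le hδ'))
  · intro z hz
    obtain ⟨σ, hσ, rfl⟩ := exists_exp_of_mem_annulus hz
    refine conformal_of_null (a := fun k => modelForm μ σ k * (exp σ)⁻¹) (hdata σ hσ).2.1 ?_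
    linear_combination (exp σ)⁻¹ ^ 2 * modelForm_null μ (hσ.trans_le hδ')
  · intro z hz h0
    obtain ⟨σ, hσ, rfl⟩ := exists_exp_of_mem_annulus hz
    have h1 := (hdata σ hσ).2.2 2
    have h3 := (conformal_of_null (a := fun k => modelForm μ σ k * (exp σ)⁻¹) (hdata σ hσ).2.1
      (by linear_combination (exp σ)⁻¹ ^ 2 * modelForm_null μ (hσ.trans_le hδ'))).1
    have h4 : partialY (modelAnnulus μ) (exp σ) = 0 := by
      rw [← norm_eq_zero, partialY, ← h3, norm_eq_zero]; exact h0
    rw [phi, h0, h4] at h1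
    have h5 : modelForm μ σ 2 = μ * 4 := rfl
    rw [h5] at h1
    have hμ' : (μ : ℂ) ≠ 0 := ofReal_ne_zero.2 hμ.ne'
    have := exp_ne_zero σ
    simp [hμ'] at h1

lemma hasWindingNumber_modelAnnulus (hμ : 0 < μ) (hδ' : δ ≤ 1 / 5) :
    HasWindingNumber (modelAnnulus μ) (Real.exp (-δ)) (Real.exp δ) 0 := by
  refine ⟨fun z hz => ?_, fun r hr => ?_⟩
  · obtain ⟨σ, hσ, rfl⟩ := exists_exp_of_mem_annulus hz
    rw [gaussMap_modelAnnulus hμ (hσ.trans_le hδ')]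
    exact exp_ne_zero _
  · have hr0 : 0 < r := (Real.exp_pos _).trans hr.1
    rw [Int.cast_zero, mul_zero]
    refine circleIntegral.integral_eq_zero_of_hasDerivWithinAt hr0.le
      (f := fun z => logGauss (log z)) fun z hz => HasDerivAt.hasDerivWithinAt ?_
    have hzr : ‖z‖ = r := by simpa using hz
    obtain ⟨σ, hσ, rfl⟩ := exists_exp_of_mem_annulus (δ := δ) (z := z)
      (by rw [annulus, mem_ofPred_eq, hzr]; exact hr)
    have hσ' := hσ.trans_le hδ'
    have hev : ∀ᶠ σ' in nhds σ, |σ'.re| < 1 / 5 := (isOpen_reStrip _).mem_nhds hσ'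
    have hL := hasDerivAt_logGauss hσ'
    have h1 : HasDerivAt (fun z => logGauss (log z)) (logGaussDeriv σ * (exp σ)⁻¹) (exp σ) :=
      hasDerivAt_of_exp hL (by filter_upwards [hev] with σ' h using logGauss_log_exp h.le)
    have h2 : HasDerivAt (gaussMap (modelAnnulus μ))
        (exp (logGauss σ) * logGaussDeriv σ * (exp σ)⁻¹) (exp σ) :=
      hasDerivAt_of_exp hL.cexp (by
        filter_upwards [hev] with σ' h using gaussMap_modelAnnulus hμ h)
    rw [h2.deriv, gaussMap_modelAnnulus hμ hσ']
    refine h1.congr_deriv ?_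
    have := exp_ne_zero (logGauss σ)
    field_simp

lemma modelPrimitive_add_two_pi {σ : ℂ} (hσ : |σ.re| ≤ 1 / 5) :
    modelPrimitive μ 0 (σ + 2 * Real.pi * I) = modelPrimitive μ 0 σ ∧
    modelPrimitive μ 1 (σ + 2 * Real.pi * I) = modelPrimitive μ 1 σ := by
  have h : chartInv (σ + 2 * Real.pi * I) = chartInv σ + 2 * Real.pi * I := by
    simpa using chartInv_add_int_mul hσ 1
  have e1 : exp (chartInv σ + 2 * Real.pi * I) = exp (chartInv σ) := exp_periodic _
  have e2 : exp (-(chartInv σ + 2 * Real.pi * I)) = exp (-chartInv σ) :=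
    exp_eq_exp_iff_exists_int.2 ⟨-1, by push_cast; ring⟩
  have e3 : exp (2 * (chartInv σ + 2 * Real.pi * I)) = exp (2 * chartInv σ) :=
    exp_eq_exp_iff_exists_int.2 ⟨2, by push_cast; ring⟩
  have e4 : exp (-(2 * (chartInv σ + 2 * Real.pi * I))) = exp (-(2 * chartInv σ)) :=
    exp_eq_exp_iff_exists_int.2 ⟨-2, by push_cast; ring⟩
  constructor
  · change (μ * (4 * Real.sqrt 2 * cosh (chartInv (σ + 2 * Real.pi * I))) : ℂ) =
      μ * (4 * Real.sqrt 2 * cosh (chartInv σ))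
    rw [h, Complex.cosh, Complex.cosh, e1, e2]
  · change (μ * (I * sinh (2 * chartInv (σ + 2 * Real.pi * I))) : ℂ) =
      μ * (I * sinh (2 * chartInv σ))
    rw [h, Complex.sinh, Complex.sinh, e3, e4]

lemma hasVerticalFlux_modelAnnulus (hμ : 0 < μ) (hδ : 0 < δ) (hδ' : δ ≤ 1 / 5) :
    HasVerticalFlux (modelAnnulus μ) (Ioo (Real.exp (-δ)) (Real.exp δ)) (8 * Real.pi * μ) := by
  have hF := isMinimalAnnulus_modelAnnulus hμ hδ hδ'
  intro r hr
  have hr0 : 0 < r := (Real.exp_pos _).trans hr.1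
  set t := Real.log r with ht
  have htm : t ∈ Ioo (Real.log (Real.exp (-δ))) (Real.log (Real.exp δ)) :=
    ⟨Real.log_lt_log (Real.exp_pos _) hr.1, Real.log_lt_log hr0 hr.2⟩
  have htδ : |t| < δ := by
    rw [Real.log_exp, Real.log_exp] at htm
    exact abs_lt.2 htm
  have hσ : ∀ θ : ℝ, |((t : ℂ) + θ * I).re| < 1 / 5 := fun θ => by
    simpa using htδ.trans_le hδ'
  have hrad : Continuous fun θ : ℝ =>
      fderiv ℝ (modelAnnulus μ) (logPolar (t, θ)) (logPolar (t, θ)) :=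
    continuous_radial fun θ => hF.contDiffAt (hF.logPolar_mem (p := (t, θ)) htm)
  have hcoord : ∀ (k : Fin 3) (θ : ℝ),
      (fderiv ℝ (modelAnnulus μ) (logPolar (t, θ)) (logPolar (t, θ))) k =
        (modelForm μ (t + θ * I) k).re := by
    intro k θ
    have h1 := (fderiv_of_exp_eq_re (hasDerivAt_modelPrimitive μ (hσ θ))
      (eventually_modelAnnulus_exp μ (hσ θ))).2.1 (exp (t + θ * I)) k
    rw [inv_mul_cancel_right₀ (exp_ne_zero _)] at h1
    exact h1
  have hflux : ∀ k : Fin 3, flux (modelAnnulus μ) r k =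
      (modelPrimitive μ k (t + 2 * Real.pi * I)).im - (modelPrimitive μ k t).im := by
    intro k
    have h1 := flux_apply (F := modelAnnulus μ) (t := t) k hrad
      fun θ => (hF.norm_radial (p := (t, θ)) htm).symm
    rw [ht, Real.exp_log hr0, ← ht] at h1
    rw [h1]
    have hd : ∀ θ : ℝ, HasDerivAt (fun θ : ℝ => (modelPrimitive μ k (t + θ * I)).im)
        ((fderiv ℝ (modelAnnulus μ) (logPolar (t, θ)) (logPolar (t, θ))) k) θ := by
      intro θ
      have h2 : HasDerivAt (fun θ : ℝ => (t : ℂ) + θ * I) (1 * I) θ :=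
        ((hasDerivAt_id θ).ofReal_comp.mul_const I).const_add _
      have h3 := (hasDerivAt_modelPrimitive μ (hσ θ) k).comp θ h2
      have h4 := imCLM.hasFDerivAt.comp_hasDerivAt θ h3
      refine h4.congr_deriv ?_
      rw [hcoord]
      simp
    rw [intervalIntegral.integral_eq_sub_of_hasDerivAt (fun θ _ => hd θ)
      (((EuclideanSpace.proj k : E3 →L[ℝ] ℝ).continuous.comp hrad).intervalIntegrable _ _)]
    simp
  have ht0 : |(t : ℂ).re| ≤ 1 / 5 := by simpa using (htδ.trans_le hδ').le
  ext k
  rw [hflux k]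
  fin_cases k
  · simp [(modelPrimitive_add_two_pi (μ := μ) ht0).1]
  · simp [(modelPrimitive_add_two_pi (μ := μ) ht0).2]
  · simp [modelPrimitive]
    ring

lemma isReflectionSymmetric_modelAnnulus (hδ' : δ ≤ 1 / 5) :
    IsReflectionSymmetric (Real.exp (-δ)) (Real.exp δ) (modelAnnulus μ) := by
  intro z hz
  obtain ⟨σ, hσ, rfl⟩ := exists_exp_of_mem_annulus hz
  have hσ1 : |σ.re| ≤ 1 / 5 := hσ.le.trans hδ'
  have hσ2 : |(-(starRingEnd ℂ) σ).re| ≤ 1 / 5 := by simpa using hσ1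
  have h1 : ((Real.exp (-δ) * Real.exp δ : ℝ) : ℂ) / (starRingEnd ℂ) (exp σ) =
      exp (-(starRingEnd ℂ) σ) := by
    rw [← Real.exp_add, neg_add_cancel, Real.exp_zero, ofReal_one, ← exp_conj, exp_neg, one_div]
  rw [h1]
  ext k
  rw [modelAnnulus_exp μ hσ2]
  fin_cases k
  · change (μ * (4 * Real.sqrt 2 * cosh (chartInv (-(starRingEnd ℂ) σ))) : ℂ).re =
      modelAnnulus μ (exp σ) 0
    rw [modelAnnulus_exp μ hσ1, chartInv_neg_conj hσ1, cosh_neg, cosh_conj]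
    change _ = (μ * (4 * Real.sqrt 2 * cosh (chartInv σ)) : ℂ).re
    rw [← conj_re]
    simp
  · change (μ * (I * sinh (2 * chartInv (-(starRingEnd ℂ) σ))) : ℂ).re =
      modelAnnulus μ (exp σ) 1
    rw [modelAnnulus_exp μ hσ1, chartInv_neg_conj hσ1]
    change _ = (μ * (I * sinh (2 * chartInv σ)) : ℂ).re
    have e : sinh (2 * -(starRingEnd ℂ) (chartInv σ)) =
        -(starRingEnd ℂ) (sinh (2 * chartInv σ)) := by
      rw [← sinh_conj, map_mul, map_ofNat, mul_neg, sinh_neg]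
    rw [e]
    simp
  · change (μ * (4 * -(starRingEnd ℂ) σ) : ℂ).re = -(modelAnnulus μ (exp σ) 2)
    rw [modelAnnulus_exp μ hσ1]
    change _ = -(μ * (4 * σ) : ℂ).re
    simp

end Model

/-! ### Length of the level curves of the model annulus -/

/-- The speed of the level curves of the model annulus with `μ = 1`. -/
def modelSpeed (p : ℝ × ℝ) : ℝ := 4 * Real.cosh (logGauss (p.1 + p.2 * I)).re

/-- In terms of the Gauss map `g` the speed is `2 μ (|g| + |g|⁻¹) = 4 μ cosh (log |g|)`. -/
lemma speed_modelAnnulus {μ : ℝ} (hμ : 0 < μ) {t θ : ℝ} (ht : |t| < 1 / 5) :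
    speed (modelAnnulus μ) (t, θ) = μ * modelSpeed (t, θ) := by
  set σ : ℂ := t + θ * I with hσdef
  have hσ : |σ.re| < 1 / 5 := by simpa [hσdef] using ht
  have hv : ∀ k, (fderiv ℝ (modelAnnulus μ) (exp σ) (I * exp σ)) k = -(modelForm μ σ k).im := by
    intro k
    rw [(fderiv_of_exp_eq_re (hasDerivAt_modelPrimitive μ hσ)
      (eventually_modelAnnulus_exp μ hσ)).2.1 (I * exp σ) k,
      show modelForm μ σ k * (exp σ)⁻¹ * (I * exp σ) =
        modelForm μ σ k * I * ((exp σ)⁻¹ * exp σ) by ring, inv_mul_cancel₀ (exp_ne_zero σ)]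
    simp
  have hnull := congrArg Complex.re (modelForm_null μ hσ)
  simp only [pow_two, add_re, mul_re, zero_re] at hnull
  have hsq : ∀ z : ℂ, ‖z‖ ^ 2 = z.re ^ 2 + z.im ^ 2 := fun z => by
    rw [← normSq_eq_norm_sq, normSq_apply]; ring
  have hspeed : 2 * speed (modelAnnulus μ) (t, θ) ^ 2 =
      ‖modelForm μ σ 0‖ ^ 2 + ‖modelForm μ σ 1‖ ^ 2 + ‖modelForm μ σ 2‖ ^ 2 := by
    have : speed (modelAnnulus μ) (t, θ) = ‖fderiv ℝ (modelAnnulus μ) (exp σ) (I * exp σ)‖ := rfl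
    rw [this, norm_sq_E3, hv, hv, hv, hsq, hsq, hsq]
    linarith
  set p := gaussParam σ with hp
  have ha : 0 < ‖1 - p‖ := norm_pos_iff.2 (slitPlane_ne_zero (one_sub_gaussParam_mem hσ.le))
  have hb : 0 < ‖1 + p‖ := norm_pos_iff.2 (slitPlane_ne_zero (one_add_gaussParam_mem hσ.le))
  set Y := ‖1 - cosh (2 * chartInv σ) / 2‖ with hY
  have hY0 : 0 < Y := norm_pos_iff.2 (one_sub_cosh_ne_zero (chartInv_mem hσ.le))
  have hab : ‖1 - p‖ * ‖1 + p‖ = 2 * Y := by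
    rw [← norm_mul, show (1 - p) * (1 + p) = 1 - p ^ 2 by ring, hp, one_sub_gaussParam_sq, norm_mul,
      norm_ofNat]
  have hsum : ‖1 - p‖ ^ 2 + ‖1 + p‖ ^ 2 = 2 * (1 + ‖p‖ ^ 2) := by
    rw [hsq, hsq, hsq]
    simp only [sub_re, sub_im, add_re, add_im, one_re, one_im]
    ring
  have hpar : ‖1 + p ^ 2‖ ^ 2 + (2 * Y) ^ 2 = 2 * (1 + ‖p‖ ^ 4) := by
    rw [← hab, ← norm_mul, show (1 - p) * (1 + p) = 1 - p ^ 2 by ring,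
      show ‖p‖ ^ 4 = ‖p ^ 2‖ ^ 2 by rw [norm_pow]; ring, hsq, hsq, hsq]
    simp only [sub_re, sub_im, add_re, add_im, one_re, one_im]
    ring
  have hform : 2 * speed (modelAnnulus μ) (t, θ) ^ 2 = 8 * μ ^ 2 * (1 + ‖p‖ ^ 2) ^ 2 / Y ^ 2 := by
    rw [hspeed, modelForm_zero, modelForm_one, ← hp, show modelForm μ σ 2 = μ * 4 from rfl]
    simp only [norm_mul, norm_inv, norm_I, norm_ofNat, norm_real, Real.norm_eq_abs,
      abs_of_pos hμ, ← hY]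
    field_simp
    linear_combination 4 * hpar
  have hcosh : Real.cosh (logGauss σ).re = (1 + ‖p‖ ^ 2) / (2 * Y) := by
    have h1 : Real.exp (logGauss σ).re = ‖1 - p‖ / ‖1 + p‖ := by
      rw [← norm_exp, exp_logGauss hσ.le, norm_div]
    rw [Real.cosh_eq, Real.exp_neg, h1, ← hab]
    field_simp
    linear_combination hsum
  have : speed (modelAnnulus μ) (t, θ) ^ 2 = (μ * modelSpeed (t, θ)) ^ 2 := by
    have h2 : modelSpeed (t, θ) = 4 * Real.cosh (logGauss σ).re := rfl
    rw [h2, hcosh]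
    have h3 : speed (modelAnnulus μ) (t, θ) ^ 2 = 4 * μ ^ 2 * (1 + ‖p‖ ^ 2) ^ 2 / Y ^ 2 := by
      linear_combination hform / 2
    rw [h3]
    field_simp
    ring
  refine (pow_left_inj₀ (norm_nonneg _) ?_ two_ne_zero).1 this
  have := Real.cosh_pos (logGauss σ).re
  exact mul_nonneg hμ.le (mul_nonneg (by norm_num) this.le)

lemma contDiffOn_re_logGauss : ContDiffOn ℝ 3
    (fun p : ℝ × ℝ => (logGauss (p.1 + p.2 * I)).re) (Ioo (-(1 / 5)) (1 / 5) ×ˢ univ) := by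
  have h1 : ContDiff ℝ 3 (fun p : ℝ × ℝ => (p.1 : ℂ) + p.2 * I) :=
    (ofRealCLM.contDiff.comp contDiff_fst).add
      ((ofRealCLM.contDiff.comp contDiff_snd).mul contDiff_const)
  intro p hp
  have hσ : |((p.1 : ℂ) + p.2 * I).re| < 1 / 5 := by simpa [abs_lt] using hp
  have h2 : AnalyticAt ℂ logGauss (p.1 + p.2 * I) :=
    DifferentiableOn.analyticAt (s := {σ : ℂ | |σ.re| < 1 / 5})
      (fun _ h => (hasDerivAt_logGauss h).differentiableAt.differentiableWithinAt)
      ((isOpen_reStrip _).mem_nhds hσ)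
  have h3 : ContDiffAt ℝ 3 logGauss (p.1 + p.2 * I) := (h2.contDiffAt (n := 3)).restrict_scalars ℝ
  exact (reCLM.contDiff.contDiffAt.comp p (h3.comp p h1.contDiffAt)).contDiffWithinAt

lemma partialT_re_logGauss {t θ : ℝ} (ht : t ∈ Ioo (-(1 / 5) : ℝ) (1 / 5)) :
    partialT (fun p : ℝ × ℝ => (logGauss (p.1 + p.2 * I)).re) (t, θ) =
      (logGaussDeriv (t + θ * I)).re := by
  have h1 := hasDerivAt_partialT (θ := θ) (contDiffOn_re_logGauss.of_le (by norm_num)) ht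
  have hσ : |((t : ℂ) + θ * I).re| < 1 / 5 := by simpa [abs_lt] using ht
  have h2 : HasDerivAt (fun t : ℝ => (t : ℂ) + θ * I) 1 t :=
    (hasDerivAt_id t).ofReal_comp.add_const _
  have h3 := reCLM.hasFDerivAt.comp_hasDerivAt t ((hasDerivAt_logGauss hσ).comp t h2)
  refine h1.unique (h3.congr_deriv ?_)
  simp

lemma contDiffOn_modelSpeed : ContDiffOn ℝ 3 modelSpeed (Ioo (-(1 / 5)) (1 / 5) ×ˢ univ) :=
  contDiffOn_const.mul (Real.contDiff_cosh.comp_contDiffOn contDiffOn_re_logGauss)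

/-- On the unit circle the Gauss map has modulus one. -/
lemma re_logGauss_mul_I (θ : ℝ) : (logGauss (θ * I)).re = 0 := by
  have h0 : |((θ : ℂ) * I).re| ≤ 1 / 5 := by simp
  have h1 := chartInv_neg_conj h0
  have h2 : -(starRingEnd ℂ) ((θ : ℂ) * I) = θ * I := by simp
  rw [h2] at h1
  have h3 : (starRingEnd ℂ) (gaussParam (θ * I)) = -gaussParam (θ * I) := by
    conv_rhs => rw [gaussParam, h1, sinh_neg, sinh_conj]
    rw [gaussParam, map_mul, conj_ofReal]
    ring
  have h4 : ‖1 - gaussParam (θ * I)‖ = ‖1 + gaussParam (θ * I)‖ := by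
    rw [← norm_conj, map_sub, map_one, h3, sub_neg_eq_add]
  rw [logGauss, sub_re, log_re, log_re, h4, sub_self]

lemma modelSpeed_zero (θ : ℝ) : modelSpeed (0, θ) = 4 := by
  simp [modelSpeed, re_logGauss_mul_I]

lemma partialT_partialT_modelSpeed (θ : ℝ) :
    partialT (partialT modelSpeed) (0, θ) = 4 * (logGaussDeriv (θ * I)).re ^ 2 := by
  set u : ℝ × ℝ → ℝ := fun p => (logGauss (p.1 + p.2 * I)).re with hu
  have h0 : (0 : ℝ) ∈ Ioo (-(1 / 5) : ℝ) (1 / 5) := by norm_num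
  have hd : ∀ t ∈ Ioo (-(1 / 5) : ℝ) (1 / 5),
      HasDerivAt (fun t => u (t, θ)) (partialT u (t, θ)) t :=
    fun t ht => hasDerivAt_partialT (contDiffOn_re_logGauss.of_le (by norm_num)) ht
  have h1 : ∀ t ∈ Ioo (-(1 / 5) : ℝ) (1 / 5),
      partialT modelSpeed (t, θ) = 4 * (Real.sinh (u (t, θ)) * partialT u (t, θ)) := fun t ht =>
    (hasDerivAt_partialT (contDiffOn_modelSpeed.of_le (by norm_num)) ht).unique
      ((hd t ht).cosh.const_mul 4)
  have h2 := hasDerivAt_partialT (θ := θ)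
    (contDiffOn_partialT contDiffOn_re_logGauss (m := 1) (by norm_num)) h0
  have h3 := hasDerivAt_partialT (θ := θ)
    (contDiffOn_partialT contDiffOn_modelSpeed (m := 1) (by norm_num)) h0
  have h4 := (((hd 0 h0).sinh.mul h2).const_mul 4).congr_of_eventuallyEq
    (f₁ := fun t => partialT modelSpeed (t, θ)) (by
      filter_upwards [isOpen_Ioo.mem_nhds h0] with t ht using h1 t ht)
  have hu0 : u (0, θ) = 0 := by simp [hu, re_logGauss_mul_I]
  have hu1 : partialT u (0, θ) = (logGaussDeriv (θ * I)).re := by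
    rw [hu, partialT_re_logGauss h0]
    simp
  rw [h3.unique h4, hu0, hu1]
  simp
  ring

/-- The substitution `θ = α - sin (2 α) / 4`, where `α` is the argument on the model surface. -/
lemma integral_logGaussDeriv_sq : ∫ θ in (0 : ℝ)..2 * Real.pi, (logGaussDeriv (θ * I)).re ^ 2 =
    2 * ∫ α in (0 : ℝ)..2 * Real.pi, Real.cos α ^ 2 / (1 - Real.cos (2 * α) / 2) ^ 3 := by
  have hsub : ∀ α : ℝ, HasDerivAt (fun α : ℝ => α - Real.sin (2 * α) / 4)
      (1 - Real.cos (2 * α) / 2) α := by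
    intro α
    have h2 : HasDerivAt (fun α : ℝ => 2 * α) 2 α := by
      simpa using (hasDerivAt_id α).const_mul 2
    refine ((hasDerivAt_id α).sub (h2.sin.div_const 4)).congr_deriv ?_
    ring
  have hcont : Continuous fun θ : ℝ => (logGaussDeriv (θ * I)).re ^ 2 := by
    have h0 : (0 : ℝ) ∈ Ioo (-(1 / 5) : ℝ) (1 / 5) := by norm_num
    have h1 := continuous_slice (contDiffOn_partialT contDiffOn_re_logGauss (m := 0)
      (by norm_num)).continuousOn h0
    refine (h1.pow 2).congr fun θ => ?_
    rw [Pi.pow_apply, partialT_re_logGauss h0]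
    simp
  have h := intervalIntegral.integral_comp_mul_deriv (a := 0) (b := 2 * Real.pi)
    (fun α _ => hsub α) (by fun_prop) hcont
  have e : Real.sin (2 * (2 * Real.pi)) = 0 := by
    rw [show 2 * (2 * Real.pi) = (4 : ℕ) * Real.pi by push_cast; ring, Real.sin_nat_mul_pi]
  rw [e] at h
  simp only [mul_zero, Real.sin_zero, zero_div, sub_zero] at h
  rw [← h, ← intervalIntegral.integral_const_mul]
  refine intervalIntegral.integral_congr fun α _ => ?_
  simp only [Function.comp_apply, logGaussDeriv, chartInv_mul_I]
  have h1 : cosh (2 * ((α : ℂ) * I)) = (Real.cos (2 * α) : ℝ) := by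
    rw [← mul_assoc, cosh_mul_I]
    push_cast
    rfl
  have h2 : cosh ((α : ℂ) * I) = (Real.cos α : ℝ) := by rw [cosh_mul_I, ofReal_cos]
  have h3 : -((Real.sqrt 2 : ℂ) * ((Real.cos α : ℝ) : ℂ) *
      (1 - ((Real.cos (2 * α) : ℝ) : ℂ) / 2)⁻¹ ^ 2) =
      ((-(Real.sqrt 2 * Real.cos α * (1 - Real.cos (2 * α) / 2)⁻¹ ^ 2) : ℝ) : ℂ) := by
    push_cast
    rfl
  rw [h1, h2, h3, ofReal_re, neg_sq, mul_pow, mul_pow, Real.sq_sqrt zero_le_two]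
  have : 1 - Real.cos (2 * α) / 2 ≠ 0 := by linarith [Real.cos_le_one (2 * α)]
  field_simp

/-- The length estimate on a neighbourhood of the middle circle, in terms of `t = log |z|`. -/
lemma exists_modelLength_convexity : ∃ δ : ℝ, 0 < δ ∧ δ ≤ 1 / 5 ∧ ∀ t : ℝ, |t| < δ →
    2 * (∫ θ in (0 : ℝ)..2 * Real.pi, modelSpeed (t, θ)) <
      ∫ θ in (0 : ℝ)..2 * Real.pi, partialT (partialT modelSpeed) (t, θ) ∧
    ∫ θ in (0 : ℝ)..2 * Real.pi, partialT (partialT modelSpeed) (t, θ) <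
      4 * (∫ θ in (0 : ℝ)..2 * Real.pi, modelSpeed (t, θ)) := by
  have h0 : (0 : ℝ) ∈ Ioo (-(1 / 5) : ℝ) (1 / 5) := by norm_num
  have hc0 := (hasDerivAt_integral_slice (c := 0) (d := 2 * Real.pi)
    (contDiffOn_modelSpeed.of_le (by norm_num)) h0).continuousAt
  have hc2 := (hasDerivAt_integral_slice (c := 0) (d := 2 * Real.pi) (contDiffOn_partialT
    (contDiffOn_partialT contDiffOn_modelSpeed (m := 2) (by norm_num)) (m := 1)
      (by norm_num)) h0).continuousAt
  have hv0 : ∫ θ in (0 : ℝ)..2 * Real.pi, modelSpeed (0, θ) = 8 * Real.pi := by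
    simp only [modelSpeed_zero, intervalIntegral.integral_const, smul_eq_mul]
    ring
  have hv2 : ∫ θ in (0 : ℝ)..2 * Real.pi, partialT (partialT modelSpeed) (0, θ) =
      80 / 3 * ∫ α in (0 : ℝ)..2 * Real.pi, (2 - Real.cos (2 * α))⁻¹ := by
    simp only [partialT_partialT_modelSpeed, intervalIntegral.integral_const_mul]
    rw [integral_logGaussDeriv_sq, integral_reduction]
    ring
  obtain ⟨hb1, hb2⟩ := integral_inv_two_sub_cos_bounds
  have e1 := (hc0.const_mul 2).eventually_lt hc2 (by rw [hv0, hv2]; linarith)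
  have e2 := hc2.eventually_lt (hc0.const_mul 4) (by rw [hv0, hv2]; linarith)
  obtain ⟨δ, hδ, hball⟩ := Metric.eventually_nhds_iff.1 (e1.and e2)
  refine ⟨min δ (1 / 5), lt_min hδ (by norm_num), min_le_right _ _, fun t ht => ?_⟩
  exact hball (by simpa using ht.trans_le (min_le_left _ _))

lemma hasLengthConvexity_modelAnnulus {μ δ : ℝ} (hμ : 0 < μ) (hδ' : δ ≤ 1 / 5)
    (hconv : ∀ t : ℝ, |t| < δ →
      2 * (∫ θ in (0 : ℝ)..2 * Real.pi, modelSpeed (t, θ)) <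
        ∫ θ in (0 : ℝ)..2 * Real.pi, partialT (partialT modelSpeed) (t, θ) ∧
      ∫ θ in (0 : ℝ)..2 * Real.pi, partialT (partialT modelSpeed) (t, θ) <
        4 * (∫ θ in (0 : ℝ)..2 * Real.pi, modelSpeed (t, θ))) :
    HasLengthConvexity (4 * μ * δ) (Real.exp (-δ)) (Real.exp δ) (8 * Real.pi * μ)
      (modelAnnulus μ) := by
  have hc0 : (4 * μ : ℝ) ≠ 0 := by positivity
  have hdiv : ∀ s ∈ Ioo (-(4 * μ * δ)) (4 * μ * δ), |s / (4 * μ)| < δ := by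
    intro s hs
    rw [abs_div, abs_of_pos (by positivity : 0 < 4 * μ), div_lt_iff₀ (by positivity), mul_comm]
    exact abs_lt.2 hs
  have hheight : ∀ z ∈ annulus (Real.exp (-δ)) (Real.exp δ),
      modelAnnulus μ z 2 = 4 * μ * (Real.log ‖z‖ - 0) := by
    intro z hz
    obtain ⟨σ, hσ, rfl⟩ := exists_exp_of_mem_annulus hz
    rw [modelAnnulus_height (hσ.le.trans hδ'), norm_exp, Real.log_exp, sub_zero]
  have hlev : ∀ s ∈ Ioo (-(4 * μ * δ)) (4 * μ * δ), ∃ r ∈ Ioo (Real.exp (-δ)) (Real.exp δ),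
      ∀ z : ℂ, ‖z‖ = r → modelAnnulus μ z 2 = s := by
    intro s hs
    obtain ⟨h1, h2⟩ := abs_lt.1 (hdiv s hs)
    refine ⟨Real.exp (s / (4 * μ)), ⟨Real.exp_lt_exp.2 h1, Real.exp_lt_exp.2 h2⟩, fun z hz => ?_⟩
    rw [hheight z ⟨by rw [hz]; exact Real.exp_lt_exp.2 h1, by rw [hz]; exact Real.exp_lt_exp.2 h2⟩,
      hz, Real.log_exp, sub_zero, mul_div_cancel₀ _ hc0]
  have hlength : ∀ s ∈ Ioo (-(4 * μ * δ)) (4 * μ * δ),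
      levelLength (modelAnnulus μ) (Real.exp (-δ)) (Real.exp δ) s =
        μ * ∫ θ in (0 : ℝ)..2 * Real.pi, modelSpeed (0 + s / (4 * μ), θ) := by
    intro s hs
    rw [(levelLength_eq (Real.exp_pos _) hc0 hheight hlev hs).2,
      ← intervalIntegral.integral_const_mul]
    refine intervalIntegral.integral_congr fun θ _ => ?_
    exact speed_modelAnnulus hμ (by rw [zero_add]; exact (hdiv s hs).trans_le hδ')
  intro s hs
  have hs' : 0 + s / (4 * μ) ∈ Ioo (-(1 / 5) : ℝ) (1 / 5) := by
    rw [zero_add]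
    exact abs_lt.1 ((hdiv s hs).trans_le hδ')
  have hderiv : deriv (deriv (levelLength (modelAnnulus μ) (Real.exp (-δ)) (Real.exp δ))) s =
      (μ * ∫ θ in (0 : ℝ)..2 * Real.pi, partialT (partialT modelSpeed) (0 + s / (4 * μ), θ)) /
        (4 * μ) ^ 2 := by
    refine deriv_deriv_rescale
      (L := fun t => μ * ∫ θ in (0 : ℝ)..2 * Real.pi, modelSpeed (t, θ))
      (L' := fun t => μ * ∫ θ in (0 : ℝ)..2 * Real.pi, partialT modelSpeed (t, θ)) (t₀ := 0)
      ?_ ?_ ?_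
    · filter_upwards [isOpen_Ioo.mem_nhds hs] with s hs using hlength s hs
    · filter_upwards [isOpen_Ioo.mem_nhds hs'] with t ht
      exact (hasDerivAt_integral_slice (contDiffOn_modelSpeed.of_le (by norm_num)) ht).const_mul μ
    · exact (hasDerivAt_integral_slice
        (contDiffOn_partialT contDiffOn_modelSpeed (by norm_num)) hs').const_mul μ
  have hκ : (2 * Real.pi / (8 * Real.pi * μ)) ^ 2 = 1 / (4 * μ) ^ 2 := by
    have := Real.pi_pos.ne'
    field_simp
    norm_num
  rw [hderiv, hlength s hs, hκ, lt_div_iff₀ (by positivity), div_lt_iff₀ (by positivity)]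
  obtain ⟨h1, h2⟩ := hconv (0 + s / (4 * μ)) (by rw [zero_add]; exact hdiv s hs)
  have hsq : (1 : ℝ) / (4 * μ) ^ 2 * (4 * μ) ^ 2 = 1 := by field_simp
  generalize ∫ θ in (0 : ℝ)..2 * Real.pi, modelSpeed (0 + s / (4 * μ), θ) = A at *
  generalize ∫ θ in (0 : ℝ)..2 * Real.pi, partialT (partialT modelSpeed)
    (0 + s / (4 * μ), θ) = B at *
  rw [show 2 * (1 / (4 * μ) ^ 2) * (μ * A) * (4 * μ) ^ 2 =
      (1 / (4 * μ) ^ 2 * (4 * μ) ^ 2) * (μ * (2 * A)) by ring,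
    show 4 * (1 / (4 * μ) ^ 2) * (μ * A) * (4 * μ) ^ 2 =
      (1 / (4 * μ) ^ 2 * (4 * μ) ^ 2) * (μ * (4 * A)) by ring, hsq, one_mul, one_mul]
  exact ⟨mul_lt_mul_of_pos_left h1 hμ, mul_lt_mul_of_pos_left h2 hμ⟩

theorem exists_isModelAnnulus {H : ℝ} (hH : 0 < H) : ∃ (R₀ R₁ F₃ : ℝ) (F : ℂ → E3),
    IsModelAnnulus H R₀ R₁ F₃ F ∧ IsReflectionSymmetric R₀ R₁ F := by
  obtain ⟨δ, hδ, hδ', hconv⟩ := exists_modelLength_convexity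
  set μ := H / (4 * δ) with hμdef
  have hμ : 0 < μ := by positivity
  have hHμ : H = 4 * μ * δ := by rw [hμdef]; field_simp
  refine ⟨Real.exp (-δ), Real.exp δ, 8 * Real.pi * μ, modelAnnulus μ, ⟨?_, ?_, ?_, ?_, ?_⟩,
    isReflectionSymmetric_modelAnnulus hδ'⟩
  · rw [hHμ]; exact isMinimalAnnulus_modelAnnulus hμ hδ hδ'
  · exact hasWindingNumber_modelAnnulus hμ hδ'
  · exact hasVerticalFlux_modelAnnulus hμ hδ hδ'
  · refine ⟨modelSurface μ, _, _, _, _, _, _, modelParam, hasLaurentData_modelSurface hμ, ?_, ?_,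
      fun z _ => exp_ne_zero _, fun z _ => rfl⟩
    · intro z hz
      obtain ⟨σ, hσ, rfl⟩ := exists_exp_of_mem_annulus hz
      exact (hasDerivAt_modelParam (hσ.trans_le hδ')).differentiableAt.differentiableWithinAt
    · intro z hz w hw h
      obtain ⟨σ, hσ, rfl⟩ := exists_exp_of_mem_annulus hz
      obtain ⟨σ', hσ', rfl⟩ := exists_exp_of_mem_annulus hw
      have h1 : |σ.re| ≤ 1 / 5 := hσ.le.trans hδ'
      have h2 : |σ'.re| ≤ 1 / 5 := hσ'.le.trans hδ'
      rw [modelParam_exp h1, modelParam_exp h2] at h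
      obtain ⟨n, hn⟩ := exp_eq_exp_iff_exists_int.1 h
      rw [← chartInv_add_int_mul h2] at hn
      have h3 := congrArg heightChart hn
      rw [heightChart_chartInv h1, heightChart_chartInv (by simpa using h2)] at h3
      exact exp_eq_exp_iff_exists_int.2 ⟨n, h3⟩
  · rw [hHμ]; exact hasLengthConvexity_modelAnnulus hμ hδ' hconv

end MinAnnuli

end

theorem mainTheorem6 :
    (∀ H : ℝ, 0 < H → ∃ (R₀ R₁ F₃ : ℝ) (F : ℂ → MinAnnuli.E3),
      MinAnnuli.IsModelAnnulus H R₀ R₁ F₃ F ∧ MinAnnuli.IsReflectionSymmetric R₀ R₁ F) ∧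
    ∀ (H R₀ R₁ F₃ : ℝ) (F : ℂ → MinAnnuli.E3),
      MinAnnuli.IsModelAnnulus H R₀ R₁ F₃ F → MinAnnuli.IsReflectionSymmetric R₀ R₁ F →
      ∃ ε : ℝ, 0 < ε ∧ ε ≤ H ∧ ∀ h : ℝ, 0 < h → h < ε →
        ∀ (p q ρ : ℝ) (k : ℤ), 0 < ρ → |k| = 2 →
          MinAnnuli.HasVerticalFlux (MinAnnuli.catenoidCover p q ρ k) (Set.Ioi 0) F₃ →
          MinAnnuli.area F (MinAnnuli.annulus R₀ R₁ ∩ F ⁻¹' MinAnnuli.slab h) <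
            MinAnnuli.area (MinAnnuli.catenoidCover p q ρ k)
              ({z : ℂ | z ≠ 0} ∩ MinAnnuli.catenoidCover p q ρ k ⁻¹' MinAnnuli.slab h) :=
  ⟨fun _ hH => MinAnnuli.exists_isModelAnnulus hH, fun _ _ _ _ _ hF hs =>
    MinAnnuli.exists_area_lt_catenoidCover hF.minimal hF.verticalFlux hF.convexity hs⟩
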